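/- **Setting.** Consider the class of equations $$f(x)u_t=(g(x)u_x)_x+h(x)|u|^m \qquad (u\neq 0),$$ where the arbitrary elements $\theta=(f,g,h,m)$ consist of smooth nonvanishing real functions $f,g,h$ on an open interval $I=I_\theta$ and a real constant $m\ne0,1$. (The modulus makes the power meaningful for either sign of $u$; on $u>0$ this is $f u_t=(gu_x)_x+hu^m$.) Denote the equation by $\mathcal L_\theta$, regarded as a manifold in the second-order jet space over $(t,x\,|\,u)$. A *transformation domain* for $\theta$ is a nonempty connected open set $\Omega$ of points $(t,x,u)$ with $x\in I_\theta$, $u\ne0$, all of whose slices $x=\mathrm{const}$ are connected; $I_\Omega$ denotes its projection to the $x$-axis. An *admissible transformation* from $\mathcal L_\theta$ to $\mathcal L_{\tilde\theta}$ on $\Omega$ is an injective smooth map $(t,x,u)\mapsto(\tilde t,\tilde x,\tilde u)$ on $\Omega$ with nonvanishing Jacobian, taking values in $\{\tilde x\in I_{\tilde\theta},\ \tilde u\neq0\}$, whose second prolongation (where it is defined) maps $\mathcal L_\theta$ to $\mathcal L_{\tilde\theta}$: a 2-jet lies on $\mathcal L_\theta$ iff its image lies on $\mathcal L_{\tilde\theta}$.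 The *generalized extended equivalence group* $\hat G^\sim$ of the class is the set of all families $\Phi$ that assign to every $\theta$ new arbitrary elements $\tilde\theta=\Phi\theta$ of the class, a transformation domain $\Omega_\theta$ and an admissible transformation $\Phi_\theta$ from $\mathcal L_\theta$ to $\mathcal L_{\Phi\theta}$ on $\Omega_\theta$, such that $\Phi_\theta$ depends on $\theta$ in an arbitrary (possibly nonlocal) but continuous way: for every one-parameter family $\theta_s$, $s\in\mathbb R$, of arbitrary elements on a fixed interval $I$ with $f_s(x),g_s(x),h_s(x)$ smooth in $(s,x)$ and $m_s$ smooth in $s$, the set $\{(s,z): z\in\Omega_{\theta_s}\}$ is open and $\Phi_{\theta_s}(z)$ is continuous in $(s,z)$ on it. We say that a map on a transformation domain $\Omega$ of $\theta$, together with $\tilde\theta$, *has the listed form* if $$\tilde t=\delta_1t+\delta_2,\qquad \tilde x=\varphi(x),\qquad \tilde u=\psi(x)u,$$ $$\tilde f=\frac{\delta_0\delta_1}{\varphi_x\psi^2}f,\qquad \tilde g=\frac{\delta_0\varphi_x}{\psi^2}g,\qquad \tilde h=\frac{\delta_0}{\varphi_x\,\psi|\psi|^{m}}h,\qquad \tilde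 m=m$$ (the left-hand sides taken at $\tilde x=\varphi(x)\in I_{\tilde\theta}$, the right-hand sides at $x\in I_\Omega$; for $\psi>0$ one has $\psi|\psi|^m=\psi^{m+1}$) for some constants $\delta_0,\delta_1,\delta_2$ with $\delta_0\delta_1\ne0$, a smooth function $\varphi$ on $I_\Omega$ with $\varphi_x\neq0$, and a smooth nonvanishing solution $\psi$ on $I_\Omega$ of $$\left(\frac{g\psi_x}{\psi^2}\right)_x=0 .$$ **Theorem.** 1. A family $\Phi$ depending continuously on $\theta$ as above belongs to $\hat G^\sim$ if and only if for every $\theta$ the map $\Phi_\theta$ on $\Omega_\theta$ together with $\Phi\theta$ has the listed form. (The parameters $\delta_0,\delta_1,\delta_2,\varphi,\psi$ may depend on $\theta$.) In particular, $m$ is invariant. 2. Conversely, for every $\theta$, every transformation domain $\Omega$ of $\theta$ and every map on $\Omega$ which together with some $\tilde\theta$ has the listed form, there is $\Phi\in\hat G^\sim$ with $\Phi\theta=\tilde\theta$ and $\Omega_\theta=\Omega$ for which $\Phi_\theta$ is the given map on $\Omega$. 3. The transformations of the listed form are closed under inversion (the image of a transformation domain of $\theta$ being a transformation domain of $\tilde\theta$)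 and under composition (whenever the first map takes its domain into the domain of the second). -/

import Mathlib

open scoped ContDiff Topology

namespace RDPower

/-- The arbitrary elements `θ = (f, g, h, m)` of the class `f(x) u_t = (g(x) u_x)_x + h(x) |u|^m`
on an open interval `I` of values of `x`: `f`, `g`, `h` are smooth and nonvanishing on `I`
(their values outside `I` play no role), and `m` is a real constant different from `0` and `1`. -/
structure ArbElem where
  I : Set ℝ
  f : ℝ → ℝ
  g : ℝ → ℝ
  h : ℝ → ℝ
  m : ℝ
  isOpen_I : IsOpen I
  nonempty_I : I.Nonempty
  ordConnected_I : I.OrdConnected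
  smooth_f : ContDiffOn ℝ ∞ f I
  smooth_g : ContDiffOn ℝ ∞ g I
  smooth_h : ContDiffOn ℝ ∞ h I
  f_ne_zero : ∀ x ∈ I, f x ≠ 0
  g_ne_zero : ∀ x ∈ I, g x ≠ 0
  h_ne_zero : ∀ x ∈ I, h x ≠ 0
  m_ne_zero : m ≠ 0
  m_ne_one : m ≠ 1

/-- The function `u` of `(t, x)` satisfies `f u_t = (g u_x)_x + h |u|^m` at the point `p = (t, x)`,
that is, the second-order jet of `u` at `p` lies on the manifold of the equation. -/
def SolvesAt (θ : ArbElem) (u : ℝ × ℝ → ℝ) (p : ℝ × ℝ) : Prop :=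
  θ.f p.2 * deriv (fun t => u (t, p.2)) p.1 =
    deriv (fun x => θ.g x * deriv (fun y => u (p.1, y)) x) p.2 + θ.h p.2 * |u p| ^ θ.m

/-- The projection to the `x`-axis of a set in the space of `(t, x, u)`. -/
def xProj (Ω : Set (ℝ × ℝ × ℝ)) : Set ℝ := (fun z : ℝ × ℝ × ℝ => z.2.1) '' Ω

/-- `Ω` is a possible domain of a (local) point transformation of the equation with arbitrary
elements `θ`: a connected nonempty open set of points `(t, x, u)` with `x ∈ I` and `u ≠ 0`,
all of whose slices `x = const` are connected. -/
structure IsTransDomain (θ : ArbElem) (Ω : Set (ℝ × ℝ × ℝ)) : Prop where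
  isOpen : IsOpen Ω
  isConnected : IsConnected Ω
  slice : ∀ x : ℝ, IsPreconnected {p : ℝ × ℝ | (p.1, x, p.2) ∈ Ω}
  mem_I : ∀ z ∈ Ω, z.2.1 ∈ θ.I
  u_ne_zero : ∀ z ∈ Ω, z.2.2 ≠ 0

/-- The map `(t, x, u) ↦ F (t, x, u) = (T, X, U)` is a nondegenerate smooth point transformation
of `Ω` to its image. -/
structure IsPointTransformation (Ω : Set (ℝ × ℝ × ℝ)) (F : ℝ × ℝ × ℝ → ℝ × ℝ × ℝ) : Prop where
  smooth : ContDiffOn ℝ ∞ F Ω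
  injOn : Set.InjOn F Ω
  jacobian : ∀ z ∈ Ω, (fderiv ℝ F z).det ≠ 0

/-- The change of the independent variables `(t, x) ↦ (T, X)(t, x, u(t, x))` that a point
transformation induces along the graph of a function `u`. -/
def baseMap (F : ℝ × ℝ × ℝ → ℝ × ℝ × ℝ) (u : ℝ × ℝ → ℝ) (q : ℝ × ℝ) : ℝ × ℝ :=
  ((F (q.1, q.2, u q)).1, (F (q.1, q.2, u q)).2.1)

/-- The second prolongation of the point transformation `F` on `Ω` maps the equation with arbitrary
elements `θ` to the equation with arbitrary elements `θ'`, as manifolds in the second-order jet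
space: whenever `F` maps (near a point) the graph of a smooth function `u`, along which the induced
change of independent variables is nondegenerate, to the graph of a smooth function `v`, the jet
of `u` at the point satisfies the first equation iff the corresponding jet of `v` satisfies the
second one. -/
def MapsEquation (θ θ' : ArbElem) (Ω : Set (ℝ × ℝ × ℝ)) (F : ℝ × ℝ × ℝ → ℝ × ℝ × ℝ) : Prop :=
  ∀ (u v : ℝ × ℝ → ℝ) (p : ℝ × ℝ), (p.1, p.2, u p) ∈ Ω →
    ContDiffAt ℝ ∞ u p → ContDiffAt ℝ ∞ v (baseMap F u p) →
    (fderiv ℝ (baseMap F u) p).det ≠ 0 →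
    (∀ᶠ q in 𝓝 p, v (baseMap F u q) = (F (q.1, q.2, u q)).2.2) →
    (SolvesAt θ u p ↔ SolvesAt θ' v (baseMap F u p))

/-- `F` on `Ω` is an admissible transformation from the equation with arbitrary elements `θ` to
the equation with arbitrary elements `θ'`. -/
structure IsAdmissible (θ θ' : ArbElem) (Ω : Set (ℝ × ℝ × ℝ))
    (F : ℝ × ℝ × ℝ → ℝ × ℝ × ℝ) : Prop where
  point : IsPointTransformation Ω F
  mem_I : ∀ z ∈ Ω, (F z).2.1 ∈ θ'.I
  u_ne_zero : ∀ z ∈ Ω, (F z).2.2 ≠ 0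
  maps : MapsEquation θ θ' Ω F

/-- A transformation of `(t, x, u)` depending on the arbitrary elements in an arbitrary (possibly
nonlocal) way, together with a transformation `θ ↦ arb θ` of the arbitrary elements: for every fixed
`θ` it becomes a map `toFun θ` of the variables `(t, x, u)`, considered on the domain `dom θ`. -/
structure TransFamily where
  arb : ArbElem → ArbElem
  dom : ArbElem → Set (ℝ × ℝ × ℝ)
  toFun : ArbElem → ℝ × ℝ × ℝ → ℝ × ℝ × ℝ
  isTransDomain : ∀ θ, IsTransDomain θ (dom θ)

/-- A smooth one-parameter family of arbitrary elements on a fixed interval `I`. -/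
structure IsSmoothCurve (I : Set ℝ) (θ : ℝ → ArbElem) : Prop where
  I_eq : ∀ s, (θ s).I = I
  smooth_f : ContDiffOn ℝ ∞ (fun p : ℝ × ℝ => (θ p.1).f p.2) (Set.univ ×ˢ I)
  smooth_g : ContDiffOn ℝ ∞ (fun p : ℝ × ℝ => (θ p.1).g p.2) (Set.univ ×ˢ I)
  smooth_h : ContDiffOn ℝ ∞ (fun p : ℝ × ℝ => (θ p.1).h p.2) (Set.univ ×ˢ I)
  smooth_m : ContDiff ℝ ∞ (fun s => (θ s).m)

/-- The map of the variables depends continuously on the arbitrary elements: along every smooth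
one-parameter family `θ s` of arbitrary elements, the image of `(t, x, u)` under the transformation
with arbitrary elements `θ s` is defined on an open set of `(s, t, x, u)` and continuous there. -/
def TransFamily.DependsContinuously (Φ : TransFamily) : Prop :=
  ∀ (I : Set ℝ) (θ : ℝ → ArbElem), IsSmoothCurve I θ →
    IsOpen {p : ℝ × ℝ × ℝ × ℝ | p.2 ∈ Φ.dom (θ p.1)} ∧
    ContinuousOn (fun p : ℝ × ℝ × ℝ × ℝ => Φ.toFun (θ p.1) p.2)
      {p : ℝ × ℝ × ℝ × ℝ | p.2 ∈ Φ.dom (θ p.1)}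

/-- The generalized extended equivalence group of the class: the transformations of `(t, x, u)` and
of the arbitrary elements, depending continuously on the arbitrary elements, which for every fixed
`θ` are point transformations in `(t, x, u)` mapping the equation with the arbitrary elements `θ`
to the equation from the same class with the new arbitrary elements `arb θ`. -/
def generalizedExtendedEquivalenceGroup : Set TransFamily :=
  {Φ | Φ.DependsContinuously ∧ ∀ θ, IsAdmissible θ (Φ.arb θ) (Φ.dom θ) (Φ.toFun θ)}

/-- The map `F` on `Ω` and the passage from `θ` to `θ'` have the form
`t' = δ₁ t + δ₂`, `x' = φ(x)`, `u' = ψ(x) u`,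
`f' = δ₀ δ₁ f / (φ_x ψ²)`, `g' = δ₀ φ_x g / ψ²`, `h' = δ₀ h / (φ_x ψ |ψ|^m)`, `m' = m`,
where `δ₀ δ₁ ≠ 0`, `φ` is smooth with `φ_x ≠ 0` and `ψ` is a nonvanishing solution of
`(g ψ_x / ψ²)_x = 0`. -/
def HasListedForm (θ θ' : ArbElem) (Ω : Set (ℝ × ℝ × ℝ)) (F : ℝ × ℝ × ℝ → ℝ × ℝ × ℝ) : Prop :=
  ∃ (δ₀ δ₁ δ₂ : ℝ) (φ ψ : ℝ → ℝ),
    δ₀ * δ₁ ≠ 0 ∧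
    ContDiffOn ℝ ∞ φ (xProj Ω) ∧ (∀ x ∈ xProj Ω, deriv φ x ≠ 0) ∧
    ContDiffOn ℝ ∞ ψ (xProj Ω) ∧ (∀ x ∈ xProj Ω, ψ x ≠ 0) ∧
    (∀ x ∈ xProj Ω, deriv (fun y => θ.g y * deriv ψ y / ψ y ^ 2) x = 0) ∧
    (∀ t x u : ℝ, (t, x, u) ∈ Ω → F (t, x, u) = (δ₁ * t + δ₂, φ x, ψ x * u)) ∧
    (∀ x ∈ xProj Ω,
      φ x ∈ θ'.I ∧
      θ'.f (φ x) = δ₀ * δ₁ / (deriv φ x * ψ x ^ 2) * θ.f x ∧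
      θ'.g (φ x) = δ₀ * deriv φ x / ψ x ^ 2 * θ.g x ∧
      θ'.h (φ x) = δ₀ / (deriv φ x * (ψ x * |ψ x| ^ θ.m)) * θ.h x) ∧
    θ'.m = θ.m

end RDPower

namespace RDPower

/-! Write (T, X, U) for the components of an admissible map. The determining equations are obtained
by testing it on quadratic functions of (t, x). The value of u_tt is free on the source equation, so
its coefficient in the transformed equation must vanish, which forces T_x = T_u = 0
(`fderiv_compT`). Comparing the coefficients of u_t gives X_u = 0 (`fderiv_compX`), and those of the
powers of u_x give U_uu = 0 (`determining_equations`). Since U is affine in u, the last determining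
equation compares |u|^m with a power of |Au + B| modulo affine functions of u: the exponents agree,
and B = 0 unless m = 2 (`power_identity`).

Nothing so far excludes X_t ≠ 0, nor a shift of u when m = 2. Both are excluded by continuity in θ.
In the coordinate Y = ∫|f/g|^(1/2) dx the map X is affine for each t, and an invariant of the
equation obeys a transformation law whose x- and t-derivatives form a linear system for X_t. If its
determinant is nonzero (`IsGenericAt`), then X_t = 0 (`time_deriv_eq_zero`), and the constancy of
T_t and the independence of U from t follow (`box_hasForm`). Every equation with m ≠ 2 is a limit of
equations generic at a given point (`exists_generic_scaleH`), and m = 2 is a limit of 2 + s². The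
form of the map is a closed condition, so it passes to limits along such curves
(`exists_hasForm_of_curve`). Connectedness of the domain and its slices makes it global
(`hasForm_of_local`). The remaining determining equations then give the equation for ψ and the
formulas for the new f, g, h, with δ₀ a constant of integration (`hasListedForm_of_hasForm`).

Conversely, substituting a listed map multiplies the residual of the equation by a nonvanishing
factor (`isAdmissible_of_hasListedForm`). To include a given map in a continuous family, note that
(1/ψ)_x = -C/g with C constant: fixing C and the value of ψ at one point determines a ψ for every g,
on a possibly smaller domain (`exists_mem_group_of_hasListedForm`). -/

/-! ### Calculus: second derivatives along curves, and local graphs. -/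

theorem det_ne_zero_iff_injective {E : Type*} [NormedAddCommGroup E] [NormedSpace ℝ E]
    [FiniteDimensional ℝ E] (L : E →L[ℝ] E) : L.det ≠ 0 ↔ Function.Injective L := by
  rw [ContinuousLinearMap.det, ← isUnit_iff_ne_zero, ← LinearMap.isUnit_iff_isUnit_det,
    LinearMap.isUnit_iff_ker_eq_bot, LinearMap.ker_eq_bot]
  rfl

theorem eventually_differentiableAt {E : Type*} [NormedAddCommGroup E] [NormedSpace ℝ E]
    {v : E → ℝ} {P : E} (hv : ContDiffAt ℝ ∞ v P) : ∀ᶠ q in 𝓝 P, DifferentiableAt ℝ v q := by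
  have := (hv.of_le (m := 1) (by exact_mod_cast le_top)).eventually (by simp)
  exact this.mono fun z hz => hz.differentiableAt (by simp)

/-- The second derivative of a function along a curve. -/
theorem hasDerivAt_deriv_comp {E : Type*} [NormedAddCommGroup E] [NormedSpace ℝ E] {G : E → ℝ}
    {γ γ' : ℝ → E} {γ'' : E} (hG : ContDiffAt ℝ ∞ G (γ 0))
    (hγ : ∀ᶠ r in 𝓝 (0 : ℝ), HasDerivAt γ (γ' r) r) (hγ' : HasDerivAt γ' γ'' 0) :
    HasDerivAt (deriv (G ∘ γ))
      (fderiv ℝ (fderiv ℝ G) (γ 0) (γ' 0) (γ' 0) + fderiv ℝ G (γ 0) γ'') 0 := by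
  have hγ0 : HasDerivAt γ (γ' 0) 0 := hγ.self_of_nhds
  have h1 := eventually_differentiableAt hG
  have h2 : deriv (G ∘ γ) =ᶠ[𝓝 0] fun r => fderiv ℝ G (γ r) (γ' r) := by
    filter_upwards [hγ, hγ0.continuousAt.eventually h1] with r hr hr'
    exact (hr'.hasFDerivAt.comp_hasDerivAt r hr).deriv
  have h3 : DifferentiableAt ℝ (fderiv ℝ G) (γ 0) :=
    (hG.fderiv_right (m := ∞) le_rfl).differentiableAt (by simp)
  have h4 : HasDerivAt (fun r => fderiv ℝ G (γ r)) (fderiv ℝ (fderiv ℝ G) (γ 0) (γ' 0)) 0 :=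
    h3.hasFDerivAt.comp_hasDerivAt 0 hγ0
  exact (h4.clm_apply hγ').congr_of_eventuallyEq h2

/-- The graph of a quadratic function over a straight line in the (t, x)-plane is exactly a curve of
this shape, so the test functions used later need no remainder terms. -/
theorem hasDerivAt_quadCurve {E : Type*} [NormedAddCommGroup E] [NormedSpace ℝ E] (z w w' : E)
    (r : ℝ) : HasDerivAt (fun r : ℝ => z + r • w + r ^ 2 • w') (w + (2 * r) • w') r := by
  have h1 : HasDerivAt (fun r : ℝ => r • w) ((1 : ℝ) • w) r := (hasDerivAt_id r).smul_const w
  have h2 : HasDerivAt (fun r : ℝ => r ^ 2 • w') ((2 * r) • w') r := by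
    simpa using (hasDerivAt_pow 2 r).smul_const w'
  simpa using (h1.const_add z).fun_add h2

theorem hasDerivAt_quadCurve_deriv {E : Type*} [NormedAddCommGroup E] [NormedSpace ℝ E] (w w' : E)
    (r : ℝ) : HasDerivAt (fun r : ℝ => w + (2 * r) • w') ((2 : ℝ) • w') r := by
  have h1 : HasDerivAt (fun r : ℝ => 2 * r) 2 r := by simpa using (hasDerivAt_id r).const_mul 2
  exact (h1.smul_const w').const_add w

/-- The second derivative of a function along a parabola. -/
theorem hasDerivAt_deriv_quadCurve {E : Type*} [NormedAddCommGroup E] [NormedSpace ℝ E]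
    {G : E → ℝ} {z : E} (w w' : E) (hG : ContDiffAt ℝ ∞ G z) :
    HasDerivAt (deriv fun r : ℝ => G (z + r • w + r ^ 2 • w'))
      (fderiv ℝ (fderiv ℝ G) z w w + fderiv ℝ G z ((2 : ℝ) • w')) 0 := by
  have := hasDerivAt_deriv_comp (G := G) (γ := fun r : ℝ => z + r • w + r ^ 2 • w')
    (γ' := fun r => w + (2 * r) • w') (γ'' := (2 : ℝ) • w') (by simpa using hG)
    (Filter.Eventually.of_forall fun r => hasDerivAt_quadCurve z w w' r)
    (hasDerivAt_quadCurve_deriv w w' 0)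
  simpa [Function.comp_def] using this

theorem hasDerivAt_comp_quadCurve {E : Type*} [NormedAddCommGroup E] [NormedSpace ℝ E]
    {G : E → ℝ} {z : E} (w w' : E) {r : ℝ}
    (hG : DifferentiableAt ℝ G (z + r • w + r ^ 2 • w')) :
    HasDerivAt (fun r : ℝ => G (z + r • w + r ^ 2 • w'))
      (fderiv ℝ G (z + r • w + r ^ 2 • w') (w + (2 * r) • w')) r :=
  hG.hasFDerivAt.comp_hasDerivAt r (hasDerivAt_quadCurve z w w' r)

/-- A map with nondegenerate differential locally maps the graph of a smooth function to the graph
of a smooth function. -/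
theorem exists_smooth_comp_eq {E : Type*} [NormedAddCommGroup E] [NormedSpace ℝ E]
    [FiniteDimensional ℝ E] {B : E → E} {w : E → ℝ} {p : E} (hB : ContDiffAt ℝ ∞ B p)
    (hw : ContDiffAt ℝ ∞ w p) (hdet : (fderiv ℝ B p).det ≠ 0) :
    ∃ v : E → ℝ, ContDiffAt ℝ ∞ v (B p) ∧ ∀ᶠ q in 𝓝 p, v (B q) = w q := by
  have : CompleteSpace E := FiniteDimensional.complete ℝ E
  set e := (fderiv ℝ B p).toContinuousLinearEquivOfDetNeZero hdet
  have he : (e : E →L[ℝ] E) = fderiv ℝ B p := by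
    ext x; simp [e]
  have hd : HasFDerivAt B (e : E →L[ℝ] E) p := by
    rw [he]; exact (hB.differentiableAt (by simp)).hasFDerivAt
  have hs : HasStrictFDerivAt B (e : E →L[ℝ] E) p := by
    rw [he]; exact hB.hasStrictFDerivAt (by simp)
  have hinv := hB.to_localInverse hd (by simp)
  have hp : hB.localInverse hd (by simp) (B p) = p := hs.eventually_left_inverse.self_of_nhds
  refine ⟨w ∘ hB.localInverse hd (by simp), ?_, ?_⟩
  · exact ContDiffAt.comp (B p) (by rw [hp]; exact hw) hinv
  · filter_upwards [hs.eventually_left_inverse] with q hq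
    exact congrArg w hq

/-! ### The equation as a relation on second-order jets. -/

theorem hasDerivAt_fst_slice {v : ℝ × ℝ → ℝ} {s y : ℝ} (hv : DifferentiableAt ℝ v (s, y)) :
    HasDerivAt (fun t => v (t, y)) (fderiv ℝ v (s, y) (1, 0)) s :=
  hv.hasFDerivAt.comp_hasDerivAt s ((hasDerivAt_id s).prodMk (hasDerivAt_const s y))

theorem hasDerivAt_snd_slice {v : ℝ × ℝ → ℝ} {s y : ℝ} (hv : DifferentiableAt ℝ v (s, y)) :
    HasDerivAt (fun x => v (s, x)) (fderiv ℝ v (s, y) (0, 1)) y :=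
  hv.hasFDerivAt.comp_hasDerivAt y ((hasDerivAt_const y s).prodMk (hasDerivAt_id y))

theorem hasDerivAt_fderiv_snd_slice {v : ℝ × ℝ → ℝ} {s y : ℝ} (hv : ContDiffAt ℝ ∞ v (s, y)) :
    HasDerivAt (fun x => fderiv ℝ v (s, x) (0, 1))
      (fderiv ℝ (fderiv ℝ v) (s, y) (0, 1) (0, 1)) y := by
  have h3 : DifferentiableAt ℝ (fderiv ℝ v) (s, y) :=
    (hv.fderiv_right (m := ∞) le_rfl).differentiableAt (by simp)
  have h4 : HasDerivAt (fun x => fderiv ℝ v (s, x)) (fderiv ℝ (fderiv ℝ v) (s, y) (0, 1)) y :=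
    h3.hasFDerivAt.comp_hasDerivAt y ((hasDerivAt_const y s).prodMk (hasDerivAt_id y))
  simpa using h4.clm_apply (hasDerivAt_const y ((0 : ℝ), (1 : ℝ)))

/-- The inner derivative can be replaced by a Fréchet derivative because `v` is differentiable at
all points near `P`; the outer one is then the product rule. -/
theorem solvesAt_iff {θ : ArbElem} {v : ℝ × ℝ → ℝ} {P : ℝ × ℝ} (hv : ContDiffAt ℝ ∞ v P)
    (hP : P.2 ∈ θ.I) :
    SolvesAt θ v P ↔ θ.f P.2 * fderiv ℝ v P (1, 0) =
      deriv θ.g P.2 * fderiv ℝ v P (0, 1) + θ.g P.2 * fderiv ℝ (fderiv ℝ v) P (0, 1) (0, 1) +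
        θ.h P.2 * |v P| ^ θ.m := by
  obtain ⟨s, y⟩ := P
  have hev := eventually_differentiableAt hv
  have h1 := (hasDerivAt_fst_slice hev.self_of_nhds).deriv
  have hg : HasDerivAt θ.g (deriv θ.g y) y :=
    ((θ.smooth_g.contDiffAt (θ.isOpen_I.mem_nhds hP)).differentiableAt (by simp)).hasDerivAt
  have h6 : HasDerivAt (fun x => θ.g x * deriv (fun y => v (s, y)) x)
      (deriv θ.g y * fderiv ℝ v (s, y) (0, 1) +
        θ.g y * fderiv ℝ (fderiv ℝ v) (s, y) (0, 1) (0, 1)) y := by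
    refine (hg.mul (hasDerivAt_fderiv_snd_slice hv)).congr_of_eventuallyEq ?_
    have hc : ContinuousAt (fun x : ℝ => (s, x)) y := by fun_prop
    filter_upwards [hc.eventually hev] with x hx
    simp only [Pi.mul_apply, (hasDerivAt_snd_slice hx).deriv]
  simp only [SolvesAt, h1, h6.deriv]

/-- The quadratic function of `(t, x)` with prescribed derivatives at `(t₀, x₀)`. -/
noncomputable def jetFun (t₀ x₀ a b c d k : ℝ) (q : ℝ × ℝ) : ℝ :=
  a + b * (q.1 - t₀) + c * (q.2 - x₀) + d / 2 * (q.2 - x₀) ^ 2 + k / 2 * (q.1 - t₀) ^ 2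

theorem contDiff_jetFun (t₀ x₀ a b c d k : ℝ) : ContDiff ℝ ∞ (jetFun t₀ x₀ a b c d k) := by
  unfold jetFun; fun_prop

/-- The parameter `k`, the value of u_tt, does not enter the equation. Varying it on the source side
is what later forces T_x = T_u = 0. -/
theorem solvesAt_jetFun {θ : ArbElem} {t₀ x₀ : ℝ} (a b c d k : ℝ) (hx : x₀ ∈ θ.I) :
    SolvesAt θ (jetFun t₀ x₀ a b c d k) (t₀, x₀) ↔
      θ.f x₀ * b = deriv θ.g x₀ * c + θ.g x₀ * d + θ.h x₀ * |a| ^ θ.m := by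
  have h1 : HasDerivAt (fun t => jetFun t₀ x₀ a b c d k (t, x₀)) b t₀ := by
    have h : HasDerivAt (fun t : ℝ => t - t₀) 1 t₀ := (hasDerivAt_id t₀).sub_const t₀
    refine ((((h.const_mul b).const_add a).add_const (c * (x₀ - x₀))
      |>.add_const (d / 2 * (x₀ - x₀) ^ 2)).fun_add
      ((h.fun_pow 2).const_mul (k / 2))).congr_deriv ?_
    simp
  have h2 : ∀ y, HasDerivAt (fun y => jetFun t₀ x₀ a b c d k (t₀, y)) (c + d * (y - x₀)) y := by
    intro y
    have h : HasDerivAt (fun y : ℝ => y - x₀) 1 y := (hasDerivAt_id y).sub_const x₀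
    refine ((((h.const_mul c).const_add (a + b * (t₀ - t₀))).fun_add
      ((h.fun_pow 2).const_mul (d / 2))).add_const (k / 2 * (t₀ - t₀) ^ 2)).congr_deriv ?_
    simp; ring
  have h3 : HasDerivAt (fun y => c + d * (y - x₀)) d x₀ := by
    simpa using (((hasDerivAt_id x₀).sub_const x₀).const_mul d).const_add c
  have hg : HasDerivAt θ.g (deriv θ.g x₀) x₀ :=
    ((θ.smooth_g.contDiffAt (θ.isOpen_I.mem_nhds hx)).differentiableAt (by simp)).hasDerivAt
  have h4 := (hg.mul h3).deriv
  have h5 : (fun x => θ.g x * deriv (fun y => jetFun t₀ x₀ a b c d k (t₀, y)) x) =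
      θ.g * fun y => c + d * (y - x₀) := by
    ext x; simp [(h2 x).deriv]
  simp only [SolvesAt, h1.deriv, h5, h4]
  simp [jetFun]

theorem hasFDerivAt_jetFun (t₀ x₀ a b c d k : ℝ) :
    HasFDerivAt (jetFun t₀ x₀ a b c d k)
      (b • ContinuousLinearMap.fst ℝ ℝ ℝ + c • ContinuousLinearMap.snd ℝ ℝ ℝ) (t₀, x₀) := by
  have h1 : HasFDerivAt (fun q : ℝ × ℝ => q.1 - t₀) (ContinuousLinearMap.fst ℝ ℝ ℝ) (t₀, x₀) :=
    hasFDerivAt_fst.sub_const t₀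
  have h2 : HasFDerivAt (fun q : ℝ × ℝ => q.2 - x₀) (ContinuousLinearMap.snd ℝ ℝ ℝ) (t₀, x₀) :=
    hasFDerivAt_snd.sub_const x₀
  refine ((((h1.const_mul b).const_add a).fun_add (h2.const_mul c)).fun_add
    ((h2.pow 2).const_mul (d / 2))).fun_add ((h1.pow 2).const_mul (k / 2))
    |>.congr_fderiv ?_
  ext <;> simp

/-! ### The determining relation at a jet. -/

/-- The `t`-component of a point transformation. -/
def compT (F : ℝ × ℝ × ℝ → ℝ × ℝ × ℝ) (z : ℝ × ℝ × ℝ) : ℝ := (F z).1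
/-- The `x`-component of a point transformation. -/
def compX (F : ℝ × ℝ × ℝ → ℝ × ℝ × ℝ) (z : ℝ × ℝ × ℝ) : ℝ := (F z).2.1
/-- The `u`-component of a point transformation. -/
def compU (F : ℝ × ℝ × ℝ → ℝ × ℝ × ℝ) (z : ℝ × ℝ × ℝ) : ℝ := (F z).2.2

/-- The quadratic form of the second derivative. -/
noncomputable def hess (G : ℝ × ℝ × ℝ → ℝ) (z w : ℝ × ℝ × ℝ) : ℝ := fderiv ℝ (fderiv ℝ G) z w w

/-- The determining relation of a map of equations at a second-order jet, in terms of the first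
derivatives `W`, `V` of the transformed function and of the direction `(α, β)` that is mapped to
the new `x`-axis. -/
theorem mapsEquation_jet {θ θ' : ArbElem} {Ω : Set (ℝ × ℝ × ℝ)} {F : ℝ × ℝ × ℝ → ℝ × ℝ × ℝ}
    (hΩ : IsOpen Ω) (hF : ContDiffOn ℝ ∞ F Ω) (hI : ∀ z ∈ Ω, z.2.1 ∈ θ.I)
    (hI' : ∀ z ∈ Ω, (F z).2.1 ∈ θ'.I) (hM : MapsEquation θ θ' Ω F) {t x a : ℝ}
    (hz : (t, x, a) ∈ Ω) {b c d k W V α β : ℝ}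
    (hinj : ∀ τ χ : ℝ, fderiv ℝ (compT F) (t, x, a) (τ, χ, b * τ + c * χ) = 0 →
      fderiv ℝ (compX F) (t, x, a) (τ, χ, b * τ + c * χ) = 0 → τ = 0 ∧ χ = 0)
    (hWV : ∀ τ χ : ℝ, fderiv ℝ (compU F) (t, x, a) (τ, χ, b * τ + c * χ) =
      W * fderiv ℝ (compT F) (t, x, a) (τ, χ, b * τ + c * χ) +
      V * fderiv ℝ (compX F) (t, x, a) (τ, χ, b * τ + c * χ))
    (hα : fderiv ℝ (compT F) (t, x, a) (α, β, b * α + c * β) = 0)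
    (hβ : fderiv ℝ (compX F) (t, x, a) (α, β, b * α + c * β) = 1) :
    θ.f x * b = deriv θ.g x * c + θ.g x * d + θ.h x * |a| ^ θ.m ↔
    θ'.f (compX F (t, x, a)) * W = deriv θ'.g (compX F (t, x, a)) * V +
      θ'.g (compX F (t, x, a)) * (hess (compU F) (t, x, a) (α, β, b * α + c * β) -
        W * hess (compT F) (t, x, a) (α, β, b * α + c * β) -
        V * hess (compX F) (t, x, a) (α, β, b * α + c * β) +
        (fderiv ℝ (compU F) (t, x, a) (0, 0, 1) - W * fderiv ℝ (compT F) (t, x, a) (0, 0, 1) -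
          V * fderiv ℝ (compX F) (t, x, a) (0, 0, 1)) * (d * β ^ 2 + k * α ^ 2)) +
      θ'.h (compX F (t, x, a)) * |compU F (t, x, a)| ^ θ'.m := by
  set u := jetFun t x a b c d k with hu
  set z : ℝ × ℝ × ℝ := (t, x, a) with hzdef
  have hup : u (t, x) = a := by simp [hu, jetFun]
  have hFz : ContDiffAt ℝ ∞ F z := hF.contDiffAt (hΩ.mem_nhds hz)
  have hT : ContDiffAt ℝ ∞ (compT F) z := contDiffAt_fst.comp z hFz
  have hX : ContDiffAt ℝ ∞ (compX F) z := contDiffAt_fst.comp z (contDiffAt_snd.comp z hFz)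
  have hU : ContDiffAt ℝ ∞ (compU F) z := contDiffAt_snd.comp z (contDiffAt_snd.comp z hFz)
  have hus : ContDiffAt ℝ ∞ u (t, x) := (contDiff_jetFun t x a b c d k).contDiffAt
  set gr : ℝ × ℝ → ℝ × ℝ × ℝ := fun q => (q.1, q.2, u q) with hgr
  have hgrp : gr (t, x) = z := by simp [hgr, hup, hzdef]
  have hgrs : ContDiffAt ℝ ∞ gr (t, x) := contDiffAt_fst.prodMk (contDiffAt_snd.prodMk hus)
  have hgrd : HasFDerivAt gr ((ContinuousLinearMap.fst ℝ ℝ ℝ).prod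
      ((ContinuousLinearMap.snd ℝ ℝ ℝ).prod
        (b • ContinuousLinearMap.fst ℝ ℝ ℝ + c • ContinuousLinearMap.snd ℝ ℝ ℝ))) (t, x) :=
    hasFDerivAt_fst.prodMk (hasFDerivAt_snd.prodMk (hasFDerivAt_jetFun t x a b c d k))
  have hBeq : baseMap F u = fun q => (compT F (gr q), compX F (gr q)) := rfl
  have hcd : ∀ G : ℝ × ℝ × ℝ → ℝ, ContDiffAt ℝ ∞ G z → ContDiffAt ℝ ∞ (G ∘ gr) (t, x) :=
    fun G hG => ContDiffAt.comp (t, x) (by rw [hgrp]; exact hG) hgrs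
  have hfd : ∀ G : ℝ × ℝ × ℝ → ℝ, ContDiffAt ℝ ∞ G z → HasFDerivAt (G ∘ gr)
      ((fderiv ℝ G z).comp _) (t, x) := fun G hG =>
    HasFDerivAt.comp (t, x) (by rw [hgrp]; exact (hG.differentiableAt (by simp)).hasFDerivAt) hgrd
  have hUg : HasFDerivAt (fun q => compU F (gr q)) _ (t, x) := hfd _ hU
  have hBd : HasFDerivAt (baseMap F u) _ (t, x) := (hfd _ hT).prodMk (hfd _ hX)
  have hBs : ContDiffAt ℝ ∞ (baseMap F u) (t, x) :=
    (hcd _ hT).prodMk (hcd _ hX)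
  have hUs : ContDiffAt ℝ ∞ (fun q => compU F (gr q)) (t, x) := hcd _ hU
  have hBapp : ∀ τ χ : ℝ, fderiv ℝ (baseMap F u) (t, x) (τ, χ) =
      (fderiv ℝ (compT F) z (τ, χ, b * τ + c * χ), fderiv ℝ (compX F) z (τ, χ, b * τ + c * χ)) := by
    intro τ χ
    rw [hBd.fderiv]; simp
  have hBinj : Function.Injective (fderiv ℝ (baseMap F u) (t, x)) := by
    rw [injective_iff_map_eq_zero]
    rintro ⟨τ, χ⟩ h
    rw [hBapp, Prod.mk_eq_zero] at h
    obtain ⟨h1, h2⟩ := hinj τ χ h.1 h.2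
    simp [h1, h2]
  have hdet := (det_ne_zero_iff_injective _).2 hBinj
  have hBsurj : Function.Surjective (fderiv ℝ (baseMap F u) (t, x)) :=
    LinearMap.injective_iff_surjective (f := (fderiv ℝ (baseMap F u) (t, x)).toLinearMap).1 hBinj
  obtain ⟨v, hv, hvB⟩ := exists_smooth_comp_eq hBs hUs hdet
  have hBp : baseMap F u (t, x) = (compT F z, compX F z) := by
    rw [hBeq]; simp only [hgrp]
  have key := hM u v (t, x) (by rw [hup]; exact hz) hus hv hdet hvB
  rw [solvesAt_jetFun a b c d k (hI z hz), solvesAt_iff hv (by rw [hBp]; exact hI' z hz)] at key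
  rw [key]
  -- first derivatives of `v`
  have hvd : HasFDerivAt v (fderiv ℝ v (baseMap F u (t, x))) (baseMap F u (t, x)) :=
    (hv.differentiableAt (by simp)).hasFDerivAt
  have hD1 : ∀ s y : ℝ, fderiv ℝ v (baseMap F u (t, x)) (s, y) = W * s + V * y := by
    intro s y
    -- Every direction at the image point comes from a direction at the source, along which the
    -- derivatives of `v ∘ baseMap F u` and of U along the graph agree. Hence W and V are the first
    -- derivatives of `v`.
    obtain ⟨⟨τ, χ⟩, hτ⟩ := hBsurj (s, y)
    have h1 : HasFDerivAt (fun q => v (baseMap F u q)) _ (t, x) :=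
      hvd.comp (t, x) (hBs.differentiableAt (by simp)).hasFDerivAt
    have h2 := (h1.congr_of_eventuallyEq (f₁ := fun q => compU F (gr q))
      (hvB.mono fun q hq => hq.symm)).unique hUg
    have h3 := congrArg (fun L => L (τ, χ)) h2
    simp only [ContinuousLinearMap.comp_apply, ContinuousLinearMap.prod_apply, hτ,
      add_apply, smul_apply, ContinuousLinearMap.coe_fst',
      ContinuousLinearMap.coe_snd', smul_eq_mul] at h3
    rw [h3, hWV]
    rw [hBapp, Prod.mk.injEq] at hτ
    rw [hτ.1, hτ.2]
  -- second derivative of `v`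
  set w : ℝ × ℝ × ℝ := (α, β, b * α + c * β) with hw
  -- The term r² • w' has second derivative 2 • w', hence the factor 1/2. The lifted line stays in
  -- the graph of `u`, and its base direction (α, β) is mapped to (0, 1).
  set w' : ℝ × ℝ × ℝ := (0, 0, (d * β ^ 2 + k * α ^ 2) / 2) with hw'
  have hcurve : ∀ r : ℝ, gr ((t, x) + r • (α, β)) = z + r • w + r ^ 2 • w' := by
    intro r
    simp only [hgr, hu, jetFun, hzdef, hw, hw', Prod.smul_mk, Prod.mk_add_mk, smul_eq_mul,
      Prod.mk.injEq]
    refine ⟨by ring, by ring, by ring⟩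
  have h2w' : (2 : ℝ) • w' = (d * β ^ 2 + k * α ^ 2) • ((0, 0, 1) : ℝ × ℝ × ℝ) := by
    simp [hw', Prod.smul_mk]; ring
  have hcont : Filter.Tendsto (fun r : ℝ => z + r • w + r ^ 2 • w') (𝓝 0) (𝓝 z) := by
    have : Continuous (fun r : ℝ => z + r • w + r ^ 2 • w') := by fun_prop
    simpa using this.tendsto 0
  have hdiff : ∀ G : ℝ × ℝ × ℝ → ℝ, ContDiffAt ℝ ∞ G z →
      ∀ᶠ r in 𝓝 (0 : ℝ), DifferentiableAt ℝ G (z + r • w + r ^ 2 • w') := by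
    intro G hG
    have := (hG.of_le (m := 1) (by exact_mod_cast le_top)).eventually (by simp)
    exact hcont.eventually (this.mono fun z hz => hz.differentiableAt (by simp))
  set γ : ℝ → ℝ × ℝ := fun r => (compT F (z + r • w + r ^ 2 • w'),
    compX F (z + r • w + r ^ 2 • w')) with hγ
  set γ' : ℝ → ℝ × ℝ := fun r => (deriv (fun r => compT F (z + r • w + r ^ 2 • w')) r,
    deriv (fun r => compX F (z + r • w + r ^ 2 • w')) r) with hγ'
  have hγB : ∀ r, γ r = baseMap F u ((t, x) + r • (α, β)) := by
    intro r; simp only [hγ, hBeq, hcurve]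
  have hγ0 : γ 0 = baseMap F u (t, x) := by rw [hγB]; simp
  have hγd : ∀ᶠ r in 𝓝 (0 : ℝ), HasDerivAt γ (γ' r) r := by
    filter_upwards [hdiff _ hT, hdiff _ hX] with r h1 h2
    have h1' := hasDerivAt_comp_quadCurve w w' h1
    have h2' := hasDerivAt_comp_quadCurve w w' h2
    simp only [hγ, hγ', h1'.deriv, h2'.deriv]
    exact h1'.prodMk h2'
  have hγ'd := (hasDerivAt_deriv_quadCurve w w' hT).prodMk (hasDerivAt_deriv_quadCurve w w' hX)
  have hγ'0 : γ' 0 = (0, 1) := by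
    have h1' := hasDerivAt_comp_quadCurve w w' (hdiff _ hT).self_of_nhds
    have h2' := hasDerivAt_comp_quadCurve w w' (hdiff _ hX).self_of_nhds
    simp only [hγ', h1'.deriv, h2'.deriv]
    simp [hα, hβ]
  have hsec := hasDerivAt_deriv_comp (G := v) (γ := γ) (γ' := γ') (by rw [hγ0]; exact hv) hγd hγ'd
  have hev : (v ∘ γ) =ᶠ[𝓝 0] fun r => compU F (z + r • w + r ^ 2 • w') := by
    have hc : Filter.Tendsto (fun r : ℝ => (t, x) + r • (α, β)) (𝓝 0) (𝓝 (t, x)) := by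
      have : Continuous (fun r : ℝ => ((t, x) : ℝ × ℝ) + r • ((α, β) : ℝ × ℝ)) := by fun_prop
      simpa using this.tendsto 0
    filter_upwards [hc.eventually hvB] with r hr
    simp only [Function.comp_apply, hγB, hr]
    exact congrArg (compU F) (hcurve r)
  have hUU := hasDerivAt_deriv_quadCurve w w' hU
  -- The second derivative of the same function is computed twice: through `v` along the image
  -- curve, whose initial velocity (0, 1) singles out v_xx, and through U along the parabola.
  have heq := (hsec.congr_of_eventuallyEq hev.deriv.symm).unique hUU
  rw [hγ0, hγ'0, hD1, h2w', map_smul, map_smul, map_smul] at heq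
  simp only [smul_eq_mul] at heq
  have hvp : v (baseMap F u (t, x)) = compU F z := by
    have := hvB.self_of_nhds
    rw [this]; exact congrArg (compU F) hgrp
  have hP2 : (baseMap F u (t, x)).2 = compX F z := by rw [hBp]
  have e2 : fderiv ℝ (fderiv ℝ v) (baseMap F u (t, x)) (0, 1) (0, 1) =
      hess (compU F) z w - W * hess (compT F) z w - V * hess (compX F) z w +
        (fderiv ℝ (compU F) z (0, 0, 1) - W * fderiv ℝ (compT F) z (0, 0, 1) -
          V * fderiv ℝ (compX F) z (0, 0, 1)) * (d * β ^ 2 + k * α ^ 2) := by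
    simp only [hess]; linear_combination heq
  rw [hD1, hD1, e2, hvp, hP2]
  simp only [mul_one, mul_zero, add_zero, zero_add]

/-! ### Independence of the new time from x and u. -/

theorem clm_apply_triple (L : ℝ × ℝ × ℝ →L[ℝ] ℝ) (τ χ μ : ℝ) :
    L (τ, χ, μ) = τ * L (1, 0, 0) + χ * L (0, 1, 0) + μ * L (0, 0, 1) := by
  have : ((τ, χ, μ) : ℝ × ℝ × ℝ) =
      τ • ((1, 0, 0) : ℝ × ℝ × ℝ) + χ • ((0, 1, 0) : ℝ × ℝ × ℝ) + μ • ((0, 0, 1) : ℝ × ℝ × ℝ) := by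
    simp
  rw [this, map_add, map_add, map_smul, map_smul, map_smul]
  simp

/-- An admissible transformation on an open set of points `(t, x, u)` with `x ∈ I`. -/
structure IsLocAdmissible (θ θ' : ArbElem) (Ω : Set (ℝ × ℝ × ℝ))
    (F : ℝ × ℝ × ℝ → ℝ × ℝ × ℝ) : Prop extends IsAdmissible θ θ' Ω F where
  isOpen : IsOpen Ω
  base_mem : ∀ z ∈ Ω, z.2.1 ∈ θ.I
  base_ne_zero : ∀ z ∈ Ω, z.2.2 ≠ 0

variable {θ θ' : ArbElem} {Ω : Set (ℝ × ℝ × ℝ)} {F : ℝ × ℝ × ℝ → ℝ × ℝ × ℝ}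

theorem IsLocAdmissible.mono (H : IsLocAdmissible θ θ' Ω F) {Ω' : Set (ℝ × ℝ × ℝ)} (h : Ω' ⊆ Ω)
    (ho : IsOpen Ω') : IsLocAdmissible θ θ' Ω' F where
  point := ⟨H.point.smooth.mono h, H.point.injOn.mono h, fun z hz => H.point.jacobian z (h hz)⟩
  mem_I z hz := H.mem_I z (h hz)
  u_ne_zero z hz := H.u_ne_zero z (h hz)
  maps u v p hp := H.maps u v p (h hp)
  isOpen := ho
  base_mem z hz := H.base_mem z (h hz)
  base_ne_zero z hz := H.base_ne_zero z (h hz)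

namespace IsLocAdmissible

theorem contDiffAt (H : IsLocAdmissible θ θ' Ω F) {z : ℝ × ℝ × ℝ} (hz : z ∈ Ω) :
    ContDiffAt ℝ ∞ F z := H.point.smooth.contDiffAt (H.isOpen.mem_nhds hz)

theorem contDiffAt_compT (H : IsLocAdmissible θ θ' Ω F) {z : ℝ × ℝ × ℝ} (hz : z ∈ Ω) :
    ContDiffAt ℝ ∞ (compT F) z := contDiffAt_fst.comp z (H.contDiffAt hz)

theorem contDiffAt_compX (H : IsLocAdmissible θ θ' Ω F) {z : ℝ × ℝ × ℝ} (hz : z ∈ Ω) :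
    ContDiffAt ℝ ∞ (compX F) z :=
  contDiffAt_fst.comp z (contDiffAt_snd.comp z (H.contDiffAt hz))

theorem contDiffAt_compU (H : IsLocAdmissible θ θ' Ω F) {z : ℝ × ℝ × ℝ} (hz : z ∈ Ω) :
    ContDiffAt ℝ ∞ (compU F) z :=
  contDiffAt_snd.comp z (contDiffAt_snd.comp z (H.contDiffAt hz))

theorem surjective (H : IsLocAdmissible θ θ' Ω F) {z : ℝ × ℝ × ℝ} (hz : z ∈ Ω) (p q r : ℝ) :
    ∃ e : ℝ × ℝ × ℝ, fderiv ℝ (compT F) z e = p ∧ fderiv ℝ (compX F) z e = q ∧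
      fderiv ℝ (compU F) z e = r := by
  have hinj := (det_ne_zero_iff_injective _).1 (H.point.jacobian z hz)
  have hsurj : Function.Surjective (fderiv ℝ F z) :=
    LinearMap.injective_iff_surjective (f := (fderiv ℝ F z).toLinearMap).1 hinj
  obtain ⟨e, he⟩ := hsurj (p, q, r)
  have hF : HasFDerivAt F (fderiv ℝ F z) z :=
    ((H.contDiffAt hz).differentiableAt (by simp)).hasFDerivAt
  have h1 : HasFDerivAt (compT F) _ z := hF.fst
  have h2 : HasFDerivAt (compX F) _ z := hF.snd.fst
  have h3 : HasFDerivAt (compU F) _ z := hF.snd.snd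
  refine ⟨e, ?_, ?_, ?_⟩
  · rw [h1.fderiv]; simp [he]
  · rw [h2.fderiv]; simp [he]
  · rw [h3.fderiv]; simp [he]

/-- The derivatives in `u` are not related by the conditions that hold for the total derivatives. -/
theorem vertical_ne_zero (H : IsLocAdmissible θ θ' Ω F) {z : ℝ × ℝ × ℝ} (hz : z ∈ Ω)
    {b c W V : ℝ}
    (h1 : fderiv ℝ (compU F) z (1, 0, b) =
      W * fderiv ℝ (compT F) z (1, 0, b) + V * fderiv ℝ (compX F) z (1, 0, b))
    (h2 : fderiv ℝ (compU F) z (0, 1, c) =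
      W * fderiv ℝ (compT F) z (0, 1, c) + V * fderiv ℝ (compX F) z (0, 1, c)) :
    fderiv ℝ (compU F) z (0, 0, 1) - W * fderiv ℝ (compT F) z (0, 0, 1) -
      V * fderiv ℝ (compX F) z (0, 0, 1) ≠ 0 := by
  intro h3
  obtain ⟨⟨e1, e2, e3⟩, hT, hX, hU⟩ := H.surjective hz 0 0 1
  rw [clm_apply_triple] at hT hX hU
  rw [clm_apply_triple _ 1 0 b, clm_apply_triple _ 1 0 b, clm_apply_triple _ 1 0 b] at h1
  rw [clm_apply_triple _ 0 1 c, clm_apply_triple _ 0 1 c, clm_apply_triple _ 0 1 c] at h2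
  have : (1 : ℝ) = 0 := by
    linear_combination -hU + W * hT + V * hX + e1 * h1 + e2 * h2 + (e3 - e1 * b - e2 * c) * h3
  norm_num at this

/-- The determining relation at jets along which the change of independent variables is
nondegenerate. -/
theorem jet_iff (H : IsLocAdmissible θ θ' Ω F) {t x a : ℝ} (hz : (t, x, a) ∈ Ω)
    {b c W V α β : ℝ} (d k : ℝ)
    (hJ : fderiv ℝ (compT F) (t, x, a) (1, 0, b) * fderiv ℝ (compX F) (t, x, a) (0, 1, c) -
      fderiv ℝ (compT F) (t, x, a) (0, 1, c) * fderiv ℝ (compX F) (t, x, a) (1, 0, b) ≠ 0)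
    (h1 : fderiv ℝ (compU F) (t, x, a) (1, 0, b) = W * fderiv ℝ (compT F) (t, x, a) (1, 0, b) +
      V * fderiv ℝ (compX F) (t, x, a) (1, 0, b))
    (h2 : fderiv ℝ (compU F) (t, x, a) (0, 1, c) = W * fderiv ℝ (compT F) (t, x, a) (0, 1, c) +
      V * fderiv ℝ (compX F) (t, x, a) (0, 1, c))
    (hα : α * fderiv ℝ (compT F) (t, x, a) (1, 0, b) +
      β * fderiv ℝ (compT F) (t, x, a) (0, 1, c) = 0)
    (hβ : α * fderiv ℝ (compX F) (t, x, a) (1, 0, b) +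
      β * fderiv ℝ (compX F) (t, x, a) (0, 1, c) = 1) :
    θ.f x * b = deriv θ.g x * c + θ.g x * d + θ.h x * |a| ^ θ.m ↔
    θ'.f (compX F (t, x, a)) * W = deriv θ'.g (compX F (t, x, a)) * V +
      θ'.g (compX F (t, x, a)) * (hess (compU F) (t, x, a) (α, β, b * α + c * β) -
        W * hess (compT F) (t, x, a) (α, β, b * α + c * β) -
        V * hess (compX F) (t, x, a) (α, β, b * α + c * β) +
        (fderiv ℝ (compU F) (t, x, a) (0, 0, 1) - W * fderiv ℝ (compT F) (t, x, a) (0, 0, 1) -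
          V * fderiv ℝ (compX F) (t, x, a) (0, 0, 1)) * (d * β ^ 2 + k * α ^ 2)) +
      θ'.h (compX F (t, x, a)) * |compU F (t, x, a)| ^ θ'.m := by
  -- The vectors (1, 0, b) and (0, 1, c) span the tangent plane of the graph, so derivatives along
  -- them are the total derivatives D_t and D_x, and `hJ` is the nondegeneracy of the induced change
  -- of (t, x).
  have hsplit : ∀ (L : ℝ × ℝ × ℝ →L[ℝ] ℝ) (τ χ : ℝ),
      L (τ, χ, b * τ + c * χ) = τ * L (1, 0, b) + χ * L (0, 1, c) := by
    intro L τ χ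
    rw [clm_apply_triple L τ, clm_apply_triple L 1 0 b, clm_apply_triple L 0 1 c]
    ring
  refine mapsEquation_jet H.isOpen H.point.smooth H.base_mem H.mem_I H.maps hz ?_ ?_ ?_ ?_
  · intro τ χ h h'
    rw [hsplit] at h h'
    constructor
    · refine (mul_eq_zero.1 (?_ : τ * _ = 0)).resolve_right hJ
      linear_combination (fderiv ℝ (compX F) (t, x, a) (0, 1, c)) * h -
        (fderiv ℝ (compT F) (t, x, a) (0, 1, c)) * h'
    · refine (mul_eq_zero.1 (?_ : χ * _ = 0)).resolve_right hJ
      linear_combination (fderiv ℝ (compT F) (t, x, a) (1, 0, b)) * h' -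
        (fderiv ℝ (compX F) (t, x, a) (1, 0, b)) * h
  · intro τ χ
    rw [hsplit, hsplit, hsplit]
    linear_combination τ * h1 + χ * h2
  · rw [hsplit]; exact hα
  · rw [hsplit]; exact hβ

/-- The transformed relation contains u_tt with the coefficient g' (U_u - W T_u - V X_u) (D_x T /
J)², while the source equation does not contain u_tt. Comparing u_tt = 0 with u_tt = 1 at one source
jet makes this coefficient vanish, and its first two factors are nonzero. -/
theorem totalDeriv_compT_eq_zero (H : IsLocAdmissible θ θ' Ω F) {t x a : ℝ}
    (hz : (t, x, a) ∈ Ω) {b c : ℝ}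
    (hJ : fderiv ℝ (compT F) (t, x, a) (1, 0, b) * fderiv ℝ (compX F) (t, x, a) (0, 1, c) -
      fderiv ℝ (compT F) (t, x, a) (0, 1, c) * fderiv ℝ (compX F) (t, x, a) (1, 0, b) ≠ 0) :
    fderiv ℝ (compT F) (t, x, a) (0, 1, c) = 0 := by
  set T1 := fderiv ℝ (compT F) (t, x, a) (1, 0, b) with hT1
  set T2 := fderiv ℝ (compT F) (t, x, a) (0, 1, c) with hT2
  set X1 := fderiv ℝ (compX F) (t, x, a) (1, 0, b) with hX1
  set X2 := fderiv ℝ (compX F) (t, x, a) (0, 1, c) with hX2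
  set U1 := fderiv ℝ (compU F) (t, x, a) (1, 0, b) with hU1
  set U2 := fderiv ℝ (compU F) (t, x, a) (0, 1, c) with hU2
  set J := T1 * X2 - T2 * X1 with hJdef
  -- The values of W, V, α and β come from Cramer's rule for the two linear systems with determinant
  -- J.
  have e1 : U1 = ((U1 * X2 - U2 * X1) / J) * T1 + ((T1 * U2 - T2 * U1) / J) * X1 := by
    field_simp; rw [hJdef]; ring
  have e2 : U2 = ((U1 * X2 - U2 * X1) / J) * T2 + ((T1 * U2 - T2 * U1) / J) * X2 := by
    field_simp; rw [hJdef]; ring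
  have e3 : (-T2 / J) * T1 + (T1 / J) * T2 = 0 := by field_simp; ring
  have e4 : (-T2 / J) * X1 + (T1 / J) * X2 = 1 := by field_simp; rw [hJdef]; ring
  have hg := θ.g_ne_zero x (H.base_mem _ hz)
  have hg' := θ'.g_ne_zero _ (H.mem_I _ hz)
  have hK := H.vertical_ne_zero hz e1 e2
  -- Since g ≠ 0, the equation can be solved for u_xx, so the jet lies on the source equation
  -- whatever `b` and `c` are.
  have hs : θ.f x * b = deriv θ.g x * c +
      θ.g x * ((θ.f x * b - deriv θ.g x * c - θ.h x * |a| ^ θ.m) / θ.g x) + θ.h x * |a| ^ θ.m := by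
    field_simp; ring
  have r0 := (H.jet_iff hz _ 0 hJ e1 e2 e3 e4).1 hs
  have r1 := (H.jet_iff hz _ 1 hJ e1 e2 e3 e4).1 hs
  have h0 : θ'.g (compX F (t, x, a)) * (fderiv ℝ (compU F) (t, x, a) (0, 0, 1) -
      (U1 * X2 - U2 * X1) / J * fderiv ℝ (compT F) (t, x, a) (0, 0, 1) -
      (T1 * U2 - T2 * U1) / J * fderiv ℝ (compX F) (t, x, a) (0, 0, 1)) * (-T2 / J) ^ 2 = 0 := by
    linear_combination r0 - r1
  have h1 := (mul_eq_zero.1 h0).resolve_left (mul_ne_zero hg' hK)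
  have h2 : -T2 / J = 0 := by simpa using h1
  rw [div_eq_zero_iff] at h2
  simpa using h2.resolve_right hJ

/-- The Jacobian J is a polynomial of degree at most one in (u_t, u_x), and it is not identically
zero because dT and dX are independent. So two values of u_x give J ≠ 0 for the same u_t, and D_x T
= T_x + u_x T_u vanishes at both. -/
theorem fderiv_compT (H : IsLocAdmissible θ θ' Ω F) {z : ℝ × ℝ × ℝ} (hz : z ∈ Ω) :
    fderiv ℝ (compT F) z (0, 1, 0) = 0 ∧ fderiv ℝ (compT F) z (0, 0, 1) = 0 := by
  obtain ⟨t, x, a⟩ := z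
  have key : ∀ b c : ℝ, fderiv ℝ (compT F) (t, x, a) (1, 0, b) *
      fderiv ℝ (compX F) (t, x, a) (0, 1, c) - fderiv ℝ (compT F) (t, x, a) (0, 1, c) *
      fderiv ℝ (compX F) (t, x, a) (1, 0, b) ≠ 0 →
      fderiv ℝ (compT F) (t, x, a) (0, 1, c) = 0 := fun b c h => H.totalDeriv_compT_eq_zero hz h
  obtain ⟨⟨p1, p2, p3⟩, hp, hp', -⟩ := H.surjective hz 1 0 0
  obtain ⟨⟨q1, q2, q3⟩, hq, hq', -⟩ := H.surjective hz 0 1 0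
  rw [clm_apply_triple] at hp hp' hq hq'
  have hs : ∀ b c : ℝ, fderiv ℝ (compT F) (t, x, a) (1, 0, b) *
      fderiv ℝ (compX F) (t, x, a) (0, 1, c) - fderiv ℝ (compT F) (t, x, a) (0, 1, c) *
      fderiv ℝ (compX F) (t, x, a) (1, 0, b) =
      (fderiv ℝ (compT F) (t, x, a) (1, 0, 0) * fderiv ℝ (compX F) (t, x, a) (0, 1, 0) -
        fderiv ℝ (compT F) (t, x, a) (0, 1, 0) * fderiv ℝ (compX F) (t, x, a) (1, 0, 0)) +
      b * (fderiv ℝ (compT F) (t, x, a) (0, 0, 1) * fderiv ℝ (compX F) (t, x, a) (0, 1, 0) -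
        fderiv ℝ (compT F) (t, x, a) (0, 1, 0) * fderiv ℝ (compX F) (t, x, a) (0, 0, 1)) +
      c * (fderiv ℝ (compT F) (t, x, a) (1, 0, 0) * fderiv ℝ (compX F) (t, x, a) (0, 0, 1) -
        fderiv ℝ (compT F) (t, x, a) (0, 0, 1) * fderiv ℝ (compX F) (t, x, a) (1, 0, 0)) := by
    intro b c
    rw [clm_apply_triple _ 1 0 b, clm_apply_triple _ 0 1 c, clm_apply_triple _ 1 0 b,
      clm_apply_triple _ 0 1 c]
    ring
  have hc : ∀ c : ℝ, fderiv ℝ (compT F) (t, x, a) (0, 1, c) =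
      fderiv ℝ (compT F) (t, x, a) (0, 1, 0) + c * fderiv ℝ (compT F) (t, x, a) (0, 0, 1) := by
    intro c; rw [clm_apply_triple _ 0 1 c]; ring
  replace key := fun b c h => (hc c).symm.trans (key b c ((hs b c).trans_ne h))
  set T1 := fderiv ℝ (compT F) (t, x, a) (1, 0, 0)
  set T2 := fderiv ℝ (compT F) (t, x, a) (0, 1, 0)
  set T3 := fderiv ℝ (compT F) (t, x, a) (0, 0, 1)
  set X1 := fderiv ℝ (compX F) (t, x, a) (1, 0, 0)
  set X2 := fderiv ℝ (compX F) (t, x, a) (0, 1, 0)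
  set X3 := fderiv ℝ (compX F) (t, x, a) (0, 0, 1)
  have hne : ∃ b c : ℝ, (T1 * X2 - T2 * X1) + b * (T3 * X2 - T2 * X3) +
      c * (T1 * X3 - T3 * X1) ≠ 0 := by
    by_contra! hall
    have h00 := hall 0 0
    have h10 := hall 1 0
    have h01 := hall 0 1
    have m1 : T1 * X2 - T2 * X1 = 0 := by linear_combination h00
    have m2 : T3 * X2 - T2 * X3 = 0 := by linear_combination h10 - h00
    have m3 : T1 * X3 - T3 * X1 = 0 := by linear_combination h01 - h00
    -- The vectors p and q have (dT, dX)-images (1, 0) and (0, 1). By Cauchy–Binet the determinant 1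
    -- of these images is a combination of the three minors of (dT, dX), all assumed to vanish.
    have : (1 : ℝ) = 0 := by
      linear_combination -hp * (q1 * X1 + q2 * X2 + q3 * X3) - hq' + hq * (p1 * X1 + p2 * X2 + p3 * X3) +
        (p1 * q2 - p2 * q1) * m1 + (p3 * q2 - p2 * q3) * m2 + (p1 * q3 - p3 * q1) * m3
    norm_num at this
  obtain ⟨b, c, hbc⟩ := hne
  -- the degeneracy condition is affine in `c`
  have hne' : ∃ c' ≠ c, (T1 * X2 - T2 * X1) + b * (T3 * X2 - T2 * X3) +
      c' * (T1 * X3 - T3 * X1) ≠ 0 := by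
    by_contra! hall
    have h1 := hall (c + 1) (by simp)
    have h2 := hall (c + 2) (by simp)
    exact hbc (by linear_combination 2 * h1 - h2)
  obtain ⟨c', hc', hbc'⟩ := hne'
  have k1 := key b c hbc
  have k2 := key b c' hbc'
  have h3 : T3 = 0 := (mul_eq_zero.1 (by linear_combination k2 - k1 : (c' - c) * T3 = 0)).resolve_left
    (sub_ne_zero.2 hc')
  exact ⟨by rw [h3] at k1; linarith, h3⟩

end IsLocAdmissible

/-! ### Independence of the new x from u, and the determining equations. -/

theorem hess_smul (G : ℝ × ℝ × ℝ → ℝ) (z w : ℝ × ℝ × ℝ) (r : ℝ) :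
    hess G z (r • w) = r ^ 2 * hess G z w := by
  simp only [hess, map_smul, smul_apply, smul_eq_mul]; ring

theorem fderiv_fderiv_apply {G : ℝ × ℝ × ℝ → ℝ} {z : ℝ × ℝ × ℝ} (hG : ContDiffAt ℝ ∞ G z)
    (w w' : ℝ × ℝ × ℝ) :
    fderiv ℝ (fderiv ℝ G) z w w' = fderiv ℝ (fun z => fderiv ℝ G z w') z w := by
  have h3 : DifferentiableAt ℝ (fderiv ℝ G) z :=
    (hG.fderiv_right (m := ∞) le_rfl).differentiableAt (by simp)
  have := h3.hasFDerivAt.clm_apply (hasFDerivAt_const w' z)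
  rw [this.fderiv]; simp

theorem fderiv_fderiv_eq_zero {G : ℝ × ℝ × ℝ → ℝ} {z : ℝ × ℝ × ℝ} (hG : ContDiffAt ℝ ∞ G z)
    {w' : ℝ × ℝ × ℝ} (h : ∀ᶠ y in 𝓝 z, fderiv ℝ G y w' = 0) (w : ℝ × ℝ × ℝ) :
    fderiv ℝ (fderiv ℝ G) z w w' = 0 := by
  rw [fderiv_fderiv_apply hG]
  have : (fun y => fderiv ℝ G y w') =ᶠ[𝓝 z] fun _ => 0 := h
  rw [this.fderiv_eq]; simp

theorem fderiv_fderiv_comm {G : ℝ × ℝ × ℝ → ℝ} {z : ℝ × ℝ × ℝ} (hG : ContDiffAt ℝ ∞ G z)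
    (w w' : ℝ × ℝ × ℝ) : fderiv ℝ (fderiv ℝ G) z w w' = fderiv ℝ (fderiv ℝ G) z w' w :=
  (hG.isSymmSndFDerivAt (by simpa using (WithTop.coe_le_coe.2 le_top : ((2 : ℕ∞) : ℕ∞ω) ≤ ∞))) w w'

theorem hess_x_u (G : ℝ × ℝ × ℝ → ℝ) (z : ℝ × ℝ × ℝ) (c : ℝ) :
    hess G z (0, 1, c) = hess G z (0, 1, 0) +
      c * (fderiv ℝ (fderiv ℝ G) z (0, 1, 0) (0, 0, 1) +
        fderiv ℝ (fderiv ℝ G) z (0, 0, 1) (0, 1, 0)) + c ^ 2 * hess G z (0, 0, 1) := by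
  have : ((0, 1, c) : ℝ × ℝ × ℝ) = (0, 1, 0) + c • (0, 0, 1) := by simp
  simp only [hess, this, map_add, map_smul, add_apply, smul_apply, smul_eq_mul]
  ring

namespace IsLocAdmissible

theorem fderiv_compT_t_ne_zero (H : IsLocAdmissible θ θ' Ω F) {z : ℝ × ℝ × ℝ} (hz : z ∈ Ω) :
    fderiv ℝ (compT F) z (1, 0, 0) ≠ 0 := by
  intro h
  obtain ⟨⟨e1, e2, e3⟩, he, -, -⟩ := H.surjective hz 1 0 0
  rw [clm_apply_triple, h, (H.fderiv_compT hz).1, (H.fderiv_compT hz).2] at he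
  simp at he

theorem hess_compT (H : IsLocAdmissible θ θ' Ω F) {z : ℝ × ℝ × ℝ} (hz : z ∈ Ω) (p q : ℝ) :
    hess (compT F) z (0, p, q) = 0 := by
  refine fderiv_fderiv_eq_zero (H.contDiffAt_compT hz) ?_ _
  filter_upwards [H.isOpen.mem_nhds hz] with y hy
  rw [clm_apply_triple, (H.fderiv_compT hy).1, (H.fderiv_compT hy).2]; simp

/-- With T_x = T_u = 0 the direction mapped to the new x-axis is (0, 1 / D_x X), so α = 0. The terms
with u_tt and with the Hessian of T drop out. -/
theorem jet_iff_of_time (H : IsLocAdmissible θ θ' Ω F) {t x a : ℝ} (hz : (t, x, a) ∈ Ω)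
    (b c d : ℝ) (hX : fderiv ℝ (compX F) (t, x, a) (0, 1, c) ≠ 0) {V W : ℝ}
    (hV : fderiv ℝ (compU F) (t, x, a) (0, 1, c) = V * fderiv ℝ (compX F) (t, x, a) (0, 1, c))
    (hW : fderiv ℝ (compU F) (t, x, a) (1, 0, b) = W * fderiv ℝ (compT F) (t, x, a) (1, 0, 0) +
      V * fderiv ℝ (compX F) (t, x, a) (1, 0, b)) :
    (fderiv ℝ (compU F) (t, x, a) (0, 0, 1) - V * fderiv ℝ (compX F) (t, x, a) (0, 0, 1)) ≠ 0 ∧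
    (θ.f x * b = deriv θ.g x * c + θ.g x * d + θ.h x * |a| ^ θ.m ↔
    θ'.f (compX F (t, x, a)) * W = deriv θ'.g (compX F (t, x, a)) * V +
      θ'.g (compX F (t, x, a)) * (hess (compU F) (t, x, a) (0, 1, c) -
        V * hess (compX F) (t, x, a) (0, 1, c) +
        (fderiv ℝ (compU F) (t, x, a) (0, 0, 1) - V * fderiv ℝ (compX F) (t, x, a) (0, 0, 1)) * d) /
        fderiv ℝ (compX F) (t, x, a) (0, 1, c) ^ 2 +
      θ'.h (compX F (t, x, a)) * |compU F (t, x, a)| ^ θ'.m) := by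
  obtain ⟨hT2, hT3⟩ := H.fderiv_compT hz
  have hT1 := H.fderiv_compT_t_ne_zero hz
  have ht : fderiv ℝ (compT F) (t, x, a) (1, 0, b) = fderiv ℝ (compT F) (t, x, a) (1, 0, 0) := by
    rw [clm_apply_triple _ 1 0 b, hT2, hT3]; ring
  have hx : fderiv ℝ (compT F) (t, x, a) (0, 1, c) = 0 := by
    rw [clm_apply_triple, hT2, hT3]; ring
  have e1 : fderiv ℝ (compU F) (t, x, a) (1, 0, b) = W * fderiv ℝ (compT F) (t, x, a) (1, 0, b) +
      V * fderiv ℝ (compX F) (t, x, a) (1, 0, b) := by rw [ht, hW]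
  have e2 : fderiv ℝ (compU F) (t, x, a) (0, 1, c) = W * fderiv ℝ (compT F) (t, x, a) (0, 1, c) +
      V * fderiv ℝ (compX F) (t, x, a) (0, 1, c) := by rw [hx, hV]; ring
  have hK := H.vertical_ne_zero hz e1 e2
  rw [hT3, mul_zero, sub_zero] at hK
  refine ⟨hK, ?_⟩
  rw [H.jet_iff hz (α := 0) (β := (fderiv ℝ (compX F) (t, x, a) (0, 1, c))⁻¹) d 0
    (by rw [ht, hx, zero_mul, sub_zero]; exact mul_ne_zero hT1 hX) e1 e2 (by rw [hx]; ring)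
    (by field_simp; ring)]
  have hw : ((0, (fderiv ℝ (compX F) (t, x, a) (0, 1, c))⁻¹,
      b * 0 + c * (fderiv ℝ (compX F) (t, x, a) (0, 1, c))⁻¹) : ℝ × ℝ × ℝ) =
      (fderiv ℝ (compX F) (t, x, a) (0, 1, c))⁻¹ • ((0, 1, c) : ℝ × ℝ × ℝ) := by
    simp [mul_comm]
  rw [hw, hess_smul, hess_smul, hess_smul, H.hess_compT hz, hT3]
  constructor <;> intro h
  · rw [h]; field_simp; ring
  · rw [h]; field_simp; ring

/-- This is the coefficient of u_t: the relations at u_t = 0 and u_t = 1, with u_xx adjusted to stay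
on the source equation, are subtracted, and the common nonzero factor U_u - V X_u is cancelled. -/
theorem sq_totalDeriv_compX (H : IsLocAdmissible θ θ' Ω F) {t x a : ℝ} (hz : (t, x, a) ∈ Ω)
    {c : ℝ} (hX : fderiv ℝ (compX F) (t, x, a) (0, 1, c) ≠ 0) :
    θ'.f (compX F (t, x, a)) * θ.g x * fderiv ℝ (compX F) (t, x, a) (0, 1, c) ^ 2 =
      θ'.g (compX F (t, x, a)) * θ.f x * fderiv ℝ (compT F) (t, x, a) (1, 0, 0) := by
  have hT1 := H.fderiv_compT_t_ne_zero hz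
  have hg := θ.g_ne_zero x (H.base_mem _ hz)
  set V := fderiv ℝ (compU F) (t, x, a) (0, 1, c) / fderiv ℝ (compX F) (t, x, a) (0, 1, c)
    with hVdef
  have hV : fderiv ℝ (compU F) (t, x, a) (0, 1, c) =
    V * fderiv ℝ (compX F) (t, x, a) (0, 1, c) := by rw [hVdef]; field_simp
  have hW : ∀ b : ℝ, fderiv ℝ (compU F) (t, x, a) (1, 0, b) =
      ((fderiv ℝ (compU F) (t, x, a) (1, 0, b) - V * fderiv ℝ (compX F) (t, x, a) (1, 0, b)) /
        fderiv ℝ (compT F) (t, x, a) (1, 0, 0)) * fderiv ℝ (compT F) (t, x, a) (1, 0, 0) +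
      V * fderiv ℝ (compX F) (t, x, a) (1, 0, b) := by intro b; field_simp; ring
  have hs : ∀ b : ℝ, θ.f x * b = deriv θ.g x * c +
      θ.g x * ((θ.f x * b - deriv θ.g x * c - θ.h x * |a| ^ θ.m) / θ.g x) +
        θ.h x * |a| ^ θ.m := by
    intro b; field_simp; ring
  obtain ⟨hK, r0⟩ := H.jet_iff_of_time hz 0 c _ hX hV (hW 0)
  have r0 := r0.1 (hs 0)
  have r1 := (H.jet_iff_of_time hz 1 c _ hX hV (hW 1)).2.1 (hs 1)
  rw [clm_apply_triple _ 1 0 1, clm_apply_triple (fderiv ℝ (compX F) (t, x, a)) 1 0 1] at r1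
  have r := congrArg₂ (· - ·) r1 r0
  refine mul_left_cancel₀ hK ?_
  field_simp at r
  linear_combination r

/-- If X_u ≠ 0, then D_x X = X_x + u_x X_u takes every value, whereas by `sq_totalDeriv_compX` its
nonzero values have one and the same square. After X_u = 0, the vanishing of X_x would make dX
proportional to dT. -/
theorem fderiv_compX (H : IsLocAdmissible θ θ' Ω F) {z : ℝ × ℝ × ℝ} (hz : z ∈ Ω) :
    fderiv ℝ (compX F) z (0, 0, 1) = 0 ∧ fderiv ℝ (compX F) z (0, 1, 0) ≠ 0 := by
  obtain ⟨t, x, a⟩ := z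
  have key := fun c => H.sq_totalDeriv_compX hz (c := c)
  have hfg : θ'.f (compX F (t, x, a)) * θ.g x ≠ 0 :=
    mul_ne_zero (θ'.f_ne_zero _ (H.mem_I _ hz)) (θ.g_ne_zero x (H.base_mem _ hz))
  have hX3 : fderiv ℝ (compX F) (t, x, a) (0, 0, 1) = 0 := by
    by_contra hne
    have hc : ∀ s : ℝ, fderiv ℝ (compX F) (t, x, a)
        (0, 1, (s - fderiv ℝ (compX F) (t, x, a) (0, 1, 0)) /
          fderiv ℝ (compX F) (t, x, a) (0, 0, 1)) = s := by
      intro s; rw [clm_apply_triple]; field_simp; ring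
    have k1 := key _ ((hc 1).trans_ne one_ne_zero)
    have k2 := key _ ((hc 2).trans_ne two_ne_zero)
    rw [hc] at k1 k2
    have : θ'.f (compX F (t, x, a)) * θ.g x = 0 := by linear_combination (k2 - k1) / 3
    exact hfg this
  refine ⟨hX3, fun h => ?_⟩
  obtain ⟨⟨p1, p2, p3⟩, hp, hp', -⟩ := H.surjective hz 0 1 0
  rw [clm_apply_triple, (H.fderiv_compT hz).1, (H.fderiv_compT hz).2] at hp
  rw [clm_apply_triple, h, hX3] at hp'
  have hp1 : p1 = 0 := by simpa [H.fderiv_compT_t_ne_zero hz] using hp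
  simp [hp1] at hp'

/-- The determining equations of the admissible transformations at a point. -/
theorem determining_equations (H : IsLocAdmissible θ θ' Ω F) {t x a : ℝ} (hz : (t, x, a) ∈ Ω)
    {T₁ X₁ X₂ U₁ U₂ U₃ : ℝ}
    (hT₁ : fderiv ℝ (compT F) (t, x, a) (1, 0, 0) = T₁)
    (hX₁ : fderiv ℝ (compX F) (t, x, a) (1, 0, 0) = X₁)
    (hX₂ : fderiv ℝ (compX F) (t, x, a) (0, 1, 0) = X₂)
    (hU₁ : fderiv ℝ (compU F) (t, x, a) (1, 0, 0) = U₁)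
    (hU₂ : fderiv ℝ (compU F) (t, x, a) (0, 1, 0) = U₂)
    (hU₃ : fderiv ℝ (compU F) (t, x, a) (0, 0, 1) = U₃) :
    T₁ ≠ 0 ∧ X₂ ≠ 0 ∧ U₃ ≠ 0 ∧
    θ'.f (compX F (t, x, a)) * θ.g x * X₂ ^ 2 = θ'.g (compX F (t, x, a)) * θ.f x * T₁ ∧
    hess (compU F) (t, x, a) (0, 0, 1) = 0 ∧
    θ'.f (compX F (t, x, a)) * (U₃ * deriv θ.g x / θ.f x - U₃ * X₁ / X₂) / T₁ =
      deriv θ'.g (compX F (t, x, a)) * U₃ / X₂ + θ'.g (compX F (t, x, a)) *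
        (2 * fderiv ℝ (fderiv ℝ (compU F)) (t, x, a) (0, 1, 0) (0, 0, 1) -
          U₃ * hess (compX F) (t, x, a) (0, 1, 0) / X₂) / X₂ ^ 2 ∧
    θ'.f (compX F (t, x, a)) * (U₁ + U₃ * (θ.h x * |a| ^ θ.m) / θ.f x - U₂ * X₁ / X₂) / T₁ =
      deriv θ'.g (compX F (t, x, a)) * U₂ / X₂ + θ'.g (compX F (t, x, a)) *
        (hess (compU F) (t, x, a) (0, 1, 0) - U₂ * hess (compX F) (t, x, a) (0, 1, 0) / X₂) /
          X₂ ^ 2 + θ'.h (compX F (t, x, a)) * |compU F (t, x, a)| ^ θ'.m := by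
  obtain ⟨hX3, hX2⟩ := H.fderiv_compX hz
  have hT := H.fderiv_compT_t_ne_zero hz
  have hsq := H.sq_totalDeriv_compX hz hX2
  have hXc : ∀ c : ℝ, fderiv ℝ (compX F) (t, x, a) (0, 1, c) = X₂ := by
    intro c; rw [clm_apply_triple, hX3, hX₂]; ring
  have hXb : ∀ b : ℝ, fderiv ℝ (compX F) (t, x, a) (1, 0, b) = X₁ := by
    intro b; rw [clm_apply_triple, hX3, hX₁]; ring
  have hUc : ∀ c : ℝ, fderiv ℝ (compU F) (t, x, a) (0, 1, c) = U₂ + c * U₃ := by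
    intro c; rw [clm_apply_triple, hU₂, hU₃]; ring
  have hUb : ∀ b : ℝ, fderiv ℝ (compU F) (t, x, a) (1, 0, b) = U₁ + b * U₃ := by
    intro b; rw [clm_apply_triple, hU₁, hU₃]; ring
  have hXuu : ∀ w, fderiv ℝ (fderiv ℝ (compX F)) (t, x, a) w (0, 0, 1) = 0 := by
    refine fderiv_fderiv_eq_zero (H.contDiffAt_compX hz) ?_
    filter_upwards [H.isOpen.mem_nhds hz] with y hy
    exact (H.fderiv_compX hy).1
  have hHX : ∀ c : ℝ, hess (compX F) (t, x, a) (0, 1, c) =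
      hess (compX F) (t, x, a) (0, 1, 0) := by
    intro c
    rw [hess_x_u, fderiv_fderiv_comm (H.contDiffAt_compX hz) (0, 0, 1) (0, 1, 0), hXuu,
      hess, hess, hXuu]
    ring
  have hHU : ∀ c : ℝ, hess (compU F) (t, x, a) (0, 1, c) =
      hess (compU F) (t, x, a) (0, 1, 0) +
        c * (2 * fderiv ℝ (fderiv ℝ (compU F)) (t, x, a) (0, 1, 0) (0, 0, 1)) +
          c ^ 2 * hess (compU F) (t, x, a) (0, 0, 1) := by
    intro c
    rw [hess_x_u, fderiv_fderiv_comm (H.contDiffAt_compU hz) (0, 0, 1) (0, 1, 0)]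
    ring
  rw [hX₂] at hX2 hsq
  rw [hT₁] at hT hsq
  have hf := θ.f_ne_zero x (H.base_mem _ hz)
  have hg' := θ'.g_ne_zero _ (H.mem_I _ hz)
  -- With u_xx = 0 and u_t solved from the source equation, `c` = u_x is the only free parameter,
  -- and the relation is a quadratic polynomial in it.
  have main : ∀ c : ℝ, U₃ ≠ 0 ∧ θ'.f (compX F (t, x, a)) * ((U₁ +
      ((deriv θ.g x * c + θ.h x * |a| ^ θ.m) / θ.f x) * U₃ - (U₂ + c * U₃) / X₂ * X₁) / T₁) =
      deriv θ'.g (compX F (t, x, a)) * ((U₂ + c * U₃) / X₂) + θ'.g (compX F (t, x, a)) *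
        ((hess (compU F) (t, x, a) (0, 1, 0) +
        c * (2 * fderiv ℝ (fderiv ℝ (compU F)) (t, x, a) (0, 1, 0) (0, 0, 1)) +
          c ^ 2 * hess (compU F) (t, x, a) (0, 0, 1)) -
          (U₂ + c * U₃) / X₂ * hess (compX F) (t, x, a) (0, 1, 0)) / X₂ ^ 2 +
        θ'.h (compX F (t, x, a)) * |compU F (t, x, a)| ^ θ'.m := by
    intro c
    obtain ⟨hK, h⟩ := H.jet_iff_of_time hz ((deriv θ.g x * c + θ.h x * |a| ^ θ.m) / θ.f x) c 0
      (V := (U₂ + c * U₃) / X₂) (W := (U₁ +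
      ((deriv θ.g x * c + θ.h x * |a| ^ θ.m) / θ.f x) * U₃ - (U₂ + c * U₃) / X₂ * X₁) / T₁)
      (by rw [hXc]; exact hX2) (by rw [hXc, hUc]; field_simp)
      (by rw [hUb, hXb, hT₁]; field_simp; ring)
    rw [hX3, hU₃, mul_zero, sub_zero] at hK
    refine ⟨hK, ?_⟩
    have := h.1 (by field_simp; ring)
    rw [hHU, hHX, hXc] at this
    rw [this]; ring
  have hU3 := (main 0).1
  -- The values at 0, 1 and -1 separate the coefficients of c², c and 1.
  have m0 := (main 0).2
  have m1 := (main 1).2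
  have m2 := (main (-1)).2
  refine ⟨hT, hX2, hU3, hsq, ?_, ?_, ?_⟩
  · have : θ'.g (compX F (t, x, a)) / X₂ ^ 2 * hess (compU F) (t, x, a) (0, 0, 1) = 0 := by
      linear_combination (-1 / 2) * m1 + (-1 / 2) * m2 + m0
    exact (mul_eq_zero.1 this).resolve_left (div_ne_zero hg' (pow_ne_zero 2 hX2))
  · linear_combination (1 / 2) * m1 - (1 / 2) * m2
  · linear_combination m0

end IsLocAdmissible

/-! ### Powers of affine functions. -/

/-- Since `Real.log` is even, |u|^m = exp(m log u) for both signs of u. Dividing by the signed power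
u^j instead of lowering the exponent lets one formula serve both signs and be iterated. -/
theorem hasDerivAt_abs_rpow_div_pow (m : ℝ) (j : ℕ) {u : ℝ} (hu : u ≠ 0) :
    HasDerivAt (fun u : ℝ => |u| ^ m / u ^ j) ((m - j) * (|u| ^ m / u ^ (j + 1))) u := by
  have h1 : HasDerivAt (fun u : ℝ => Real.exp (m * Real.log u))
      (Real.exp (m * Real.log u) * (m * u⁻¹)) u :=
    ((Real.hasDerivAt_log hu).const_mul m).exp
  have h2 : ∀ v : ℝ, v ≠ 0 → |v| ^ m = Real.exp (m * Real.log v) := by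
    intro v hv
    rw [Real.rpow_def_of_pos (abs_pos.2 hv), Real.log_abs, mul_comm]
  have h3 : HasDerivAt (fun u : ℝ => |u| ^ m) (|u| ^ m * (m * u⁻¹)) u := by
    rw [h2 u hu]
    refine h1.congr_of_eventuallyEq ?_
    filter_upwards [isOpen_ne.mem_nhds hu] with v hv using h2 v hv
  refine (h3.fun_div (hasDerivAt_pow j u) (pow_ne_zero j hu)).congr_deriv ?_
  rcases j with - | j
  · simp; field_simp
  · field_simp; push_cast; ring

theorem hasDerivAt_abs_rpow_affine (m A B : ℝ) (j : ℕ) {u : ℝ} (hu : A * u + B ≠ 0) :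
    HasDerivAt (fun u : ℝ => |A * u + B| ^ m / (A * u + B) ^ j)
      ((m - j) * A * (|A * u + B| ^ m / (A * u + B) ^ (j + 1))) u := by
  have h : HasDerivAt (fun u : ℝ => A * u + B) A u := by
    simpa using ((hasDerivAt_id u).const_mul A).add_const B
  have h' := HasDerivAt.comp u (hasDerivAt_abs_rpow_div_pow m j hu) h
  exact h'.congr_deriv (by ring)

theorem eventually_deriv_eq {f g f' g' : ℝ → ℝ} {a : ℝ} (h : ∀ᶠ u in 𝓝 a, f u = g u)
    (hf : ∀ᶠ u in 𝓝 a, HasDerivAt f (f' u) u) (hg : ∀ᶠ u in 𝓝 a, HasDerivAt g (g' u) u) :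
    ∀ᶠ u in 𝓝 a, f' u = g' u := by
  filter_upwards [h.eventually_nhds, hf, hg] with u h1 h2 h3
  exact (h2.congr_of_eventuallyEq (h1.mono fun _ h => h.symm)).unique h3

/-- Powers of affine functions are linearly independent modulo affine functions. -/
theorem power_identity {a C₁ C₂ A B α β m m' : ℝ} (ha : a ≠ 0) (hA : A ≠ 0) (haB : A * a + B ≠ 0)
    (hC₁ : C₁ ≠ 0) (hm0 : m ≠ 0) (hm1 : m ≠ 1)
    (h : ∀ᶠ u in 𝓝 a, C₁ * |u| ^ m + (α * u + β) = C₂ * |A * u + B| ^ m') :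
    m' = m ∧ (m ≠ 2 → B = 0) ∧ (B = 0 → C₁ = C₂ * |A| ^ m ∧ α = 0 ∧ β = 0) := by
  have hu : ∀ᶠ u in 𝓝 a, u ≠ 0 := isOpen_ne.mem_nhds ha
  have hw : ∀ᶠ u in 𝓝 a, A * u + B ≠ 0 := by
    have : Continuous fun u => A * u + B := by fun_prop
    exact this.continuousAt.eventually (isOpen_ne.mem_nhds haB)
  have h1 : ∀ᶠ u in 𝓝 a, C₁ * (m * (|u| ^ m / u ^ 1)) + α =
      C₂ * (m' * A * (|A * u + B| ^ m' / (A * u + B) ^ 1)) := by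
    refine eventually_deriv_eq h ?_ ?_
    · filter_upwards [hu] with u hu
      have := hasDerivAt_abs_rpow_div_pow m 0 hu
      simp only [pow_zero, div_one, Nat.cast_zero, sub_zero, zero_add] at this
      have h2 : HasDerivAt (fun u : ℝ => α * u + β) α u := by
        simpa using ((hasDerivAt_id u).const_mul α).add_const β
      exact (this.const_mul C₁).fun_add h2
    · filter_upwards [hw] with u hu
      have := hasDerivAt_abs_rpow_affine m' A B 0 hu
      simp only [pow_zero, div_one, Nat.cast_zero, sub_zero, zero_add] at this
      exact this.const_mul C₂
  -- Two differentiations remove the affine term.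
  have h2 : ∀ᶠ u in 𝓝 a, C₁ * (m * ((m - 1) * (|u| ^ m / u ^ 2))) =
      C₂ * (m' * A * ((m' - 1) * A * (|A * u + B| ^ m' / (A * u + B) ^ 2))) := by
    refine eventually_deriv_eq h1 ?_ ?_
    · filter_upwards [hu] with u hu
      have := hasDerivAt_abs_rpow_div_pow m 1 hu
      simp only [Nat.cast_one] at this
      exact ((this.const_mul m).const_mul C₁).add_const α
    · filter_upwards [hw] with u hu
      have := hasDerivAt_abs_rpow_affine m' A B 1 hu
      simp only [Nat.cast_one] at this
      exact (this.const_mul _).const_mul C₂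
  have h3 : ∀ᶠ u in 𝓝 a, C₁ * (m * ((m - 1) * ((m - 2) * (|u| ^ m / u ^ 3)))) =
      C₂ * (m' * A * ((m' - 1) * A * ((m' - 2) * A * (|A * u + B| ^ m' / (A * u + B) ^ 3)))) := by
    refine eventually_deriv_eq h2 ?_ ?_
    · filter_upwards [hu] with u hu
      have := hasDerivAt_abs_rpow_div_pow m 2 hu
      simp only [Nat.cast_ofNat] at this
      exact ((this.const_mul (m - 1)).const_mul m).const_mul C₁
    · filter_upwards [hw] with u hu
      have := hasDerivAt_abs_rpow_affine m' A B 2 hu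
      simp only [Nat.cast_ofNat] at this
      exact ((this.const_mul _).const_mul _).const_mul C₂
  have hm1' : m - 1 ≠ 0 := sub_ne_zero.2 hm1
  -- The third derivative is divided by the second, which does not vanish because m ≠ 0, 1. The
  -- powers cancel, and (m - 2)/u = (m' - 2)A/(Au + B) remains.
  have h4 : ∀ᶠ u in 𝓝 a, (m - 2) * (A * u + B) = (m' - 2) * A * u := by
    filter_upwards [h2, h3, hu, hw] with u h2 h3 hu hw
    have hpow : |u| ^ m ≠ 0 := (Real.rpow_pos_of_pos (abs_pos.2 hu) m).ne'
    have hne : C₁ * (m * ((m - 1) * (|u| ^ m / u ^ 2))) ≠ 0 :=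
      mul_ne_zero hC₁ (mul_ne_zero hm0 (mul_ne_zero hm1' (div_ne_zero hpow (pow_ne_zero 2 hu))))
    have e1 : C₁ * (m * ((m - 1) * ((m - 2) * (|u| ^ m / u ^ 3)))) =
        C₁ * (m * ((m - 1) * (|u| ^ m / u ^ 2))) * ((m - 2) / u) := by field_simp
    have e2 : C₂ * (m' * A * ((m' - 1) * A * ((m' - 2) * A * (|A * u + B| ^ m' /
        (A * u + B) ^ 3)))) = C₂ * (m' * A * ((m' - 1) * A * (|A * u + B| ^ m' /
        (A * u + B) ^ 2))) * ((m' - 2) * A / (A * u + B)) := by field_simp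
    rw [e1, e2, ← h2] at h3
    have h5 := mul_left_cancel₀ hne h3
    rw [div_eq_div_iff hu hw] at h5
    exact h5
  have h5 : ∀ᶠ u in 𝓝 a, (m - 2) * A = (m' - 2) * A := by
    refine eventually_deriv_eq h4 ?_ ?_
    · refine Filter.Eventually.of_forall fun u => ?_
      simpa using (((hasDerivAt_id u).const_mul A).add_const B).const_mul (m - 2)
    · refine Filter.Eventually.of_forall fun u => ?_
      simpa using (hasDerivAt_id u).const_mul ((m' - 2) * A)
  have hmm : m' = m := by
    have := mul_right_cancel₀ hA h5.self_of_nhds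
    linarith
  refine ⟨hmm, fun hm2 => ?_, ?_⟩
  -- For m = 2 this identity is empty: (Au + B)² differs from A²u² by an affine function, so a shift
  -- cannot be seen here.
  · have h6 := h4.self_of_nhds
    rw [hmm] at h6
    exact (mul_eq_zero.1 (by linear_combination h6 : (m - 2) * B = 0)).resolve_left
      (sub_ne_zero.2 hm2)
  · rintro rfl
    subst hmm
    have hpow : |a| ^ m' ≠ 0 := (Real.rpow_pos_of_pos (abs_pos.2 ha) m').ne'
    have habs : |A * a + 0| ^ m' = |A| ^ m' * |a| ^ m' := by
      rw [add_zero, abs_mul, Real.mul_rpow (abs_nonneg _) (abs_nonneg _)]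
    have k2 := h2.self_of_nhds
    have k1 := h1.self_of_nhds
    have k0 := h.self_of_nhds
    rw [habs] at k0 k1 k2
    simp only [add_zero] at k1 k2
    have e : C₁ = C₂ * |A| ^ m' := by
      field_simp at k2
      exact k2
    rw [← mul_assoc, ← e] at k0
    have hα : α = 0 := by
      have : C₂ * (m' * A * (|A| ^ m' * |a| ^ m' / (A * a) ^ 1)) =
          C₂ * |A| ^ m' * (m' * (|a| ^ m' / a ^ 1)) := by field_simp
      rw [this, ← e] at k1
      linarith
    exact ⟨e, hα, by rw [hα] at k0; linarith⟩

/-! ### Integration of the determining equations on boxes. -/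

theorem hasDerivAt_line {G : ℝ × ℝ × ℝ → ℝ} {z : ℝ × ℝ × ℝ} (hG : ContDiffAt ℝ ∞ G z)
    (w : ℝ × ℝ × ℝ) : HasDerivAt (fun r : ℝ => G (z + r • w)) (fderiv ℝ G z w) 0 := by
  have := hasDerivAt_comp_quadCurve (G := G) (z := z) w 0 (r := 0)
    (by simpa using hG.differentiableAt (by simp))
  simpa using this

theorem hasDerivAt_deriv_line {G : ℝ × ℝ × ℝ → ℝ} {z : ℝ × ℝ × ℝ} (hG : ContDiffAt ℝ ∞ G z)
    (w : ℝ × ℝ × ℝ) : HasDerivAt (deriv fun r : ℝ => G (z + r • w)) (hess G z w) 0 := by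
  have := hasDerivAt_deriv_quadCurve (G := G) w 0 hG
  simpa [hess] using this

/-- Along a line the hypothesis is a linear relation between functions of one variable, which can be
differentiated twice. It carries derivatives in t and x from one value of u to another. -/
theorem fderiv_hess_of_comb {G : ℝ × ℝ × ℝ → ℝ} {z z₁ z₂ w : ℝ × ℝ × ℝ} {p q : ℝ}
    (hG : ContDiffAt ℝ ∞ G z) (hG₁ : ContDiffAt ℝ ∞ G z₁) (hG₂ : ContDiffAt ℝ ∞ G z₂)
    (h : ∀ᶠ r in 𝓝 (0 : ℝ), G (z + r • w) = p * G (z₁ + r • w) + q * G (z₂ + r • w)) :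
    fderiv ℝ G z w = p * fderiv ℝ G z₁ w + q * fderiv ℝ G z₂ w ∧
      hess G z w = p * hess G z₁ w + q * hess G z₂ w := by
  have hdiff : ∀ z : ℝ × ℝ × ℝ, ContDiffAt ℝ ∞ G z →
      ∀ᶠ r in 𝓝 (0 : ℝ), DifferentiableAt ℝ (fun r : ℝ => G (z + r • w)) r := by
    intro z hG
    have h1 := (hG.of_le (m := 1) (by exact_mod_cast le_top)).eventually (by simp)
    have hc : Filter.Tendsto (fun r : ℝ => z + r • w) (𝓝 0) (𝓝 z) := by
      have : Continuous (fun r : ℝ => z + r • w) := by fun_prop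
      simpa using this.tendsto 0
    filter_upwards [hc.eventually h1] with r hr
    exact DifferentiableAt.comp r (hr.differentiableAt (by simp)) (by fun_prop)
  constructor
  · exact ((hasDerivAt_line hG w).congr_of_eventuallyEq (h.mono fun _ h => h.symm)).unique
      (((hasDerivAt_line hG₁ w).const_mul p).fun_add ((hasDerivAt_line hG₂ w).const_mul q))
  · have hd : (deriv fun r : ℝ => G (z + r • w)) =ᶠ[𝓝 0]
        fun r => p * deriv (fun r : ℝ => G (z₁ + r • w)) r +
          q * deriv (fun r : ℝ => G (z₂ + r • w)) r := by
      filter_upwards [h.eventually_nhds, hdiff z₁ hG₁, hdiff z₂ hG₂] with r h1 h2 h3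
      have : (fun r : ℝ => G (z + r • w)) =ᶠ[𝓝 r]
        fun r => p * G (z₁ + r • w) + q * G (z₂ + r • w) := h1
      rw [this.deriv_eq]
      exact ((h2.hasDerivAt.const_mul p).fun_add (h3.hasDerivAt.const_mul q)).deriv
    exact ((hasDerivAt_deriv_line hG w).congr_of_eventuallyEq hd.symm).unique
      (((hasDerivAt_deriv_line hG₁ w).const_mul p).fun_add
        ((hasDerivAt_deriv_line hG₂ w).const_mul q))

theorem eq_of_hasDerivAt_zero {I : Set ℝ} (ho : IsOpen I) (hc : IsPreconnected I) {f : ℝ → ℝ}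
    (hf : ∀ x ∈ I, HasDerivAt f 0 x) {x y : ℝ} (hx : x ∈ I) (hy : y ∈ I) : f x = f y :=
  ho.is_const_of_deriv_eq_zero hc (fun x hx => (hf x hx).differentiableAt.differentiableWithinAt)
    (fun x hx => (hf x hx).deriv) hx hy

theorem hasDerivAt_partial_t {G : ℝ × ℝ × ℝ → ℝ} {t x u : ℝ} (hG : DifferentiableAt ℝ G (t, x, u)) :
    HasDerivAt (fun t => G (t, x, u)) (fderiv ℝ G (t, x, u) (1, 0, 0)) t :=
  hG.hasFDerivAt.comp_hasDerivAt t ((hasDerivAt_id t).prodMk (hasDerivAt_const t (x, u)))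

theorem hasDerivAt_partial_x {G : ℝ × ℝ × ℝ → ℝ} {t x u : ℝ} (hG : DifferentiableAt ℝ G (t, x, u)) :
    HasDerivAt (fun x => G (t, x, u)) (fderiv ℝ G (t, x, u) (0, 1, 0)) x :=
  hG.hasFDerivAt.comp_hasDerivAt x
    ((hasDerivAt_const x t).prodMk ((hasDerivAt_id x).prodMk (hasDerivAt_const x u)))

theorem hasDerivAt_partial_u {G : ℝ × ℝ × ℝ → ℝ} {t x u : ℝ} (hG : DifferentiableAt ℝ G (t, x, u)) :
    HasDerivAt (fun u => G (t, x, u)) (fderiv ℝ G (t, x, u) (0, 0, 1)) u :=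
  hG.hasFDerivAt.comp_hasDerivAt u
    ((hasDerivAt_const u t).prodMk ((hasDerivAt_const u x).prodMk (hasDerivAt_id u)))

theorem differentiableAt_fderiv_apply {G : ℝ × ℝ × ℝ → ℝ} {z : ℝ × ℝ × ℝ}
    (hG : ContDiffAt ℝ ∞ G z) (w : ℝ × ℝ × ℝ) :
    DifferentiableAt ℝ (fun z => fderiv ℝ G z w) z :=
  (((hG.fderiv_right (m := ∞) le_rfl).differentiableAt (by simp)).hasFDerivAt.clm_apply
    (hasFDerivAt_const w z)).differentiableAt

/-- Open boxes in the space of `(t, x, u)`. -/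
structure IsBox (It Ix Iu : Set ℝ) : Prop where
  open_t : IsOpen It
  open_x : IsOpen Ix
  open_u : IsOpen Iu
  conn_t : IsPreconnected It
  conn_x : IsPreconnected Ix
  conn_u : IsPreconnected Iu

theorem exists_isBox {Ω : Set (ℝ × ℝ × ℝ)} (hΩ : IsOpen Ω) {t x u : ℝ} (hz : (t, x, u) ∈ Ω) :
    ∃ It Ix Iu, IsBox It Ix Iu ∧ It ×ˢ Ix ×ˢ Iu ⊆ Ω ∧ t ∈ It ∧ x ∈ Ix ∧ u ∈ Iu := by
  obtain ⟨ε, hε, h⟩ := Metric.isOpen_iff.1 hΩ _ hz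
  refine ⟨Metric.ball t ε, Metric.ball x ε, Metric.ball u ε,
    ⟨Metric.isOpen_ball, Metric.isOpen_ball, Metric.isOpen_ball,
      (convex_ball _ _).isPreconnected, (convex_ball _ _).isPreconnected,
      (convex_ball _ _).isPreconnected⟩, ?_, Metric.mem_ball_self hε, Metric.mem_ball_self hε,
      Metric.mem_ball_self hε⟩
  rw [ball_prod_same, ball_prod_same]
  exact h

namespace IsLocAdmissible
variable {It Ix Iu : Set ℝ}

theorem box_compT (H : IsLocAdmissible θ θ' (It ×ˢ Ix ×ˢ Iu) F) (hB : IsBox It Ix Iu)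
    {t x u x' u' : ℝ} (ht : t ∈ It) (hx : x ∈ Ix) (hu : u ∈ Iu) (hx' : x' ∈ Ix) (hu' : u' ∈ Iu) :
    compT F (t, x, u) = compT F (t, x', u') := by
  trans compT F (t, x', u)
  · refine eq_of_hasDerivAt_zero (f := fun x => compT F (t, x, u)) hB.open_x hB.conn_x
      (fun y hy => ?_) hx hx'
    have hz : (t, y, u) ∈ It ×ˢ Ix ×ˢ Iu := ⟨ht, hy, hu⟩
    have := hasDerivAt_partial_x ((H.contDiffAt_compT hz).differentiableAt (by simp))
    rwa [(H.fderiv_compT hz).1] at this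
  · refine eq_of_hasDerivAt_zero (f := fun u => compT F (t, x', u)) hB.open_u hB.conn_u
      (fun y hy => ?_) hu hu'
    have hz : (t, x', y) ∈ It ×ˢ Ix ×ˢ Iu := ⟨ht, hx', hy⟩
    have := hasDerivAt_partial_u ((H.contDiffAt_compT hz).differentiableAt (by simp))
    rwa [(H.fderiv_compT hz).2] at this

theorem box_compX (H : IsLocAdmissible θ θ' (It ×ˢ Ix ×ˢ Iu) F) (hB : IsBox It Ix Iu)
    {t x u u' : ℝ} (ht : t ∈ It) (hx : x ∈ Ix) (hu : u ∈ Iu) (hu' : u' ∈ Iu) :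
    compX F (t, x, u) = compX F (t, x, u') := by
  refine eq_of_hasDerivAt_zero (f := fun u => compX F (t, x, u)) hB.open_u hB.conn_u
    (fun y hy => ?_) hu hu'
  have hz : (t, x, y) ∈ It ×ˢ Ix ×ˢ Iu := ⟨ht, hx, hy⟩
  have := hasDerivAt_partial_u ((H.contDiffAt_compX hz).differentiableAt (by simp))
  rwa [(H.fderiv_compX hz).1] at this

theorem box_fderiv_compU (H : IsLocAdmissible θ θ' (It ×ˢ Ix ×ˢ Iu) F) (hB : IsBox It Ix Iu)
    {t x u u' : ℝ} (ht : t ∈ It) (hx : x ∈ Ix) (hu : u ∈ Iu) (hu' : u' ∈ Iu) :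
    fderiv ℝ (compU F) (t, x, u) (0, 0, 1) = fderiv ℝ (compU F) (t, x, u') (0, 0, 1) := by
  refine eq_of_hasDerivAt_zero (f := fun u => fderiv ℝ (compU F) (t, x, u) (0, 0, 1))
    hB.open_u hB.conn_u (fun y hy => ?_) hu hu'
  have hz : (t, x, y) ∈ It ×ˢ Ix ×ˢ Iu := ⟨ht, hx, hy⟩
  have := hasDerivAt_partial_u (differentiableAt_fderiv_apply (H.contDiffAt_compU hz) (0, 0, 1))
  rw [← fderiv_fderiv_apply (H.contDiffAt_compU hz)] at this
  have h0 := (H.determining_equations hz rfl rfl rfl rfl rfl rfl).2.2.2.2.1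
  rw [hess] at h0
  rwa [h0] at this

theorem box_compU (H : IsLocAdmissible θ θ' (It ×ˢ Ix ×ˢ Iu) F) (hB : IsBox It Ix Iu)
    {t x u u' : ℝ} (ht : t ∈ It) (hx : x ∈ Ix) (hu : u ∈ Iu) (hu' : u' ∈ Iu) :
    compU F (t, x, u') = fderiv ℝ (compU F) (t, x, u) (0, 0, 1) * u' +
      (compU F (t, x, u) - fderiv ℝ (compU F) (t, x, u) (0, 0, 1) * u) := by
  have := eq_of_hasDerivAt_zero
    (f := fun v => compU F (t, x, v) - fderiv ℝ (compU F) (t, x, u) (0, 0, 1) * v)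
    hB.open_u hB.conn_u (fun y hy => ?_) hu' hu
  · linarith
  · have hz : (t, x, y) ∈ It ×ˢ Ix ×ˢ Iu := ⟨ht, hx, hy⟩
    have h1 := hasDerivAt_partial_u ((H.contDiffAt_compU hz).differentiableAt (by simp))
    rw [H.box_fderiv_compU hB ht hx hy hu] at h1
    have h2 : HasDerivAt (fun v : ℝ => fderiv ℝ (compU F) (t, x, u) (0, 0, 1) * v)
        (fderiv ℝ (compU F) (t, x, u) (0, 0, 1)) y := by
      simpa using (hasDerivAt_id y).const_mul (fderiv ℝ (compU F) (t, x, u) (0, 0, 1))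
    simpa using h1.fun_sub h2

/-- Consequences of the determining equations that follow from varying `u`. -/
theorem box_power (H : IsLocAdmissible θ θ' (It ×ˢ Ix ×ˢ Iu) F) (hB : IsBox It Ix Iu)
    {t x a : ℝ} (ht : t ∈ It) (hx : x ∈ Ix) (ha : a ∈ Iu)
    {T₁ X₁ X₂ U₁ U₂ U₃ : ℝ}
    (hT₁ : fderiv ℝ (compT F) (t, x, a) (1, 0, 0) = T₁)
    (hX₁ : fderiv ℝ (compX F) (t, x, a) (1, 0, 0) = X₁)
    (hX₂ : fderiv ℝ (compX F) (t, x, a) (0, 1, 0) = X₂)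
    (hU₁ : fderiv ℝ (compU F) (t, x, a) (1, 0, 0) = U₁)
    (hU₂ : fderiv ℝ (compU F) (t, x, a) (0, 1, 0) = U₂)
    (hU₃ : fderiv ℝ (compU F) (t, x, a) (0, 0, 1) = U₃) :
    θ'.m = θ.m ∧ (θ.m ≠ 2 → compU F (t, x, a) = U₃ * a) ∧
    (compU F (t, x, a) = U₃ * a →
      θ'.f (compX F (t, x, a)) * U₃ * θ.h x / (θ.f x * T₁) =
        θ'.h (compX F (t, x, a)) * |U₃| ^ θ.m ∧
      θ'.f (compX F (t, x, a)) * (U₁ - U₂ * X₁ / X₂) / T₁ =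
      deriv θ'.g (compX F (t, x, a)) * U₂ / X₂ + θ'.g (compX F (t, x, a)) *
        (hess (compU F) (t, x, a) (0, 1, 0) - U₂ * hess (compX F) (t, x, a) (0, 1, 0) / X₂) /
          X₂ ^ 2) := by
  have hz : (t, x, a) ∈ It ×ˢ Ix ×ˢ Iu := ⟨ht, hx, ha⟩
  obtain ⟨hT, hX, hU, -⟩ := H.determining_equations hz hT₁ hX₁ hX₂ hU₁ hU₂ hU₃
  -- U is affine in u, so its values and its derivatives in t, x are interpolated from those at the
  -- two points `a` and `a'`.
  obtain ⟨a', ha', hne⟩ : ∃ a' ∈ Iu, a' ≠ a := by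
    have h1 : ∀ᶠ v in 𝓝[≠] a, v ∈ Iu := nhdsWithin_le_nhds (hB.open_u.mem_nhds ha)
    obtain ⟨v, hv, hv'⟩ := (h1.and self_mem_nhdsWithin).exists
    exact ⟨v, hv, hv'⟩
  have hsub : a - a' ≠ 0 := sub_ne_zero.2 hne.symm
  have hz' : (t, x, a') ∈ It ×ˢ Ix ×ˢ Iu := ⟨ht, hx, ha'⟩
  -- derivatives at other values of `u`
  have hline : ∀ (p q : ℝ), ∀ᶠ r in 𝓝 (0 : ℝ), t + r * p ∈ It ∧ x + r * q ∈ Ix := by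
    intro p q
    have h1 : Filter.Tendsto (fun r : ℝ => t + r * p) (𝓝 0) (𝓝 t) := by
      have : Continuous (fun r : ℝ => t + r * p) := by fun_prop
      simpa using this.tendsto 0
    have h2 : Filter.Tendsto (fun r : ℝ => x + r * q) (𝓝 0) (𝓝 x) := by
      have : Continuous (fun r : ℝ => x + r * q) := by fun_prop
      simpa using this.tendsto 0
    exact (h1.eventually (hB.open_t.mem_nhds ht)).and (h2.eventually (hB.open_x.mem_nhds hx))
  have hXu : ∀ u ∈ Iu, ∀ p q : ℝ,
      fderiv ℝ (compX F) (t, x, u) (p, q, 0) = fderiv ℝ (compX F) (t, x, a) (p, q, 0) ∧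
      hess (compX F) (t, x, u) (p, q, 0) = hess (compX F) (t, x, a) (p, q, 0) := by
    intro u hu p q
    have := fderiv_hess_of_comb (G := compX F) (z := (t, x, u)) (z₁ := (t, x, a))
      (z₂ := (t, x, a)) (w := (p, q, 0)) (p := 1) (q := 0) (H.contDiffAt_compX ⟨ht, hx, hu⟩)
      (H.contDiffAt_compX hz) (H.contDiffAt_compX hz) ?_
    · simpa using this
    · filter_upwards [hline p q] with r hr
      simpa using H.box_compX hB hr.1 hr.2 hu ha
  have hTu : ∀ u ∈ Iu, fderiv ℝ (compT F) (t, x, u) (1, 0, 0) =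
      fderiv ℝ (compT F) (t, x, a) (1, 0, 0) := by
    intro u hu
    have := fderiv_hess_of_comb (G := compT F) (z := (t, x, u)) (z₁ := (t, x, a))
      (z₂ := (t, x, a)) (w := (1, 0, 0)) (p := 1) (q := 0) (H.contDiffAt_compT ⟨ht, hx, hu⟩)
      (H.contDiffAt_compT hz) (H.contDiffAt_compT hz) ?_
    · simpa using this.1
    · filter_upwards [hline 1 0] with r hr
      simpa using H.box_compT hB (by simpa using hr.1) hx hu hx ha
  have hUu : ∀ u ∈ Iu, ∀ p q : ℝ,
      fderiv ℝ (compU F) (t, x, u) (p, q, 0) =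
        (u - a') / (a - a') * fderiv ℝ (compU F) (t, x, a) (p, q, 0) +
        (a - u) / (a - a') * fderiv ℝ (compU F) (t, x, a') (p, q, 0) ∧
      hess (compU F) (t, x, u) (p, q, 0) =
        (u - a') / (a - a') * hess (compU F) (t, x, a) (p, q, 0) +
        (a - u) / (a - a') * hess (compU F) (t, x, a') (p, q, 0) := by
    intro u hu p q
    refine fderiv_hess_of_comb (H.contDiffAt_compU ⟨ht, hx, hu⟩) (H.contDiffAt_compU hz)
      (H.contDiffAt_compU hz') ?_
    filter_upwards [hline p q] with r hr
    simp only [Prod.smul_mk, Prod.mk_add_mk, smul_eq_mul, mul_zero, add_zero]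
    rw [H.box_compU hB hr.1 hr.2 ha hu, H.box_compU hB hr.1 hr.2 ha ha']
    field_simp; ring
  -- `L` collects the terms of the last determining equation that contain no power; it is affine in
  -- u by interpolation.
  set L : ℝ → ℝ := fun u => θ'.f (compX F (t, x, a)) *
      (fderiv ℝ (compU F) (t, x, u) (1, 0, 0) -
        fderiv ℝ (compU F) (t, x, u) (0, 1, 0) * X₁ / X₂) / T₁ -
      deriv θ'.g (compX F (t, x, a)) * fderiv ℝ (compU F) (t, x, u) (0, 1, 0) / X₂ -
      θ'.g (compX F (t, x, a)) * (hess (compU F) (t, x, u) (0, 1, 0) -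
        fderiv ℝ (compU F) (t, x, u) (0, 1, 0) * hess (compX F) (t, x, a) (0, 1, 0) / X₂) /
          X₂ ^ 2 with hL
  have hLu : ∀ u ∈ Iu, L u = (L a - L a') / (a - a') * u + (a * L a' - a' * L a) / (a - a') := by
    intro u hu
    have e : L u = (u - a') / (a - a') * L a + (a - u) / (a - a') * L a' := by
      simp only [hL]
      rw [(hUu u hu 1 0).1, (hUu u hu 0 1).1, (hUu u hu 0 1).2]
      ring
    rw [e]; field_simp; ring
  -- The last determining equation at all u near `a`, arranged as the hypothesis of `power_identity`
  -- with A = U_u and B = U - U_u a.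
  have hId : ∀ᶠ u in 𝓝 a, θ'.f (compX F (t, x, a)) * U₃ * θ.h x / (θ.f x * T₁) * |u| ^ θ.m +
      ((L a - L a') / (a - a') * u + (a * L a' - a' * L a) / (a - a')) =
      θ'.h (compX F (t, x, a)) * |U₃ * u + (compU F (t, x, a) - U₃ * a)| ^ θ'.m := by
    filter_upwards [hB.open_u.mem_nhds ha] with u hu
    have hzu : (t, x, u) ∈ It ×ˢ Ix ×ˢ Iu := ⟨ht, hx, hu⟩
    have h := (H.determining_equations hzu ((hTu u hu).trans hT₁) ((hXu u hu 1 0).1.trans hX₁)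
      ((hXu u hu 0 1).1.trans hX₂) rfl rfl
      ((H.box_fderiv_compU hB ht hx hu ha).trans hU₃)).2.2.2.2.2.2
    rw [H.box_compX hB ht hx hu ha, (hXu u hu 0 1).2, H.box_compU hB ht hx ha hu, hU₃] at h
    rw [← hLu u hu]
    have hf := θ.f_ne_zero x (H.base_mem _ hz)
    simp only [hL]
    have e : θ'.f (compX F (t, x, a)) * U₃ * θ.h x / (θ.f x * T₁) * |u| ^ θ.m =
        θ'.f (compX F (t, x, a)) * (U₃ * (θ.h x * |u| ^ θ.m) / θ.f x) / T₁ := by field_simp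
    rw [e]
    linear_combination h
  have hf := θ.f_ne_zero x (H.base_mem _ hz)
  have hh := θ.h_ne_zero x (H.base_mem _ hz)
  have hf' := θ'.f_ne_zero _ (H.mem_I _ hz)
  obtain ⟨h1, h2, h3⟩ := power_identity (H.base_ne_zero _ hz) hU
    (by rw [add_sub_cancel]; exact H.u_ne_zero _ hz)
    (div_ne_zero (mul_ne_zero (mul_ne_zero hf' hU) hh) (mul_ne_zero hf hT)) θ.m_ne_zero θ.m_ne_one
    hId
  refine ⟨h1, fun hm => sub_eq_zero.1 (h2 hm), fun hA => ?_⟩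
  obtain ⟨h4, h5, h6⟩ := h3 (sub_eq_zero.2 hA)
  refine ⟨h4, ?_⟩
  have h7 := hLu a ha
  rw [h5, h6] at h7
  simp only [hL, hU₁, hU₂] at h7
  linear_combination h7

end IsLocAdmissible

/-! ### Invariants of an equation and the rigidity of generic equations. -/

theorem hasDerivAt_integral {I : Set ℝ} (ho : IsOpen I) (hI : I.OrdConnected) {w : ℝ → ℝ}
    (hw : ContinuousOn w I) {c x : ℝ} (hc : c ∈ I) (hx : x ∈ I) :
    HasDerivAt (fun x => ∫ y in c..x, w y) (w x) x :=
  intervalIntegral.integral_hasDerivAt_right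
    ((hw.mono (hI.uIcc_subset hc hx)).intervalIntegrable)
    (hw.stronglyMeasurableAtFilter ho x hx) (hw.continuousAt (ho.mem_nhds hx))

/-- The density `|f / g| ^ (1 / 2)`. -/
noncomputable def density (θ : ArbElem) (x : ℝ) : ℝ := Real.exp (Real.log (θ.f x / θ.g x) / 2)

/-- The derivative along the density. -/
noncomputable def densityDeriv (θ : ArbElem) (n : ℝ → ℝ) (x : ℝ) : ℝ := deriv n x / density θ x

/-- The logarithmic derivative of the coefficient that controls the admissible transformations
depending on `t`. -/
noncomputable def logInv (θ : ArbElem) (x : ℝ) : ℝ :=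
  (deriv θ.f x / θ.f x + deriv θ.g x / θ.g x) / 2 +
    2 / (1 - θ.m) * (deriv θ.h x / θ.h x - deriv θ.f x / θ.f x)

/-- The iterated derivatives of `logInv` along the density. -/
noncomputable def invariantFn (θ : ArbElem) : ℕ → ℝ → ℝ
  | 0 => fun x => logInv θ x / density θ x
  | j + 1 => densityDeriv θ (invariantFn θ j)

theorem density_pos (θ : ArbElem) (x : ℝ) : 0 < density θ x := Real.exp_pos _

theorem density_sq (θ : ArbElem) {x : ℝ} (hx : x ∈ θ.I) :
    density θ x ^ 2 = |θ.f x / θ.g x| := by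
  have h : θ.f x / θ.g x ≠ 0 := div_ne_zero (θ.f_ne_zero x hx) (θ.g_ne_zero x hx)
  rw [density, ← Real.exp_nat_mul, Nat.cast_ofNat, mul_div_cancel₀ _ two_ne_zero, ← Real.log_abs,
    Real.exp_log (abs_pos.2 h)]

theorem contDiffOn_density (θ : ArbElem) : ContDiffOn ℝ ∞ (density θ) θ.I := by
  have h : ContDiffOn ℝ ∞ (fun x => θ.f x / θ.g x) θ.I := θ.smooth_f.div θ.smooth_g θ.g_ne_zero
  exact ((h.log fun x hx => div_ne_zero (θ.f_ne_zero x hx) (θ.g_ne_zero x hx)).div_const 2).exp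

theorem contDiffOn_deriv {f : ℝ → ℝ} {I : Set ℝ} (hI : IsOpen I) (hf : ContDiffOn ℝ ∞ f I) :
    ContDiffOn ℝ ∞ (deriv f) I :=
  ((contDiffOn_infty_iff_deriv_of_isOpen hI).1 hf).2

theorem contDiffOn_densityDeriv (θ : ArbElem) {n : ℝ → ℝ} (hn : ContDiffOn ℝ ∞ n θ.I) :
    ContDiffOn ℝ ∞ (densityDeriv θ n) θ.I :=
  (contDiffOn_deriv θ.isOpen_I hn).div (contDiffOn_density θ) fun x _ => (density_pos θ x).ne'

theorem contDiffOn_logInv (θ : ArbElem) : ContDiffOn ℝ ∞ (logInv θ) θ.I := by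
  have hf := (contDiffOn_deriv θ.isOpen_I θ.smooth_f).div θ.smooth_f θ.f_ne_zero
  have hg := (contDiffOn_deriv θ.isOpen_I θ.smooth_g).div θ.smooth_g θ.g_ne_zero
  have hh := (contDiffOn_deriv θ.isOpen_I θ.smooth_h).div θ.smooth_h θ.h_ne_zero
  exact ((hf.add hg).div_const 2).add (contDiffOn_const.mul (hh.sub hf))

theorem contDiffOn_invariantFn (θ : ArbElem) (j : ℕ) : ContDiffOn ℝ ∞ (invariantFn θ j) θ.I := by
  induction j with
  | zero =>
    exact (contDiffOn_logInv θ).div (contDiffOn_density θ) fun x _ => (density_pos θ x).ne'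
  | succ j ih => exact contDiffOn_densityDeriv θ ih

theorem hasDerivAt_of_contDiffOn {f : ℝ → ℝ} {I : Set ℝ} (hI : IsOpen I)
    (hf : ContDiffOn ℝ ∞ f I) {x : ℝ} (hx : x ∈ I) : HasDerivAt f (deriv f x) x :=
  ((hf.contDiffAt (hI.mem_nhds hx)).differentiableAt (by simp)).hasDerivAt

theorem hasDerivAt_invariantFn (θ : ArbElem) (j : ℕ) {x : ℝ} (hx : x ∈ θ.I) :
    HasDerivAt (invariantFn θ j) (density θ x * invariantFn θ (j + 1) x) x := by
  have h := hasDerivAt_of_contDiffOn θ.isOpen_I (contDiffOn_invariantFn θ j) hx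
  refine h.congr_deriv ?_
  have := (density_pos θ x).ne'
  simp only [invariantFn, densityDeriv]; field_simp

/-- The nondegeneracy condition under which all admissible transformations preserve the lines
`x = const`. -/
def IsGenericAt (θ : ArbElem) (x : ℝ) : Prop :=
  3 * invariantFn θ 2 x * invariantFn θ 4 x - 4 * invariantFn θ 3 x ^ 2 ≠ 0

/-- The rigidity argument for the equation relating the invariants of two equations. -/
theorem time_deriv_eq_zero {θ θ' : ArbElem} {It Ix : Set ℝ} (hIt : IsOpen It) (hIx : IsOpen Ix)
    (hcx : IsPreconnected Ix) (hIx' : Ix ⊆ θ.I) {X X₁ X₂ : ℝ → ℝ → ℝ} {T₁ : ℝ → ℝ} {e : ℝ}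
    (hX : ∀ t ∈ It, ∀ x ∈ Ix, X t x ∈ θ'.I)
    (hX₁ : ∀ t ∈ It, ∀ x ∈ Ix, HasDerivAt (fun t => X t x) (X₁ t x) t)
    (hX₂ : ∀ t ∈ It, ∀ x ∈ Ix, HasDerivAt (fun x => X t x) (X₂ t x) x)
    (hX₂c : ∀ t ∈ It, ContinuousOn (X₂ t) Ix)
    (hX₂0 : ∀ t ∈ It, ∀ x ∈ Ix, X₂ t x ≠ 0)
    (hsq : ∀ t ∈ It, ∀ x ∈ Ix, (density θ' (X t x) * X₂ t x) ^ 2 = |T₁ t| * density θ x ^ 2)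
    (hrel : ∀ t ∈ It, ∀ x ∈ Ix, invariantFn θ 0 x -
      density θ' (X t x) * X₂ t x / density θ x * invariantFn θ' 0 (X t x) =
      e * (density θ' (X t x) * X₁ t x) / (density θ' (X t x) * X₂ t x / density θ x))
    {x₀ : ℝ} (hx₀ : x₀ ∈ Ix) (hgen : IsGenericAt θ x₀) :
    ∀ t ∈ It, ∀ x ∈ Ix, X₁ t x = 0 := by
  intro t₀ ht₀
  have hd := density_pos θ
  have hd' := density_pos θ'
  set r : ℝ → ℝ := fun t => density θ' (X t x₀) * X₂ t x₀ / density θ x₀ with hr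
  have hr0 : ∀ t ∈ It, r t ≠ 0 := fun t ht =>
    div_ne_zero (mul_ne_zero (hd' _).ne' (hX₂0 t ht x₀ hx₀)) (hd _).ne'
  -- The square of this ratio is |T₁ t|, independent of x. By continuity on the connected set `Ix`
  -- the ratio cannot change sign, so it is independent of x itself.
  have hrx : ∀ t ∈ It, ∀ x ∈ Ix, density θ' (X t x) * X₂ t x / density θ x = r t := by
    intro t ht
    have hXc : ContinuousOn (X t) Ix := fun x hx => (hX₂ t ht x hx).continuousAt.continuousWithinAt
    have hc : ContinuousOn (fun x => density θ' (X t x) * X₂ t x / density θ x) Ix :=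
      (((contDiffOn_density θ').continuousOn.comp hXc (hX t ht)).mul (hX₂c t ht)).div
        ((contDiffOn_density θ).continuousOn.mono hIx') fun x _ => (hd x).ne'
    have hsq' : ∀ x ∈ Ix, (density θ' (X t x) * X₂ t x / density θ x) ^ 2 = |T₁ t| := by
      intro x hx
      rw [div_pow, hsq t ht x hx, mul_div_assoc, div_self (pow_ne_zero 2 (hd x).ne'), mul_one]
    have := hcx.eq_of_sq_eq (g := fun _ => r t) hc continuousOn_const
      (fun x hx => by
        simp only [Pi.pow_apply]; rw [hsq' x hx, hr]; exact (hsq' x₀ hx₀).symm)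
      (fun _ => hr0 t ht) hx₀ rfl
    exact this
  have hX₂r : ∀ t ∈ It, ∀ x ∈ Ix, density θ' (X t x) * X₂ t x = r t * density θ x := by
    intro t ht x hx
    rw [← hrx t ht x hx]; field_simp [(hd x).ne']
  obtain ⟨c', hc'⟩ := θ'.nonempty_I
  -- The primitives of the densities straighten the map: in them X is affine in x with slope `r t`,
  -- as `hZ` shows.
  set Y : ℝ → ℝ := fun x => ∫ y in x₀..x, density θ y with hY
  set Y' : ℝ → ℝ := fun x => ∫ y in c'..x, density θ' y with hY'
  have hYd : ∀ x ∈ Ix, HasDerivAt Y (density θ x) x := fun x hx =>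
    hasDerivAt_integral θ.isOpen_I θ.ordConnected_I (contDiffOn_density θ).continuousOn (hIx' hx₀)
      (hIx' hx)
  have hYd' : ∀ x ∈ θ'.I, HasDerivAt Y' (density θ' x) x := fun x hx =>
    hasDerivAt_integral θ'.isOpen_I θ'.ordConnected_I (contDiffOn_density θ').continuousOn hc' hx
  have hY0 : Y x₀ = 0 := by simp [hY]
  -- composition with functions on the target
  have hcx' : ∀ {p : ℝ → ℝ} {p' : ℝ}, ∀ t ∈ It, ∀ x ∈ Ix,
      HasDerivAt p (density θ' (X t x) * p') (X t x) →
      HasDerivAt (fun x => p (X t x)) (r t * density θ x * p') x := by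
    intro p p' t ht x hx h
    refine (h.comp x (hX₂ t ht x hx)).congr_deriv ?_
    rw [← hX₂r t ht x hx]; ring
  have hct' : ∀ {p : ℝ → ℝ} {p' : ℝ}, ∀ t ∈ It, ∀ x ∈ Ix,
      HasDerivAt p (density θ' (X t x) * p') (X t x) →
      HasDerivAt (fun t => p (X t x)) (density θ' (X t x) * X₁ t x * p') t := by
    intro p p' t ht x hx h
    exact (h.comp t (hX₁ t ht x hx)).congr_deriv (by ring)
  have hZ : ∀ t ∈ It, ∀ x ∈ Ix, Y' (X t x) = r t * Y x + Y' (X t x₀) := by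
    intro t ht x hx
    have := eq_of_hasDerivAt_zero hIx hcx (f := fun x => Y' (X t x) - r t * Y x)
      (fun y hy => ?_) hx hx₀
    · rw [hY0] at this; linarith
    · have h1 := hcx' (p := Y') (p' := 1) t ht y hy (by rw [mul_one]; exact hYd' _ (hX t ht y hy))
      exact (h1.fun_sub ((hYd y hy).const_mul (r t))).congr_deriv (by ring)
  obtain ⟨x₁, hx₁, hne⟩ : ∃ x₁ ∈ Ix, x₁ ≠ x₀ := by
    have h1 : ∀ᶠ v in 𝓝[≠] x₀, v ∈ Ix := nhdsWithin_le_nhds (hIx.mem_nhds hx₀)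
    obtain ⟨v, hv, hv'⟩ := (h1.and self_mem_nhdsWithin).exists
    exact ⟨v, hv, hv'⟩
  have hY1 : Y x₁ ≠ 0 := by
    have hmono : StrictMonoOn Y Ix := by
      refine strictMonoOn_of_deriv_pos (hcx.ordConnected.convex)
        (fun x hx => (hYd x hx).continuousAt.continuousWithinAt) fun x hx => ?_
      rw [(hYd x (interior_subset hx)).deriv]; exact hd x
    intro h
    exact hne (hmono.injOn hx₁ hx₀ (by rw [h, hY0]))
  have hZt : ∀ t ∈ It, ∀ x ∈ Ix, HasDerivAt (fun t => Y' (X t x)) (density θ' (X t x) * X₁ t x) t := by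
    intro t ht x hx
    have := hct' (p := Y') (p' := 1) t ht x hx (by rw [mul_one]; exact hYd' _ (hX t ht x hx))
    rwa [mul_one] at this
  set q : ℝ → ℝ → ℝ := fun t x => density θ' (X t x) * X₁ t x with hq
  set r' : ℝ → ℝ := fun t => (q t x₁ - q t x₀) / Y x₁ with hr'
  -- The slope `r` is a difference quotient of `Y' ∘ X` between `x₀` and `x₁`, so it is
  -- differentiable in t without any assumption on mixed derivatives of X.
  have hrd : ∀ t ∈ It, HasDerivAt r (r' t) t := by
    intro t ht
    refine (((hZt t ht x₁ hx₁).fun_sub (hZt t ht x₀ hx₀)).div_const (Y x₁)).congr_of_eventuallyEq ?_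
    filter_upwards [hIt.mem_nhds ht] with s hs
    rw [hZ s hs x₁ hx₁]; field_simp; ring
  have hqx : ∀ t ∈ It, ∀ x ∈ Ix, q t x = r' t * Y x + q t x₀ := by
    intro t ht x hx
    have h1 := ((hrd t ht).mul_const (Y x)).fun_add (hZt t ht x₀ hx₀)
    refine (hZt t ht x hx).unique (h1.congr_of_eventuallyEq ?_)
    filter_upwards [hIt.mem_nhds ht] with s hs
    exact hZ s hs x hx
  have hn := fun j {x : ℝ} (hx : x ∈ Ix) => hasDerivAt_invariantFn θ j (hIx' hx)
  have hp := fun j {t x : ℝ} (ht : t ∈ It) (hx : x ∈ Ix) =>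
    hcx' t ht x hx (hasDerivAt_invariantFn θ' j (hX t ht x hx))
  have hqd : ∀ t ∈ It, ∀ x ∈ Ix, HasDerivAt (q t) (r' t * density θ x) x := by
    intro t ht x hx
    refine (((hYd x hx).const_mul (r' t)).add_const (q t x₀)).congr_of_eventuallyEq ?_
    filter_upwards [hIx.mem_nhds hx] with y hy
    exact hqx t ht y hy
  have heq : ∀ {f g : ℝ → ℝ} {f' g' x : ℝ}, x ∈ Ix → (∀ y ∈ Ix, f y = g y) → HasDerivAt f f' x →
      HasDerivAt g g' x → f' = g' := by
    intro f g f' g' x hx h hf hg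
    refine hf.unique (hg.congr_of_eventuallyEq ?_)
    filter_upwards [hIx.mem_nhds hx] with y hy using h y hy
  have h0 : ∀ t ∈ It, ∀ x ∈ Ix,
      invariantFn θ 0 x = r t * invariantFn θ' 0 (X t x) + e / r t * q t x := by
    intro t ht x hx
    have := hrel t ht x hx
    rw [hrx t ht x hx] at this
    simp only [hq]
    linear_combination this
  have h1 : ∀ t ∈ It, ∀ x ∈ Ix,
      invariantFn θ 1 x = r t ^ 2 * invariantFn θ' 1 (X t x) + e / r t * r' t := by
    intro t ht x hx
    have := heq hx (h0 t ht) (hn 0 hx)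
      (((hp 0 ht hx).const_mul (r t)).fun_add ((hqd t ht x hx).const_mul (e / r t)))
    exact mul_left_cancel₀ (hd x).ne' (by linear_combination this)
  -- The term with `q` in `h0` is affine in Y, so two derivatives along the density remove it. What
  -- remains is a homogeneous law of weight three.
  have h2 : ∀ t ∈ It, ∀ x ∈ Ix, invariantFn θ 2 x = r t ^ 3 * invariantFn θ' 2 (X t x) := by
    intro t ht x hx
    have := heq hx (h1 t ht) (hn 1 hx)
      (((hp 1 ht hx).const_mul (r t ^ 2)).add_const (e / r t * r' t))
    exact mul_left_cancel₀ (hd x).ne' (by linear_combination this)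
  have h3 : ∀ t ∈ It, ∀ x ∈ Ix, invariantFn θ 3 x = r t ^ 4 * invariantFn θ' 3 (X t x) := by
    intro t ht x hx
    have := heq hx (h2 t ht) (hn 2 hx) ((hp 2 ht hx).const_mul (r t ^ 3))
    exact mul_left_cancel₀ (hd x).ne' (by linear_combination this)
  -- The left side of `h2` is independent of t, so the t-derivative of its right side vanishes.
  -- Together with the x-derivative `k2` of this relation it gives a homogeneous linear system for
  -- (r', q), whose determinant is the expression in `IsGenericAt`.
  have k1 : ∀ t ∈ It, ∀ x ∈ Ix,
      3 * r' t * invariantFn θ 2 x + q t x * invariantFn θ 3 x = 0 := by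
    intro t ht x hx
    have hd1 := ((hrd t ht).fun_pow 3).fun_mul
      (hct' t ht x hx (hasDerivAt_invariantFn θ' 2 (hX t ht x hx)))
    have hd2 : HasDerivAt (fun _ => invariantFn θ 2 x) 0 t := hasDerivAt_const _ _
    have := hd2.unique (hd1.congr_of_eventuallyEq (by
      filter_upwards [hIt.mem_nhds ht] with s hs using h2 s hs x hx))
    rw [h2 t ht x hx, h3 t ht x hx]
    simp only [hq]
    push_cast at this
    linear_combination (-(r t)) * this
  have k2 : ∀ t ∈ It, ∀ x ∈ Ix,
      4 * r' t * invariantFn θ 3 x + q t x * invariantFn θ 4 x = 0 := by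
    intro t ht x hx
    have := heq (g := fun _ => 0) hx (k1 t ht) (((hn 2 hx).const_mul (3 * r' t)).fun_add
      ((hqd t ht x hx).fun_mul (hn 3 hx))) (hasDerivAt_const _ _)
    exact mul_left_cancel₀ (hd x).ne' (by linear_combination this)
  have e1 := k1 t₀ ht₀ x₀ hx₀
  have e2 := k2 t₀ ht₀ x₀ hx₀
  have hr'0 : r' t₀ = 0 := (mul_eq_zero.1 (by
    linear_combination invariantFn θ 4 x₀ * e1 - invariantFn θ 3 x₀ * e2 : r' t₀ *
      (3 * invariantFn θ 2 x₀ * invariantFn θ 4 x₀ - 4 * invariantFn θ 3 x₀ ^ 2) = 0)).resolve_right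
    hgen
  have hq0 : q t₀ x₀ = 0 := (mul_eq_zero.1 (by
    linear_combination 3 * invariantFn θ 2 x₀ * e2 - 4 * invariantFn θ 3 x₀ * e1 : q t₀ x₀ *
      (3 * invariantFn θ 2 x₀ * invariantFn θ 4 x₀ - 4 * invariantFn θ 3 x₀ ^ 2) = 0)).resolve_right
    hgen
  intro x hx
  have := hqx t₀ ht₀ x hx
  rw [hr'0, hq0, zero_mul, add_zero] at this
  exact (mul_eq_zero.1 this).resolve_left (hd' _).ne'

/-! ### The form of the map for generic equations with m ≠ 2. -/

/-- The map has the form `t' = δ₁ t + δ₂`, `x' = φ(x)`, `u' = ψ(x) u` on `S`. -/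
def HasForm (F : ℝ × ℝ × ℝ → ℝ × ℝ × ℝ) (S : Set (ℝ × ℝ × ℝ)) : Prop :=
  ∃ (δ₁ δ₂ : ℝ) (φ ψ : ℝ → ℝ), ∀ t x u : ℝ, (t, x, u) ∈ S → F (t, x, u) = (δ₁ * t + δ₂, φ x, ψ x * u)

theorem log_deriv_eq {P Q : ℝ → ℝ} {P' Q' x : ℝ} (h : ∀ᶠ y in 𝓝 x, Real.log (P y) = Real.log (Q y))
    (hP : HasDerivAt P P' x) (hQ : HasDerivAt Q Q' x) (hP0 : P x ≠ 0) (hQ0 : Q x ≠ 0) :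
    P' / P x = Q' / Q x :=
  (hP.log hP0).unique ((hQ.log hQ0).congr_of_eventuallyEq h)

theorem ArbElem.hasDerivAt_f (θ : ArbElem) {x : ℝ} (hx : x ∈ θ.I) :
    HasDerivAt θ.f (deriv θ.f x) x := hasDerivAt_of_contDiffOn θ.isOpen_I θ.smooth_f hx

theorem ArbElem.hasDerivAt_g (θ : ArbElem) {x : ℝ} (hx : x ∈ θ.I) :
    HasDerivAt θ.g (deriv θ.g x) x := hasDerivAt_of_contDiffOn θ.isOpen_I θ.smooth_g hx

theorem ArbElem.hasDerivAt_h (θ : ArbElem) {x : ℝ} (hx : x ∈ θ.I) :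
    HasDerivAt θ.h (deriv θ.h x) x := hasDerivAt_of_contDiffOn θ.isOpen_I θ.smooth_h hx

namespace IsLocAdmissible
variable {It Ix Iu : Set ℝ}

theorem box_fderiv_compT (H : IsLocAdmissible θ θ' (It ×ˢ Ix ×ˢ Iu) F) (hB : IsBox It Ix Iu)
    {t x x' a : ℝ} (ht : t ∈ It) (hx : x ∈ Ix) (hx' : x' ∈ Ix) (ha : a ∈ Iu) :
    fderiv ℝ (compT F) (t, x, a) (1, 0, 0) = fderiv ℝ (compT F) (t, x', a) (1, 0, 0) := by
  have hz : (t, x, a) ∈ It ×ˢ Ix ×ˢ Iu := ⟨ht, hx, ha⟩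
  have hz' : (t, x', a) ∈ It ×ˢ Ix ×ˢ Iu := ⟨ht, hx', ha⟩
  have h1 := hasDerivAt_partial_t ((H.contDiffAt_compT hz).differentiableAt (by simp))
  have h2 := hasDerivAt_partial_t ((H.contDiffAt_compT hz').differentiableAt (by simp))
  refine h1.unique (h2.congr_of_eventuallyEq ?_)
  filter_upwards [hB.open_t.mem_nhds ht] with s hs
  exact H.box_compT hB hs hx ha hx' ha

/-- The logarithmic form of the determining equations. -/
theorem box_log_relations (H : IsLocAdmissible θ θ' (It ×ˢ Ix ×ˢ Iu) F) (hB : IsBox It Ix Iu)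
    (hA : ∀ t ∈ It, ∀ x ∈ Ix, ∀ u ∈ Iu,
      compU F (t, x, u) = fderiv ℝ (compU F) (t, x, u) (0, 0, 1) * u)
    {t x a : ℝ} (ht : t ∈ It) (hx : x ∈ Ix) (ha : a ∈ Iu)
    {X X₁ X₂ U₃ l n : ℝ} (hX : compX F (t, x, a) = X)
    (hX₁ : fderiv ℝ (compX F) (t, x, a) (1, 0, 0) = X₁)
    (hX₂ : fderiv ℝ (compX F) (t, x, a) (0, 1, 0) = X₂)
    (hU₃ : fderiv ℝ (compU F) (t, x, a) (0, 0, 1) = U₃)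
    (hl : l = fderiv ℝ (fderiv ℝ (compU F)) (t, x, a) (0, 1, 0) (0, 0, 1) / U₃)
    (hn : n = hess (compX F) (t, x, a) (0, 1, 0) / X₂) :
    deriv θ'.f X * X₂ / θ'.f X + deriv θ.g x / θ.g x + 2 * n =
      deriv θ'.g X * X₂ / θ'.g X + deriv θ.f x / θ.f x ∧
    deriv θ'.f X * X₂ / θ'.f X + l + deriv θ.h x / θ.h x - deriv θ.f x / θ.f x =
      deriv θ'.h X * X₂ / θ'.h X + θ.m * l ∧
    deriv θ.g x / θ.g x - θ.f x / θ.g x * (X₁ / X₂) =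
      deriv θ'.g X * X₂ / θ'.g X + 2 * l - n := by
  have hz : (t, x, a) ∈ It ×ˢ Ix ×ˢ Iu := ⟨ht, hx, ha⟩
  have hzx : ∀ y ∈ Ix, (t, y, a) ∈ It ×ˢ Ix ×ˢ Iu := fun y hy => ⟨ht, hy, ha⟩
  set T₁ := fderiv ℝ (compT F) (t, x, a) (1, 0, 0) with hT₁
  have hde := fun y (hy : y ∈ Ix) =>
    H.determining_equations (hzx y hy) (H.box_fderiv_compT hB ht hy hx ha) rfl rfl rfl rfl rfl
  have hpw := fun y (hy : y ∈ Ix) => (H.box_power hB ht hy ha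
    (H.box_fderiv_compT hB ht hy hx ha) rfl rfl rfl rfl rfl).2.2 (hA t ht y hy a ha)
  have hIX : ∀ y ∈ Ix, compX F (t, y, a) ∈ θ'.I := fun y hy => H.mem_I _ (hzx y hy)
  have hIx : ∀ y ∈ Ix, y ∈ θ.I := fun y hy => H.base_mem _ (hzx y hy)
  have dX : HasDerivAt (fun y => compX F (t, y, a)) X₂ x := by
    have := hasDerivAt_partial_x ((H.contDiffAt_compX hz).differentiableAt (by simp))
    rwa [hX₂] at this
  have dX₂ : HasDerivAt (fun y => fderiv ℝ (compX F) (t, y, a) (0, 1, 0))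
      (hess (compX F) (t, x, a) (0, 1, 0)) x := by
    have := hasDerivAt_partial_x (differentiableAt_fderiv_apply (H.contDiffAt_compX hz) (0, 1, 0))
    rwa [← fderiv_fderiv_apply (H.contDiffAt_compX hz)] at this
  have dA : HasDerivAt (fun y => fderiv ℝ (compU F) (t, y, a) (0, 0, 1))
      (fderiv ℝ (fderiv ℝ (compU F)) (t, x, a) (0, 1, 0) (0, 0, 1)) x := by
    have := hasDerivAt_partial_x (differentiableAt_fderiv_apply (H.contDiffAt_compU hz) (0, 0, 1))
    rwa [← fderiv_fderiv_apply (H.contDiffAt_compU hz)] at this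
  have hIX0 : X ∈ θ'.I := hX ▸ hIX x hx
  have df' : HasDerivAt (fun y => θ'.f (compX F (t, y, a))) (deriv θ'.f X * X₂) x :=
    HasDerivAt.comp x (h₂ := θ'.f) (by rw [hX]; exact θ'.hasDerivAt_f hIX0) dX
  have dg' : HasDerivAt (fun y => θ'.g (compX F (t, y, a))) (deriv θ'.g X * X₂) x :=
    HasDerivAt.comp x (h₂ := θ'.g) (by rw [hX]; exact θ'.hasDerivAt_g hIX0) dX
  have dh' : HasDerivAt (fun y => θ'.h (compX F (t, y, a))) (deriv θ'.h X * X₂) x :=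
    HasDerivAt.comp x (h₂ := θ'.h) (by rw [hX]; exact θ'.hasDerivAt_h hIX0) dX
  have df := θ.hasDerivAt_f (hIx x hx)
  have dg := θ.hasDerivAt_g (hIx x hx)
  have dh := θ.hasDerivAt_h (hIx x hx)
  have nf := θ.f_ne_zero x (hIx x hx)
  have ng := θ.g_ne_zero x (hIx x hx)
  have nh := θ.h_ne_zero x (hIx x hx)
  have nf' := θ'.f_ne_zero X hIX0
  have ng' := θ'.g_ne_zero X hIX0
  have nh' := θ'.h_ne_zero X hIX0
  obtain ⟨nT, nX, nU, hK, -, hC, -⟩ := hde x hx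
  rw [hX₂] at nX
  rw [hU₃] at nU
  change T₁ ≠ 0 at nT
  have hlA : l * U₃ = fderiv ℝ (fderiv ℝ (compU F)) (t, x, a) (0, 1, 0) (0, 0, 1) := by
    rw [hl]; field_simp
  have hnX : n * X₂ = hess (compX F) (t, x, a) (0, 1, 0) := by rw [hn]; field_simp
  -- The first relation is the logarithmic x-derivative of f' g X_x² = g' f T_t, the second that of
  -- f' U_u h / (f T_t) = h' |U_u|^m. The third is the coefficient of u_x divided by U_u g' / X_x².
  refine ⟨?_, ?_, ?_⟩
  · have := log_deriv_eq (P := fun y => θ'.f (compX F (t, y, a)) * θ.g y *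
        fderiv ℝ (compX F) (t, y, a) (0, 1, 0) ^ 2)
      (Q := fun y => θ'.g (compX F (t, y, a)) * θ.f y * T₁) (x := x) (by
        filter_upwards [hB.open_x.mem_nhds hx] with y hy
        rw [(hde y hy).2.2.2.1])
      ((df'.fun_mul dg).fun_mul (dX₂.fun_pow 2)) ((dg'.fun_mul df).mul_const T₁)
      (by simp only [hX, hX₂]; exact mul_ne_zero (mul_ne_zero nf' ng) (pow_ne_zero 2 nX))
      (by simp only [hX]; exact mul_ne_zero (mul_ne_zero ng' nf) nT)
    simp only [hX, hX₂, ← hnX] at this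
    have e1 : deriv θ'.f X * X₂ / θ'.f X + deriv θ.g x / θ.g x + 2 * n =
      ((deriv θ'.f X * X₂ * θ.g x + θ'.f X * deriv θ.g x) * X₂ ^ 2 +
        θ'.f X * θ.g x * (((2 : ℕ) : ℝ) * X₂ ^ (2 - 1) * (n * X₂))) /
          (θ'.f X * θ.g x * X₂ ^ 2) := by
      push_cast; field_simp
    have e2 : deriv θ'.g X * X₂ / θ'.g X + deriv θ.f x / θ.f x =
      ((deriv θ'.g X * X₂ * θ.f x + θ'.g X * deriv θ.f x) * T₁) / (θ'.g X * θ.f x * T₁) := by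
      field_simp
    rw [e1, e2]; exact this
  · have hlog : ∀ᶠ y in 𝓝 x, Real.log (θ'.f (compX F (t, y, a))) +
        Real.log (fderiv ℝ (compU F) (t, y, a) (0, 0, 1)) + Real.log (θ.h y) - Real.log (θ.f y) =
        Real.log (θ'.h (compX F (t, y, a))) +
          θ.m * Real.log (fderiv ℝ (compU F) (t, y, a) (0, 0, 1)) + Real.log T₁ := by
      filter_upwards [hB.open_x.mem_nhds hx] with y hy
      have h1 := congrArg Real.log (hpw y hy).1
      have nU' := (hde y hy).2.2.1
      have nf1 := θ.f_ne_zero y (hIx y hy)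
      have nh1 := θ.h_ne_zero y (hIx y hy)
      have nf2 := θ'.f_ne_zero _ (hIX y hy)
      have nh2 := θ'.h_ne_zero _ (hIX y hy)
      rw [Real.log_div (mul_ne_zero (mul_ne_zero nf2 nU') nh1) (mul_ne_zero nf1 nT),
        Real.log_mul (mul_ne_zero nf2 nU') nh1, Real.log_mul nf2 nU', Real.log_mul nf1 nT,
        Real.log_mul nh2 (Real.rpow_pos_of_pos (abs_pos.2 nU') _).ne',
        Real.log_rpow (abs_pos.2 nU'), Real.log_abs] at h1
      linarith
    have d1 := (((df'.log (by simpa only [hX] using nf')).fun_add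
      (dA.log (by simpa only [hU₃] using nU))).fun_add (dh.log nh)).fun_sub (df.log nf)
    have d2 := ((dh'.log (by simpa only [hX] using nh')).fun_add
      ((dA.log (by simpa only [hU₃] using nU)).const_mul θ.m)).add_const (Real.log T₁)
    have := d1.unique (d2.congr_of_eventuallyEq hlog)
    simp only [hX, hU₃, ← hl] at this
    exact this
  · rw [hX, hX₂] at hK
    rw [hX, hX₁, hX₂, hU₃, ← hlA, ← hnX] at hC
    have e3 : θ'.f X / T₁ = θ'.g X * θ.f x / (θ.g x * X₂ ^ 2) := by
      rw [div_eq_div_iff nT (mul_ne_zero ng (pow_ne_zero 2 nX))]; linear_combination hK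
    have e4 : θ'.f X * (U₃ * deriv θ.g x / θ.f x - U₃ * X₁ / X₂) / T₁ =
        U₃ * θ'.g X / X₂ ^ 2 * (deriv θ.g x / θ.g x - θ.f x / θ.g x * (X₁ / X₂)) := by
      rw [mul_comm, mul_div_assoc, e3]; field_simp
    have e5 : deriv θ'.g X * U₃ / X₂ + θ'.g X * (2 * (l * U₃) - U₃ * (n * X₂) / X₂) / X₂ ^ 2 =
        U₃ * θ'.g X / X₂ ^ 2 * (deriv θ'.g X * X₂ / θ'.g X + 2 * l - n) := by
      field_simp; ring
    rw [e4, e5] at hC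
    exact mul_left_cancel₀ (div_ne_zero (mul_ne_zero nU ng') (pow_ne_zero 2 nX)) hC

theorem box_hasForm (H : IsLocAdmissible θ θ' (It ×ˢ Ix ×ˢ Iu) F) (hB : IsBox It Ix Iu)
    (hm : θ.m ≠ 2) {x₀ : ℝ} (hx₀ : x₀ ∈ Ix) (hgen : IsGenericAt θ x₀) :
    HasForm F (It ×ˢ Ix ×ˢ Iu) := by
  rcases It.eq_empty_or_nonempty with hIt | ⟨t₀, ht₀⟩
  · exact ⟨0, 0, 0, 0, by simp [hIt]⟩
  rcases Iu.eq_empty_or_nonempty with hIu | ⟨a, ha⟩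
  · exact ⟨0, 0, 0, 0, by simp [hIu]⟩
  have hz : ∀ t ∈ It, ∀ x ∈ Ix, (t, x, a) ∈ It ×ˢ Ix ×ˢ Iu := fun t ht x hx => ⟨ht, hx, ha⟩
  have hA : ∀ t ∈ It, ∀ x ∈ Ix, ∀ u ∈ Iu,
      compU F (t, x, u) = fderiv ℝ (compU F) (t, x, u) (0, 0, 1) * u := fun t ht x hx u hu =>
    (H.box_power hB ht hx hu rfl rfl rfl rfl rfl rfl).2.1 hm
  have hmm : θ'.m = θ.m := (H.box_power hB ht₀ hx₀ ha rfl rfl rfl rfl rfl rfl).1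
  have hde := fun t (ht : t ∈ It) x (hx : x ∈ Ix) => H.determining_equations (hz t ht x hx)
    (H.box_fderiv_compT hB ht hx hx₀ ha) rfl rfl rfl rfl rfl
  set T₁ : ℝ → ℝ := fun t => fderiv ℝ (compT F) (t, x₀, a) (1, 0, 0) with hT₁
  have hIX : ∀ t ∈ It, ∀ x ∈ Ix, compX F (t, x, a) ∈ θ'.I := fun t ht x hx =>
    H.mem_I _ (hz t ht x hx)
  have hIx : Ix ⊆ θ.I := fun x hx => H.base_mem _ (hz t₀ ht₀ x hx)
  have hX₁ : ∀ t ∈ It, ∀ x ∈ Ix, HasDerivAt (fun t => compX F (t, x, a))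
      (fderiv ℝ (compX F) (t, x, a) (1, 0, 0)) t := fun t ht x hx =>
    hasDerivAt_partial_t ((H.contDiffAt_compX (hz t ht x hx)).differentiableAt (by simp))
  have hX₂ : ∀ t ∈ It, ∀ x ∈ Ix, HasDerivAt (fun x => compX F (t, x, a))
      (fderiv ℝ (compX F) (t, x, a) (0, 1, 0)) x := fun t ht x hx =>
    hasDerivAt_partial_x ((H.contDiffAt_compX (hz t ht x hx)).differentiableAt (by simp))
  -- the sign of `f / g`
  have hsgn : ∃ e : ℝ, ∀ x ∈ Ix, θ.f x / θ.g x = e * density θ x ^ 2 := by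
    refine ⟨(θ.f x₀ / θ.g x₀) / density θ x₀ ^ 2, fun x hx => ?_⟩
    have hc : ContinuousOn (fun x => θ.f x / θ.g x / density θ x ^ 2) Ix :=
      (((θ.smooth_f.continuousOn.div θ.smooth_g.continuousOn θ.g_ne_zero).div
        ((contDiffOn_density θ).continuousOn.pow 2) fun x _ =>
          pow_ne_zero 2 (density_pos θ x).ne').mono hIx)
    have hs : ∀ x ∈ Ix, (θ.f x / θ.g x / density θ x ^ 2) ^ 2 = 1 := by
      intro x hx
      rw [div_pow, density_sq θ (hIx hx), sq_abs, div_self]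
      exact pow_ne_zero 2 (div_ne_zero (θ.f_ne_zero x (hIx hx)) (θ.g_ne_zero x (hIx hx)))
    have := hB.conn_x.eq_of_sq_eq
      (g := fun _ => θ.f x₀ / θ.g x₀ / density θ x₀ ^ 2) hc continuousOn_const
      (fun x hx => (hs x hx).trans (hs x₀ hx₀).symm)
      (fun _ h => by simpa [h] using hs x₀ hx₀) hx₀ rfl
    have h2 := this hx
    simp only at h2
    have hd := (density_pos θ x).ne'
    rw [← h2]; field_simp
  obtain ⟨e, he⟩ := hsgn
  have hX0 := time_deriv_eq_zero (θ := θ) (θ' := θ') (X := fun t x => compX F (t, x, a))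
    (X₁ := fun t x => fderiv ℝ (compX F) (t, x, a) (1, 0, 0))
    (X₂ := fun t x => fderiv ℝ (compX F) (t, x, a) (0, 1, 0)) (T₁ := T₁) (e := e)
    hB.open_t hB.open_x hB.conn_x hIx hIX hX₁ hX₂
    (fun t ht x hx => (hasDerivAt_partial_x (differentiableAt_fderiv_apply
      (H.contDiffAt_compX (hz t ht x hx)) (0, 1, 0))).continuousAt.continuousWithinAt)
    (fun t ht x hx => (hde t ht x hx).2.1)
    (fun t ht x hx => by
      have hK := (hde t ht x hx).2.2.2.1
      have nf' := θ'.f_ne_zero _ (hIX t ht x hx)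
      have ng' := θ'.g_ne_zero _ (hIX t ht x hx)
      have ng := θ.g_ne_zero x (hIx hx)
      rw [mul_pow, density_sq θ' (hIX t ht x hx), density_sq θ (hIx hx), ← abs_mul, ← sq_abs,
        ← abs_pow, ← abs_mul]
      congr 1
      field_simp
      linear_combination hK)
    (fun t ht x hx => by
      obtain ⟨k1, k2, k3⟩ := H.box_log_relations hB hA ht hx ha rfl rfl rfl rfl rfl rfl
      have nX := (hde t ht x hx).2.1
      rw [he x hx] at k3
      have hm1 : 1 - θ.m ≠ 0 := sub_ne_zero.2 θ.m_ne_one.symm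
      have hd := (density_pos θ x).ne'
      have hd' := (density_pos θ' (compX F (t, x, a))).ne'
      -- The combination `logInv` is chosen so that eliminating the logarithmic x-derivatives of U_u
      -- and X_x from the three relations leaves only X and its first derivatives.
      have key : logInv θ x - fderiv ℝ (compX F) (t, x, a) (0, 1, 0) *
          logInv θ' (compX F (t, x, a)) = e * density θ x ^ 2 *
          (fderiv ℝ (compX F) (t, x, a) (1, 0, 0) / fderiv ℝ (compX F) (t, x, a) (0, 1, 0)) := by
        simp only [logInv, hmm]
        set l := fderiv ℝ (fderiv ℝ (compU F)) (t, x, a) (0, 1, 0) (0, 0, 1) /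
          fderiv ℝ (compU F) (t, x, a) (0, 0, 1)
        have k2' : deriv θ.h x / θ.h x - deriv θ.f x / θ.f x -
            fderiv ℝ (compX F) (t, x, a) (0, 1, 0) *
            (deriv θ'.h (compX F (t, x, a)) / θ'.h (compX F (t, x, a)) -
              deriv θ'.f (compX F (t, x, a)) / θ'.f (compX F (t, x, a))) = -((1 - θ.m) * l) := by
          linear_combination k2
        have k2'' : 2 / (1 - θ.m) * (deriv θ.h x / θ.h x - deriv θ.f x / θ.f x) -
            fderiv ℝ (compX F) (t, x, a) (0, 1, 0) * (2 / (1 - θ.m) *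
            (deriv θ'.h (compX F (t, x, a)) / θ'.h (compX F (t, x, a)) -
              deriv θ'.f (compX F (t, x, a)) / θ'.f (compX F (t, x, a)))) = -(2 * l) := by
          have : 2 / (1 - θ.m) * (-((1 - θ.m) * l)) = -(2 * l) := by field_simp
          rw [← this, ← k2']; ring
        linear_combination k2'' + k3 - (1 / 2) * k1
      simp only [invariantFn]
      have e1 : logInv θ x = fderiv ℝ (compX F) (t, x, a) (0, 1, 0) *
          logInv θ' (compX F (t, x, a)) + e * density θ x ^ 2 *
          (fderiv ℝ (compX F) (t, x, a) (1, 0, 0) / fderiv ℝ (compX F) (t, x, a) (0, 1, 0)) := by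
        linear_combination key
      rw [e1]; field_simp; ring) hx₀ hgen
  have hXt : ∀ t ∈ It, ∀ x ∈ Ix, compX F (t, x, a) = compX F (t₀, x, a) := by
    intro t ht x hx
    refine eq_of_hasDerivAt_zero hB.open_t hB.conn_t (f := fun t => compX F (t, x, a))
      (fun s hs => ?_) ht ht₀
    have := hX₁ s hs x hx
    rwa [hX0 s hs x hx] at this
  have hX₂t : ∀ t ∈ It, ∀ x ∈ Ix, fderiv ℝ (compX F) (t, x, a) (0, 1, 0) =
      fderiv ℝ (compX F) (t₀, x, a) (0, 1, 0) := by
    intro t ht x hx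
    refine (hX₂ t ht x hx).unique ((hX₂ t₀ ht₀ x hx).congr_of_eventuallyEq ?_)
    filter_upwards [hB.open_x.mem_nhds hx] with y hy using hXt t ht y hy
  -- As X and X_x do not depend on t, the relation f' g X_x² = g' f T_t makes T_t constant.
  have hTt : ∀ t ∈ It, T₁ t = T₁ t₀ := by
    intro t ht
    have h1 := (hde t ht x₀ hx₀).2.2.2.1
    have h2 := (hde t₀ ht₀ x₀ hx₀).2.2.2.1
    rw [hXt t ht x₀ hx₀, hX₂t t ht x₀ hx₀, h2] at h1
    exact (mul_left_cancel₀ (mul_ne_zero (θ'.g_ne_zero _ (hIX t₀ ht₀ x₀ hx₀))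
      (θ.f_ne_zero _ (hIx hx₀))) h1).symm
  have hAt : ∀ t ∈ It, ∀ x ∈ Ix, fderiv ℝ (compU F) (t, x, a) (0, 0, 1) =
      fderiv ℝ (compU F) (t₀, x, a) (0, 0, 1) := by
    intro t ht x hx
    have h1 := ((H.box_power hB ht hx ha (H.box_fderiv_compT hB ht hx hx₀ ha)
      rfl rfl rfl rfl rfl).2.2 (hA t ht x hx a ha)).1
    have h2 := ((H.box_power hB ht₀ hx ha (H.box_fderiv_compT hB ht₀ hx hx₀ ha)
      rfl rfl rfl rfl rfl).2.2 (hA t₀ ht₀ x hx a ha)).1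
    rw [hXt t ht x hx, show fderiv ℝ (compT F) (t, x₀, a) (1, 0, 0) =
      fderiv ℝ (compT F) (t₀, x₀, a) (1, 0, 0) from hTt t ht] at h1
    have n1 := (hde t ht x hx).2.2.1
    have n2 := (hde t₀ ht₀ x hx).2.2.1
    have nT := (hde t₀ ht₀ x hx).1
    have nf := θ.f_ne_zero x (hIx hx)
    have nh := θ.h_ne_zero x (hIx hx)
    have nf' := θ'.f_ne_zero _ (hIX t₀ ht₀ x hx)
    have nh' := θ'.h_ne_zero _ (hIX t₀ ht₀ x hx)
    set A := fderiv ℝ (compU F) (t, x, a) (0, 0, 1)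
    set A₀ := fderiv ℝ (compU F) (t₀, x, a) (0, 0, 1)
    have p1 := Real.rpow_pos_of_pos (abs_pos.2 n1) θ.m
    have p2 := Real.rpow_pos_of_pos (abs_pos.2 n2) θ.m
    have hcross : A * |A₀| ^ θ.m = A₀ * |A| ^ θ.m := by
      have hc : θ'.f (compX F (t₀, x, a)) * θ.h x / (θ.f x * T₁ t₀) *
          θ'.h (compX F (t₀, x, a)) ≠ 0 :=
        mul_ne_zero (div_ne_zero (mul_ne_zero nf' nh) (mul_ne_zero nf nT)) nh'
      refine mul_left_cancel₀ hc ?_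
      linear_combination (θ'.h (compX F (t₀, x, a)) * |A₀| ^ θ.m) * h1 -
        (θ'.h (compX F (t₀, x, a)) * |A| ^ θ.m) * h2
    -- Taking logarithms in `hcross` gives (1 - m) log|A| = (1 - m) log|A₀|, and m ≠ 1. With equal
    -- moduli, `hcross` itself then fixes the sign.
    have habs : |A| = |A₀| := by
      have h3 := congrArg (fun s => Real.log |s|) hcross
      simp only [abs_mul, abs_of_pos p1, abs_of_pos p2] at h3
      rw [Real.log_mul (abs_pos.2 n1).ne' p2.ne', Real.log_mul (abs_pos.2 n2).ne' p1.ne',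
        Real.log_rpow (abs_pos.2 n1), Real.log_rpow (abs_pos.2 n2)] at h3
      have h4 : Real.log |A| = Real.log |A₀| :=
        mul_left_cancel₀ (sub_ne_zero.2 θ.m_ne_one.symm) (by linear_combination h3)
      exact Real.log_injOn_pos (abs_pos.2 n1) (abs_pos.2 n2) h4
    rw [habs] at hcross
    exact mul_right_cancel₀ p2.ne' hcross
  refine ⟨T₁ t₀, compT F (t₀, x₀, a) - T₁ t₀ * t₀, fun x => compX F (t₀, x, a),
    fun x => fderiv ℝ (compU F) (t₀, x, a) (0, 0, 1), ?_⟩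
  rintro t x u ⟨ht, hx, hu⟩
  refine Prod.ext ?_ (Prod.ext ?_ ?_)
  · have h1 : compT F (t, x, u) = compT F (t, x₀, a) := H.box_compT hB ht hx hu hx₀ ha
    have h2 := eq_of_hasDerivAt_zero hB.open_t hB.conn_t
      (f := fun t => compT F (t, x₀, a) - T₁ t₀ * t) (fun s hs => ?_) ht ht₀
    · change compT F (t, x, u) = T₁ t₀ * t + (compT F (t₀, x₀, a) - T₁ t₀ * t₀)
      rw [h1]; linarith
    · have h3 := hasDerivAt_partial_t ((H.contDiffAt_compT (hz s hs x₀ hx₀)).differentiableAt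
        (by simp))
      have h4 : HasDerivAt (fun t : ℝ => T₁ t₀ * t) (T₁ t₀) s := by
        simpa using (hasDerivAt_id s).const_mul (T₁ t₀)
      refine (h3.fun_sub h4).congr_deriv ?_
      rw [← hTt s hs]; exact sub_self _
  · exact (H.box_compX hB ht hx hu ha).trans (hXt t ht x hx)
  · change compU F (t, x, u) = _
    rw [hA t ht x hx u hu, H.box_fderiv_compU hB ht hx hu ha, hAt t ht x hx]

end IsLocAdmissible

/-! ### Passage from local to global, and passage to limits. -/

theorem IsTransDomain.isOpen_xProj {θ : ArbElem} {Ω : Set (ℝ × ℝ × ℝ)} (h : IsTransDomain θ Ω) :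
    IsOpen (xProj Ω) :=
  (isOpenMap_fst.comp isOpenMap_snd) Ω h.isOpen

theorem IsTransDomain.isPreconnected_xProj {θ : ArbElem} {Ω : Set (ℝ × ℝ × ℝ)}
    (h : IsTransDomain θ Ω) : IsPreconnected (xProj Ω) :=
  h.isConnected.isPreconnected.image _ (by fun_prop)

theorem IsTransDomain.xProj_subset {θ : ArbElem} {Ω : Set (ℝ × ℝ × ℝ)}
    (h : IsTransDomain θ Ω) : xProj Ω ⊆ θ.I := by
  rintro _ ⟨z, hz, rfl⟩; exact h.mem_I z hz

theorem mem_xProj {Ω : Set (ℝ × ℝ × ℝ)} {t x u : ℝ} (h : (t, x, u) ∈ Ω) : x ∈ xProj Ω :=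
  ⟨_, h, rfl⟩

theorem IsAdmissible.isLocAdmissible {θ θ' : ArbElem} {Ω : Set (ℝ × ℝ × ℝ)}
    {F : ℝ × ℝ × ℝ → ℝ × ℝ × ℝ} (h : IsAdmissible θ θ' Ω F) (hΩ : IsTransDomain θ Ω) :
    IsLocAdmissible θ θ' Ω F :=
  { h with isOpen := hΩ.isOpen, base_mem := hΩ.mem_I, base_ne_zero := hΩ.u_ne_zero }

/-- A map that locally preserves the lines `x = const` and is linear in `u` has the same form
globally on domains with connected slices. -/
theorem hasForm_of_local {Ω : Set (ℝ × ℝ × ℝ)} {F : ℝ × ℝ × ℝ → ℝ × ℝ × ℝ}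
    (hc : IsPreconnected Ω) (hs : ∀ x : ℝ, IsPreconnected {p : ℝ × ℝ | (p.1, x, p.2) ∈ Ω})
    (hu : ∀ z ∈ Ω, z.2.2 ≠ 0) (h : ∀ z ∈ Ω, ∃ N ∈ 𝓝 z, HasForm F N) : HasForm F Ω := by
  rcases Ω.eq_empty_or_nonempty with rfl | ⟨z₀, hz₀⟩
  · exact ⟨0, 0, 0, 0, by simp⟩
  have h' : ∀ z ∈ Ω, ∃ (δ₁ δ₂ : ℝ) (φ ψ : ℝ → ℝ), ∀ᶠ y in 𝓝 z,
      F y = (δ₁ * y.1 + δ₂, φ y.2.1, ψ y.2.1 * y.2.2) := by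
    intro z hz
    obtain ⟨N, hN, δ₁, δ₂, φ, ψ, hF⟩ := h z hz
    exact ⟨δ₁, δ₂, φ, ψ, Filter.mem_of_superset hN fun y hy => hF y.1 y.2.1 y.2.2 hy⟩
  set D : ℝ × ℝ × ℝ → ℝ := fun z => fderiv ℝ (compT F) z (1, 0, 0) with hD
  -- The slope and the intercept of T in t are locally constant, hence constant on the connected set
  -- `Ω`.
  have hT : ∀ z ∈ Ω, D z = D z₀ ∧ compT F z - D z * z.1 = compT F z₀ - D z₀ * z₀.1 := by
    intro z hz
    refine hc.induction₂ (fun a b => D a = D b ∧ compT F a - D a * a.1 = compT F b - D b * b.1)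
      ?_ ?_ ?_ hz hz₀
    · intro a ha
      refine Filter.Eventually.filter_mono nhdsWithin_le_nhds ?_
      obtain ⟨δ₁, δ₂, φ, ψ, hF⟩ := h' a ha
      have key : ∀ᶠ y in 𝓝 a, compT F y = δ₁ * y.1 + δ₂ ∧ D y = δ₁ := by
        filter_upwards [hF.eventually_nhds] with y hy
        refine ⟨congrArg Prod.fst hy.self_of_nhds, ?_⟩
        have h1 : HasFDerivAt (fun y : ℝ × ℝ × ℝ => δ₁ * y.1 + δ₂)
            (δ₁ • ContinuousLinearMap.fst ℝ ℝ (ℝ × ℝ)) y :=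
          (hasFDerivAt_fst.const_mul δ₁).add_const δ₂
        have h2 := h1.congr_of_eventuallyEq (f₁ := compT F)
          (hy.mono fun w hw => congrArg Prod.fst hw)
        simp only [hD, h2.fderiv]
        simp
      filter_upwards [key] with y hy
      obtain ⟨k1, k2⟩ := key.self_of_nhds
      rw [k1, k2, hy.1, hy.2]
      exact ⟨rfl, by ring⟩
    · intro a b c _ _ _ h1 h2; exact ⟨h1.1.trans h2.1, h1.2.trans h2.2⟩
    · intro a b _ _ h1; exact ⟨h1.1.symm, h1.2.symm⟩
  -- On a slice x = const the quantities X and U/u are locally constant. Connected slices make φ(x)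
  -- and ψ(x) single-valued; connectedness of `Ω` alone would not.
  have hX : ∀ x t u t' u', (t, x, u) ∈ Ω → (t', x, u') ∈ Ω →
      compX F (t, x, u) = compX F (t', x, u') ∧
      compU F (t, x, u) / u = compU F (t', x, u') / u' := by
    intro x t u t' u' hz hz'
    refine (hs x).induction₂ (x := (t, u)) (y := (t', u'))
      (fun a b => compX F (a.1, x, a.2) = compX F (b.1, x, b.2) ∧
      compU F (a.1, x, a.2) / a.2 = compU F (b.1, x, b.2) / b.2) ?_ ?_ ?_ hz hz'
    · intro a ha
      obtain ⟨δ₁, δ₂, φ, ψ, hF⟩ := h' _ ha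
      have hcont : ContinuousAt (fun b : ℝ × ℝ => ((b.1, x, b.2) : ℝ × ℝ × ℝ)) a := by fun_prop
      filter_upwards [nhdsWithin_le_nhds (hcont.eventually hF), self_mem_nhdsWithin] with b hb hb'
      have e1 := hF.self_of_nhds
      refine ⟨?_, ?_⟩
      · rw [compX, compX, e1, hb]
      · have n1 := hu _ ha
        have n2 := hu _ hb'
        simp only at n1 n2
        rw [compU, compU, e1, hb]; field_simp
    · intro a b c _ _ _ h1 h2; exact ⟨h1.1.trans h2.1, h1.2.trans h2.2⟩
    · intro a b _ _ h1; exact ⟨h1.1.symm, h1.2.symm⟩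
  have hp : ∀ x : ℝ, ∃ p : ℝ × ℝ, ∀ t u, (t, x, u) ∈ Ω → (p.1, x, p.2) ∈ Ω := by
    intro x
    by_cases hx : ∃ p : ℝ × ℝ, (p.1, x, p.2) ∈ Ω
    · exact ⟨hx.choose, fun _ _ _ => hx.choose_spec⟩
    · exact ⟨0, fun t u htu => (hx ⟨(t, u), htu⟩).elim⟩
  choose p hp using hp
  refine ⟨D z₀, compT F z₀ - D z₀ * z₀.1, fun x => compX F ((p x).1, x, (p x).2),
    fun x => compU F ((p x).1, x, (p x).2) / (p x).2, fun t x u hz => ?_⟩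
  obtain ⟨k1, k2⟩ := hT _ hz
  obtain ⟨k3, k4⟩ := hX x t u _ _ hz (hp x t u hz)
  refine Prod.ext ?_ (Prod.ext k3 ?_)
  · change compT F (t, x, u) = _
    rw [k1] at k2
    simp only at k2 ⊢
    linarith
  · change compU F (t, x, u) = _
    have n1 := hu _ hz
    simp only at n1 ⊢
    rw [← k4]; field_simp

/-- The form amounts to identities between values of the map at a point and at fixed base points,
and these survive pointwise limits. `HasForm` requires no regularity or nonvanishing of δ₁, φ and ψ,
so none has to be controlled in the limit; admissibility of the limit map restores them later. -/
theorem HasForm.of_tendsto {ι : Type*} {l : Filter ι} [l.NeBot] {It Ix Iu : Set ℝ}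
    (hIt : IsOpen It) (hu : ∀ u ∈ Iu, u ≠ 0) {F : ℝ × ℝ × ℝ → ℝ × ℝ × ℝ}
    {G : ι → ℝ × ℝ × ℝ → ℝ × ℝ × ℝ} (hG : ∀ᶠ i in l, HasForm (G i) (It ×ˢ Ix ×ˢ Iu))
    (hlim : ∀ z ∈ It ×ˢ Ix ×ˢ Iu, Filter.Tendsto (fun i => G i z) l (𝓝 (F z))) :
    HasForm F (It ×ˢ Ix ×ˢ Iu) := by
  rcases It.eq_empty_or_nonempty with rfl | ⟨t₁, ht₁⟩
  · exact ⟨0, 0, 0, 0, by simp⟩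
  rcases Ix.eq_empty_or_nonempty with rfl | ⟨x₁, hx₁⟩
  · exact ⟨0, 0, 0, 0, by simp⟩
  rcases Iu.eq_empty_or_nonempty with rfl | ⟨u₁, hu₁⟩
  · exact ⟨0, 0, 0, 0, by simp⟩
  obtain ⟨t₂, ht₂, hne⟩ : ∃ t₂ ∈ It, t₂ ≠ t₁ := by
    have h1 : ∀ᶠ v in 𝓝[≠] t₁, v ∈ It := nhdsWithin_le_nhds (hIt.mem_nhds ht₁)
    obtain ⟨v, hv, hv'⟩ := (h1.and self_mem_nhdsWithin).exists
    exact ⟨v, hv, hv'⟩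
  have lT : ∀ {t x u}, t ∈ It → x ∈ Ix → u ∈ Iu →
      Filter.Tendsto (fun i => (G i (t, x, u)).1) l (𝓝 (F (t, x, u)).1) := fun ht hx hu =>
    (hlim _ ⟨ht, hx, hu⟩).fst_nhds
  have lX : ∀ {t x u}, t ∈ It → x ∈ Ix → u ∈ Iu →
      Filter.Tendsto (fun i => (G i (t, x, u)).2.1) l (𝓝 (F (t, x, u)).2.1) := fun ht hx hu =>
    (hlim _ ⟨ht, hx, hu⟩).snd_nhds.fst_nhds
  have lU : ∀ {t x u}, t ∈ It → x ∈ Ix → u ∈ Iu →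
      Filter.Tendsto (fun i => (G i (t, x, u)).2.2) l (𝓝 (F (t, x, u)).2.2) := fun ht hx hu =>
    (hlim _ ⟨ht, hx, hu⟩).snd_nhds.snd_nhds
  refine ⟨((F (t₂, x₁, u₁)).1 - (F (t₁, x₁, u₁)).1) / (t₂ - t₁),
    (F (t₁, x₁, u₁)).1 - ((F (t₂, x₁, u₁)).1 - (F (t₁, x₁, u₁)).1) / (t₂ - t₁) * t₁,
    fun x => (F (t₁, x, u₁)).2.1, fun x => (F (t₁, x, u₁)).2.2 / u₁, ?_⟩
  rintro t x u ⟨ht, hx, hu'⟩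
  replace ht : t ∈ It := ht
  replace hx : x ∈ Ix := hx
  replace hu' : u ∈ Iu := hu'
  have hsub : t₂ - t₁ ≠ 0 := sub_ne_zero.2 hne
  refine Prod.ext ?_ (Prod.ext ?_ ?_)
  · have h1 := tendsto_nhds_unique_of_eventuallyEq
      (((lT ht hx hu').sub (lT ht₁ hx₁ hu₁)).mul_const (t₂ - t₁))
      (((lT ht₂ hx₁ hu₁).sub (lT ht₁ hx₁ hu₁)).mul_const (t - t₁)) (hG.mono fun i hi => by
        obtain ⟨δ₁, δ₂, φ, ψ, hf⟩ := hi
        simp only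
        rw [hf t x u ⟨ht, hx, hu'⟩, hf t₁ x₁ u₁ ⟨ht₁, hx₁, hu₁⟩, hf t₂ x₁ u₁ ⟨ht₂, hx₁, hu₁⟩]
        ring)
    simp only
    field_simp
    linear_combination h1
  · refine tendsto_nhds_unique_of_eventuallyEq (lX ht hx hu') (lX ht₁ hx hu₁)
      (hG.mono fun i hi => ?_)
    obtain ⟨δ₁, δ₂, φ, ψ, hf⟩ := hi
    simp only [hf t x u ⟨ht, hx, hu'⟩, hf t₁ x u₁ ⟨ht₁, hx, hu₁⟩]
  · have n1 := hu _ hu₁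
    refine tendsto_nhds_unique_of_eventuallyEq (lU ht hx hu')
      (((lU ht₁ hx hu₁).div_const u₁).mul_const u) (hG.mono fun i hi => ?_)
    obtain ⟨δ₁, δ₂, φ, ψ, hf⟩ := hi
    simp only [hf t x u ⟨ht, hx, hu'⟩, hf t₁ x u₁ ⟨ht₁, hx, hu₁⟩]
    field_simp

/-- The local form of transformations is inherited by limits along curves of arbitrary elements. -/
theorem exists_hasForm_of_curve {Φ : TransFamily} (hΦ : Φ.DependsContinuously) {I : Set ℝ}
    {θ : ℝ → ArbElem} (hθ : IsSmoothCurve I θ) {t x u : ℝ} (hz : (t, x, u) ∈ Φ.dom (θ 0))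
    (h : ∀ᶠ s in 𝓝[≠] (0 : ℝ), ∀ It Ix Iu, IsBox It Ix Iu → x ∈ Ix →
      It ×ˢ Ix ×ˢ Iu ⊆ Φ.dom (θ s) → HasForm (Φ.toFun (θ s)) (It ×ˢ Ix ×ˢ Iu)) :
    ∃ N ∈ 𝓝 (t, x, u), HasForm (Φ.toFun (θ 0)) N := by
  obtain ⟨ho, hc⟩ := hΦ I θ hθ
  -- Joint openness in (s, t, x, u) yields one box contained in the domains for all small s, on
  -- which the limit can be taken.
  obtain ⟨ε, hε, hball⟩ := Metric.isOpen_iff.1 ho (0, t, x, u) hz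
  have hsub : ∀ s ∈ Metric.ball (0 : ℝ) ε, Metric.ball t ε ×ˢ Metric.ball x ε ×ˢ Metric.ball u ε ⊆
      Φ.dom (θ s) := by
    rintro s hs ⟨t', x', u'⟩ ⟨h1, h2, h3⟩
    refine hball (a := (s, t', x', u')) ?_
    rw [← ball_prod_same, ← ball_prod_same, ← ball_prod_same]
    exact ⟨hs, h1, h2, h3⟩
  have hbox : IsBox (Metric.ball t ε) (Metric.ball x ε) (Metric.ball u ε) :=
    ⟨Metric.isOpen_ball, Metric.isOpen_ball, Metric.isOpen_ball,
      (convex_ball _ _).isPreconnected, (convex_ball _ _).isPreconnected,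
      (convex_ball _ _).isPreconnected⟩
  refine ⟨Metric.ball t ε ×ˢ Metric.ball x ε ×ˢ Metric.ball u ε, ?_, ?_⟩
  · exact (Metric.isOpen_ball.prod (Metric.isOpen_ball.prod Metric.isOpen_ball)).mem_nhds
      ⟨Metric.mem_ball_self hε, Metric.mem_ball_self hε, Metric.mem_ball_self hε⟩
  · refine HasForm.of_tendsto (l := 𝓝[≠] (0 : ℝ)) (G := fun s => Φ.toFun (θ s)) Metric.isOpen_ball
      (fun v hv => ?_) ?_ ?_
    · exact (Φ.isTransDomain (θ 0)).u_ne_zero (t, x, v) (hsub 0 (Metric.mem_ball_self hε)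
        ⟨Metric.mem_ball_self hε, Metric.mem_ball_self hε, hv⟩)
    · have hev : ∀ᶠ s in 𝓝[≠] (0 : ℝ), s ∈ Metric.ball (0 : ℝ) ε :=
        nhdsWithin_le_nhds (Metric.ball_mem_nhds 0 hε)
      filter_upwards [h, hev] with s hs hs'
      exact hs _ _ _ hbox (Metric.mem_ball_self hε) (hsub s hs')
    · intro z hz
      have hmem : ((0, z) : ℝ × ℝ × ℝ × ℝ) ∈
          {p : ℝ × ℝ × ℝ × ℝ | p.2 ∈ Φ.dom (θ p.1)} := hsub 0 (Metric.mem_ball_self hε) hz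
      have h1 := (hc.continuousAt (ho.mem_nhds hmem)).tendsto
      have h2 : Filter.Tendsto (fun s : ℝ => ((s, z) : ℝ × ℝ × ℝ × ℝ)) (𝓝[≠] 0) (𝓝 (0, z)) :=
        (Continuous.tendsto (by fun_prop) 0).mono_left nhdsWithin_le_nhds
      exact h1.comp h2

/-! ### Approximation by generic equations and by exponents different from two. -/

/-- The element of the class with `h` multiplied by `exp (s k)`. -/
noncomputable def ArbElem.scaleH (θ : ArbElem) (k : ℝ → ℝ) (hk : ContDiffOn ℝ ∞ k θ.I) (s : ℝ) :
    ArbElem :=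
  { θ with
    h := fun x => θ.h x * Real.exp (s * k x)
    smooth_h := θ.smooth_h.mul ((contDiffOn_const.mul hk).exp)
    h_ne_zero := fun x hx => mul_ne_zero (θ.h_ne_zero x hx) (Real.exp_ne_zero _) }

/-- The element of the class with the exponent replaced. -/
def ArbElem.setM (θ : ArbElem) (m : ℝ) (h0 : m ≠ 0) (h1 : m ≠ 1) : ArbElem :=
  { θ with m := m, m_ne_zero := h0, m_ne_one := h1 }

/-- The hypothesis k' = ρk, with ρ the density, says that k is fixed by the derivative along the
density. The factor exp(sk) adds 2s ρk/(1 - m) to `logInv`, and the resulting increment of the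
zeroth invariant is reproduced by every further derivative. -/
theorem invariantFn_scaleH (θ : ArbElem) {k : ℝ → ℝ} (hk : ContDiffOn ℝ ∞ k θ.I)
    (hk' : ∀ x ∈ θ.I, deriv k x = density θ x * k x) (s : ℝ) (j : ℕ) :
    ∀ x ∈ θ.I, invariantFn (θ.scaleH k hk s) j x =
      invariantFn θ j x + 2 / (1 - θ.m) * s * k x := by
  induction j with
  | zero =>
    intro x hx
    have h1 := (θ.hasDerivAt_h hx).fun_mul
      ((hasDerivAt_of_contDiffOn θ.isOpen_I hk hx).const_mul s).exp
    have nh := θ.h_ne_zero x hx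
    have nd := (density_pos θ x).ne'
    have ne := Real.exp_ne_zero (s * k x)
    have e1 : deriv (θ.scaleH k hk s).h x / (θ.scaleH k hk s).h x =
        deriv θ.h x / θ.h x + s * (density θ x * k x) := by
      rw [show (θ.scaleH k hk s).h = fun x => θ.h x * Real.exp (s * k x) from rfl, h1.deriv,
        hk' x hx]
      field_simp
    change ((deriv θ.f x / θ.f x + deriv θ.g x / θ.g x) / 2 + 2 / (1 - θ.m) *
      (deriv (θ.scaleH k hk s).h x / (θ.scaleH k hk s).h x - deriv θ.f x / θ.f x)) /
        density θ x = logInv θ x / density θ x + _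
    rw [e1, logInv]
    field_simp
    ring
  | succ j ih =>
    intro x hx
    have nd := (density_pos θ x).ne'
    have h1 : HasDerivAt (fun x => invariantFn θ j x + 2 / (1 - θ.m) * s * k x)
        (density θ x * invariantFn θ (j + 1) x + 2 / (1 - θ.m) * s * (density θ x * k x)) x := by
      have h2 := hasDerivAt_of_contDiffOn θ.isOpen_I hk hx
      rw [hk' x hx] at h2
      exact (hasDerivAt_invariantFn θ j hx).fun_add (h2.const_mul _)
    have h3 : HasDerivAt (invariantFn (θ.scaleH k hk s) j) _ x := h1.congr_of_eventuallyEq (by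
      filter_upwards [θ.isOpen_I.mem_nhds hx] with y hy using ih y hy)
    change deriv (invariantFn (θ.scaleH k hk s) j) x / density θ x = _
    rw [h3.deriv]
    field_simp

/-- With k = exp Y and k(x₀) = 1, all the invariants involved are shifted by the same amount cs,
where c = 2/(1 - m). The genericity expression becomes a quadratic polynomial in s with leading
coefficient (3 - 4)c² ≠ 0, so its zeros are isolated. -/
theorem exists_generic_scaleH (θ : ArbElem) {x₀ : ℝ} (hx₀ : x₀ ∈ θ.I) :
    ∃ (k : ℝ → ℝ) (hk : ContDiffOn ℝ ∞ k θ.I),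
      ∀ᶠ s in 𝓝[≠] (0 : ℝ), IsGenericAt (θ.scaleH k hk s) x₀ := by
  set Y : ℝ → ℝ := fun x => ∫ y in x₀..x, density θ y with hY
  have hYd : ∀ x ∈ θ.I, HasDerivAt Y (density θ x) x := fun x hx =>
    hasDerivAt_integral θ.isOpen_I θ.ordConnected_I (contDiffOn_density θ).continuousOn hx₀ hx
  have hYs : ContDiffOn ℝ ∞ Y θ.I := by
    rw [contDiffOn_infty_iff_deriv_of_isOpen θ.isOpen_I]
    exact ⟨fun x hx => (hYd x hx).differentiableAt.differentiableWithinAt,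
      (contDiffOn_density θ).congr fun x hx => (hYd x hx).deriv⟩
  have hk : ContDiffOn ℝ ∞ (fun x => Real.exp (Y x)) θ.I := hYs.exp
  refine ⟨_, hk, ?_⟩
  have hk' : ∀ x ∈ θ.I, deriv (fun x => Real.exp (Y x)) x = density θ x * Real.exp (Y x) := by
    intro x hx
    rw [(hYd x hx).exp.deriv, mul_comm]
  have hk0 : Real.exp (Y x₀) = 1 := by simp [hY]
  have hinv := fun s j => invariantFn_scaleH θ hk hk' s j x₀ hx₀
  simp only [hk0, mul_one] at hinv
  simp only [IsGenericAt, hinv]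
  set c := 2 / (1 - θ.m) with hc
  have hc0 : c ≠ 0 := div_ne_zero two_ne_zero (sub_ne_zero.2 θ.m_ne_one.symm)
  set a := invariantFn θ 2 x₀
  set b := invariantFn θ 3 x₀
  set d := invariantFn θ 4 x₀
  have hcont : ∀ p : ℝ → ℝ, Continuous p → p 0 ≠ 0 → ∀ᶠ s in 𝓝[≠] (0 : ℝ), p s ≠ 0 :=
    fun p hp h0 => nhdsWithin_le_nhds (hp.continuousAt.eventually (isOpen_ne.mem_nhds h0))
  have hs0 : ∀ᶠ s in 𝓝[≠] (0 : ℝ), s ≠ 0 := self_mem_nhdsWithin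
  by_cases h1 : 3 * a * d - 4 * b ^ 2 = 0
  -- The three cases correspond to a zero of order two, one or none at s = 0.
  · by_cases h2 : 3 * a + 3 * d - 8 * b = 0
    · filter_upwards [hs0] with s hs
      have : 3 * (a + c * s) * (d + c * s) - 4 * (b + c * s) ^ 2 = -(c * s) ^ 2 := by
        linear_combination h1 + c * s * h2
      rw [this]
      exact neg_ne_zero.2 (pow_ne_zero 2 (mul_ne_zero hc0 hs))
    · filter_upwards [hs0, hcont (fun s => 3 * a + 3 * d - 8 * b - c * s) (by fun_prop)
        (by simpa using h2)] with s hs hs'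
      have : 3 * (a + c * s) * (d + c * s) - 4 * (b + c * s) ^ 2 =
          c * s * (3 * a + 3 * d - 8 * b - c * s) := by
        linear_combination h1
      rw [this]
      exact mul_ne_zero (mul_ne_zero hc0 hs) hs'
  · exact hcont (fun s => 3 * (a + c * s) * (d + c * s) - 4 * (b + c * s) ^ 2) (by fun_prop)
      (by simpa using h1)

theorem scaleH_zero (θ : ArbElem) {k : ℝ → ℝ} (hk : ContDiffOn ℝ ∞ k θ.I) :
    θ.scaleH k hk 0 = θ := by
  have : (fun x => θ.h x * Real.exp (0 * k x)) = θ.h := by ext x; simp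
  simp only [ArbElem.scaleH, this]

theorem isSmoothCurve_scaleH (θ : ArbElem) {k : ℝ → ℝ} (hk : ContDiffOn ℝ ∞ k θ.I) :
    IsSmoothCurve θ.I (θ.scaleH k hk) where
  I_eq _ := rfl
  smooth_f := θ.smooth_f.comp contDiffOn_snd fun _ hp => hp.2
  smooth_g := θ.smooth_g.comp contDiffOn_snd fun _ hp => hp.2
  smooth_h := (θ.smooth_h.comp contDiffOn_snd fun _ hp => hp.2).mul
    (contDiffOn_fst.mul (hk.comp contDiffOn_snd fun _ hp => hp.2)).exp
  smooth_m := contDiff_const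

theorem isSmoothCurve_setM (θ : ArbElem) {m : ℝ → ℝ} (hm : ContDiff ℝ ∞ m) (h0 : ∀ s, m s ≠ 0)
    (h1 : ∀ s, m s ≠ 1) : IsSmoothCurve θ.I fun s => θ.setM (m s) (h0 s) (h1 s) where
  I_eq _ := rfl
  smooth_f := θ.smooth_f.comp contDiffOn_snd fun _ hp => hp.2
  smooth_g := θ.smooth_g.comp contDiffOn_snd fun _ hp => hp.2
  smooth_h := θ.smooth_h.comp contDiffOn_snd fun _ hp => hp.2
  smooth_m := hm

variable {Φ : TransFamily}

theorem isLocAdmissible_of_mem_group (hΦ : Φ ∈ generalizedExtendedEquivalenceGroup) (θ : ArbElem) :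
    IsLocAdmissible θ (Φ.arb θ) (Φ.dom θ) (Φ.toFun θ) :=
  (hΦ.2 θ).isLocAdmissible (Φ.isTransDomain θ)

theorem exists_hasForm_of_ne_two (hΦ : Φ ∈ generalizedExtendedEquivalenceGroup) {θ : ArbElem}
    (hm : θ.m ≠ 2) {z : ℝ × ℝ × ℝ} (hz : z ∈ Φ.dom θ) : ∃ N ∈ 𝓝 z, HasForm (Φ.toFun θ) N := by
  obtain ⟨t, x, u⟩ := z
  obtain ⟨k, hk, hgen⟩ := exists_generic_scaleH θ ((Φ.isTransDomain θ).mem_I _ hz)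
  have := exists_hasForm_of_curve hΦ.1 (isSmoothCurve_scaleH θ hk) (t := t) (x := x) (u := u)
    (by rwa [scaleH_zero]) ?_
  · rwa [scaleH_zero] at this
  · filter_upwards [hgen] with s hs It Ix Iu hB hx hsub
    exact ((isLocAdmissible_of_mem_group hΦ _).mono hsub
      (hB.open_t.prod (hB.open_x.prod hB.open_u))).box_hasForm hB hm hx hs

/-- The exponent 2 + s² avoids 0 and 1, and also 2 for s ≠ 0. For these s the form is known locally,
itself by a limit; it extends to whole boxes, whose slices are connected, and a second limit s → 0
settles m = 2. -/
theorem exists_hasForm (hΦ : Φ ∈ generalizedExtendedEquivalenceGroup) {θ : ArbElem}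
    {z : ℝ × ℝ × ℝ} (hz : z ∈ Φ.dom θ) : ∃ N ∈ 𝓝 z, HasForm (Φ.toFun θ) N := by
  by_cases hm : θ.m = 2
  · obtain ⟨t, x, u⟩ := z
    have h0 : ∀ s : ℝ, 2 + s ^ 2 ≠ 0 := fun s => by positivity
    have h1 : ∀ s : ℝ, 2 + s ^ 2 ≠ 1 := fun s h => by nlinarith [sq_nonneg s]
    have e0 : θ.setM (2 + 0 ^ 2) (h0 0) (h1 0) = θ := by
      have : (2 + 0 ^ 2 : ℝ) = θ.m := by rw [hm]; norm_num
      simp only [ArbElem.setM, this]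
    have := exists_hasForm_of_curve hΦ.1
      (isSmoothCurve_setM θ (m := fun s => 2 + s ^ 2) (by fun_prop) h0 h1)
      (t := t) (x := x) (u := u) (by simpa only [e0] using hz) ?_
    · simpa only [e0] using this
    · have hs0 : ∀ᶠ s in 𝓝[≠] (0 : ℝ), s ≠ 0 := self_mem_nhdsWithin
      filter_upwards [hs0] with s hs It Ix Iu hB hx hsub
      refine hasForm_of_local (hB.conn_t.prod (hB.conn_x.prod hB.conn_u)) (fun y => ?_)
        (fun z hz => (Φ.isTransDomain _).u_ne_zero z (hsub hz)) fun z hz =>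
        exists_hasForm_of_ne_two hΦ (by simpa [ArbElem.setM] using hs) (hsub hz)
      by_cases hy : y ∈ Ix
      · have : {p : ℝ × ℝ | (p.1, y, p.2) ∈ It ×ˢ Ix ×ˢ Iu} = It ×ˢ Iu := by
          ext p; simp [hy]
        rw [this]; exact hB.conn_t.prod hB.conn_u
      · have : {p : ℝ × ℝ | (p.1, y, p.2) ∈ It ×ˢ Ix ×ˢ Iu} = ∅ := by
          ext p; simp [hy]
        rw [this]; exact isPreconnected_empty
  · exact exists_hasForm_of_ne_two hΦ hm hz

theorem hasForm_of_mem_group (hΦ : Φ ∈ generalizedExtendedEquivalenceGroup) (θ : ArbElem) :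
    HasForm (Φ.toFun θ) (Φ.dom θ) :=
  hasForm_of_local (Φ.isTransDomain θ).isConnected.isPreconnected (Φ.isTransDomain θ).slice
    (Φ.isTransDomain θ).u_ne_zero fun _ hz => exists_hasForm hΦ hz

/-! ### From the form of the map to the listed form. -/

theorem hasListedForm_of_hasForm {θ θ' : ArbElem} {Ω : Set (ℝ × ℝ × ℝ)}
    {F : ℝ × ℝ × ℝ → ℝ × ℝ × ℝ} (hΩ : IsTransDomain θ Ω) (hF : IsAdmissible θ θ' Ω F)
    (h : HasForm F Ω) : HasListedForm θ θ' Ω F := by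
  have H := hF.isLocAdmissible hΩ
  obtain ⟨δ₁, δ₂, φ, ψ, hform⟩ := h
  have hev : ∀ t x u : ℝ, (t, x, u) ∈ Ω → ∀ᶠ y in 𝓝 x, (t, y, u) ∈ Ω := by
    intro t x u hz
    have hc : ContinuousAt (fun y : ℝ => ((t, y, u) : ℝ × ℝ × ℝ)) x := by fun_prop
    exact hc.eventually (hΩ.isOpen.mem_nhds hz)
  have hT : ∀ {t x u : ℝ}, (t, x, u) ∈ Ω → compT F (t, x, u) = δ₁ * t + δ₂ := fun hz =>
    congrArg Prod.fst (hform _ _ _ hz)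
  have hX : ∀ {t x u : ℝ}, (t, x, u) ∈ Ω → compX F (t, x, u) = φ x := fun hz =>
    congrArg (fun z => z.2.1) (hform _ _ _ hz)
  have hU : ∀ {t x u : ℝ}, (t, x, u) ∈ Ω → compU F (t, x, u) = ψ x * u := fun hz =>
    congrArg (fun z => z.2.2) (hform _ _ _ hz)
  have hφs : ContDiffOn ℝ ∞ φ (xProj Ω) := by
    rintro _ ⟨⟨t, x, u⟩, hz, rfl⟩
    have h1 : ContDiffAt ℝ ∞ (fun y => compX F (t, y, u)) x :=
      ContDiffAt.comp (g := compX F) x (H.contDiffAt_compX hz)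
        (contDiffAt_const.prodMk (contDiffAt_id.prodMk contDiffAt_const))
    refine (h1.congr_of_eventuallyEq ?_).contDiffWithinAt
    filter_upwards [hev t x u hz] with y hy using (hX hy).symm
  have hψs : ContDiffOn ℝ ∞ ψ (xProj Ω) := by
    rintro _ ⟨⟨t, x, u⟩, hz, rfl⟩
    have hu := hΩ.u_ne_zero _ hz
    have h1 : ContDiffAt ℝ ∞ (fun y => compU F (t, y, u)) x :=
      ContDiffAt.comp (g := compU F) x (H.contDiffAt_compU hz)
        (contDiffAt_const.prodMk (contDiffAt_id.prodMk contDiffAt_const))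
    refine ((h1.div_const u).congr_of_eventuallyEq ?_).contDiffWithinAt
    filter_upwards [hev t x u hz] with y hy
    rw [hU hy, mul_div_cancel_right₀ _ hu]
  have ho := hΩ.isOpen_xProj
  have hφd : ∀ x ∈ xProj Ω, HasDerivAt φ (deriv φ x) x := fun x hx =>
    hasDerivAt_of_contDiffOn ho hφs hx
  have hφd' : ∀ x ∈ xProj Ω, HasDerivAt (deriv φ) (deriv (deriv φ) x) x := fun x hx =>
    hasDerivAt_of_contDiffOn ho (contDiffOn_deriv ho hφs) hx
  have hψd : ∀ x ∈ xProj Ω, HasDerivAt ψ (deriv ψ x) x := fun x hx =>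
    hasDerivAt_of_contDiffOn ho hψs hx
  have hψd' : ∀ x ∈ xProj Ω, HasDerivAt (deriv ψ) (deriv (deriv ψ) x) x := fun x hx =>
    hasDerivAt_of_contDiffOn ho (contDiffOn_deriv ho hψs) hx
  -- partial derivatives of the components
  have dT : ∀ {t x u : ℝ}, (t, x, u) ∈ Ω → fderiv ℝ (compT F) (t, x, u) (1, 0, 0) = δ₁ := by
    intro t x u hz
    have h1 := hasDerivAt_partial_t ((H.contDiffAt_compT hz).differentiableAt (by simp))
    have hc : ContinuousAt (fun s : ℝ => ((s, x, u) : ℝ × ℝ × ℝ)) t := by fun_prop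
    have h2 : HasDerivAt (fun s : ℝ => δ₁ * s + δ₂) δ₁ t := by
      simpa using ((hasDerivAt_id t).const_mul δ₁).add_const δ₂
    refine h1.unique (h2.congr_of_eventuallyEq ?_)
    filter_upwards [hc.eventually (hΩ.isOpen.mem_nhds hz)] with s hs using hT hs
  have dXt : ∀ {t x u : ℝ}, (t, x, u) ∈ Ω → fderiv ℝ (compX F) (t, x, u) (1, 0, 0) = 0 := by
    intro t x u hz
    have h1 := hasDerivAt_partial_t ((H.contDiffAt_compX hz).differentiableAt (by simp))
    have hc : ContinuousAt (fun s : ℝ => ((s, x, u) : ℝ × ℝ × ℝ)) t := by fun_prop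
    refine h1.unique ((hasDerivAt_const t (φ x)).congr_of_eventuallyEq ?_)
    filter_upwards [hc.eventually (hΩ.isOpen.mem_nhds hz)] with s hs using hX hs
  have dUt : ∀ {t x u : ℝ}, (t, x, u) ∈ Ω → fderiv ℝ (compU F) (t, x, u) (1, 0, 0) = 0 := by
    intro t x u hz
    have h1 := hasDerivAt_partial_t ((H.contDiffAt_compU hz).differentiableAt (by simp))
    have hc : ContinuousAt (fun s : ℝ => ((s, x, u) : ℝ × ℝ × ℝ)) t := by fun_prop
    refine h1.unique ((hasDerivAt_const t (ψ x * u)).congr_of_eventuallyEq ?_)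
    filter_upwards [hc.eventually (hΩ.isOpen.mem_nhds hz)] with s hs using hU hs
  have dXx : ∀ {t x u : ℝ}, (t, x, u) ∈ Ω →
      fderiv ℝ (compX F) (t, x, u) (0, 1, 0) = deriv φ x := by
    intro t x u hz
    have h1 := hasDerivAt_partial_x ((H.contDiffAt_compX hz).differentiableAt (by simp))
    refine h1.unique ((hφd x (mem_xProj hz)).congr_of_eventuallyEq ?_)
    filter_upwards [hev t x u hz] with y hy using hX hy
  have dUx : ∀ {t x u : ℝ}, (t, x, u) ∈ Ω →
      fderiv ℝ (compU F) (t, x, u) (0, 1, 0) = deriv ψ x * u := by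
    intro t x u hz
    have h1 := hasDerivAt_partial_x ((H.contDiffAt_compU hz).differentiableAt (by simp))
    refine h1.unique (((hψd x (mem_xProj hz)).mul_const u).congr_of_eventuallyEq ?_)
    filter_upwards [hev t x u hz] with y hy using hU hy
  have dUu : ∀ {t x u : ℝ}, (t, x, u) ∈ Ω → fderiv ℝ (compU F) (t, x, u) (0, 0, 1) = ψ x := by
    intro t x u hz
    have h1 := hasDerivAt_partial_u ((H.contDiffAt_compU hz).differentiableAt (by simp))
    have hc : ContinuousAt (fun s : ℝ => ((t, x, s) : ℝ × ℝ × ℝ)) u := by fun_prop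
    have h2 : HasDerivAt (fun s : ℝ => ψ x * s) (ψ x) u := by
      simpa using (hasDerivAt_id u).const_mul (ψ x)
    refine h1.unique (h2.congr_of_eventuallyEq ?_)
    filter_upwards [hc.eventually (hΩ.isOpen.mem_nhds hz)] with s hs using hU hs
  have dXxx : ∀ {t x u : ℝ}, (t, x, u) ∈ Ω →
      hess (compX F) (t, x, u) (0, 1, 0) = deriv (deriv φ) x := by
    intro t x u hz
    have h1 := hasDerivAt_partial_x (differentiableAt_fderiv_apply (H.contDiffAt_compX hz) (0, 1, 0))
    rw [← fderiv_fderiv_apply (H.contDiffAt_compX hz)] at h1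
    refine h1.unique ((hφd' x (mem_xProj hz)).congr_of_eventuallyEq ?_)
    filter_upwards [hev t x u hz] with y hy using dXx hy
  have dUxx : ∀ {t x u : ℝ}, (t, x, u) ∈ Ω →
      hess (compU F) (t, x, u) (0, 1, 0) = deriv (deriv ψ) x * u := by
    intro t x u hz
    have h1 := hasDerivAt_partial_x (differentiableAt_fderiv_apply (H.contDiffAt_compU hz) (0, 1, 0))
    rw [← fderiv_fderiv_apply (H.contDiffAt_compU hz)] at h1
    refine h1.unique (((hψd' x (mem_xProj hz)).mul_const u).congr_of_eventuallyEq ?_)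
    filter_upwards [hev t x u hz] with y hy using dUx hy
  have dUxu : ∀ {t x u : ℝ}, (t, x, u) ∈ Ω →
      fderiv ℝ (fderiv ℝ (compU F)) (t, x, u) (0, 1, 0) (0, 0, 1) = deriv ψ x := by
    intro t x u hz
    have h1 := hasDerivAt_partial_x (differentiableAt_fderiv_apply (H.contDiffAt_compU hz) (0, 0, 1))
    rw [← fderiv_fderiv_apply (H.contDiffAt_compU hz)] at h1
    refine h1.unique ((hψd x (mem_xProj hz)).congr_of_eventuallyEq ?_)
    filter_upwards [hev t x u hz] with y hy using dUu hy
  -- the relations between the parameters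
  have main : ∀ x ∈ xProj Ω, δ₁ ≠ 0 ∧ deriv φ x ≠ 0 ∧ ψ x ≠ 0 ∧ φ x ∈ θ'.I ∧ θ'.m = θ.m ∧
      θ'.f (φ x) * θ.g x * deriv φ x ^ 2 = θ'.g (φ x) * θ.f x * δ₁ ∧
      θ'.f (φ x) * ψ x * θ.h x / (θ.f x * δ₁) = θ'.h (φ x) * |ψ x| ^ θ.m ∧
      deriv θ.g x / θ.g x = deriv θ'.g (φ x) * deriv φ x / θ'.g (φ x) +
        2 * (deriv ψ x / ψ x) - deriv (deriv φ) x / deriv φ x ∧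
      0 = deriv θ'.g (φ x) * deriv ψ x / deriv φ x + θ'.g (φ x) *
        (deriv (deriv ψ) x - deriv ψ x * deriv (deriv φ) x / deriv φ x) / deriv φ x ^ 2 := by
    rintro _ ⟨⟨t, x, u⟩, hz, rfl⟩
    obtain ⟨It, Ix, Iu, hB, hsub, ht, hx, hu⟩ := exists_isBox hΩ.isOpen hz
    have HB := H.mono hsub (hB.open_t.prod (hB.open_x.prod hB.open_u))
    obtain ⟨n1, n2, n3, hK, -⟩ :=
      H.determining_equations hz (dT hz) (dXt hz) (dXx hz) (dUt hz) (dUx hz) (dUu hz)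
    obtain ⟨hm, -, hp⟩ := HB.box_power hB ht hx hu (dT hz) (dXt hz) (dXx hz) (dUt hz) (dUx hz)
      (dUu hz)
    obtain ⟨hp1, hp2⟩ := hp (hU hz)
    obtain ⟨-, -, hl⟩ := HB.box_log_relations hB (fun t ht x hx u hu => by
        rw [hU (hsub ⟨ht, hx, hu⟩), dUu (hsub ⟨ht, hx, hu⟩)]) ht hx hu (hX hz) (dXt hz) (dXx hz)
      (dUu hz) rfl rfl
    rw [dUxu hz, dXxx hz] at hl
    rw [hX hz] at hK hp1 hp2
    rw [dXxx hz, dUxx hz] at hp2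
    have hu0 := hΩ.u_ne_zero _ hz
    refine ⟨n1, n2, n3, by rw [← hX hz]; exact H.mem_I _ hz, hm, hK, hp1, ?_, ?_⟩
    · linear_combination hl
    · refine mul_right_cancel₀ hu0 ?_
      linear_combination hp2
  -- The coefficient of u_x is the logarithmic form of the statement that this quotient is constant.
  -- Its constant value is δ₀, which gives the formula for the new g; those for the new f and h then
  -- follow from the other relations.
  have hG : ∀ x ∈ xProj Ω, HasDerivAt (fun x => θ'.g (φ x) * ψ x ^ 2 / (deriv φ x * θ.g x)) 0 x := by
    intro x hx
    obtain ⟨n1, n2, n3, hI', hm, hK, hp1, hl, -⟩ := main x hx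
    have ng := θ.g_ne_zero x (hΩ.xProj_subset hx)
    have ng' := θ'.g_ne_zero _ hI'
    have h1 : HasDerivAt (fun x => θ'.g (φ x)) (deriv θ'.g (φ x) * deriv φ x) x :=
      (θ'.hasDerivAt_g hI').comp x (hφd x hx)
    have h2 := (h1.fun_mul ((hψd x hx).fun_pow 2)).fun_div
      ((hφd' x hx).fun_mul (θ.hasDerivAt_g (hΩ.xProj_subset hx))) (mul_ne_zero n2 ng)
    refine h2.congr_deriv ?_
    field_simp at hl
    rw [div_eq_zero_iff]; left
    push_cast
    linear_combination (-ψ x) * hl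
  obtain ⟨z₀, hz₀⟩ := hΩ.isConnected.nonempty
  set x₀ := z₀.2.1
  have hx₀ : x₀ ∈ xProj Ω := ⟨z₀, hz₀, rfl⟩
  obtain ⟨δ₀, hδ₀⟩ : ∃ δ₀, δ₀ = θ'.g (φ x₀) * ψ x₀ ^ 2 / (deriv φ x₀ * θ.g x₀) := ⟨_, rfl⟩
  have hG' : ∀ x ∈ xProj Ω, θ'.g (φ x) * ψ x ^ 2 = δ₀ * (deriv φ x * θ.g x) := by
    intro x hx
    have := eq_of_hasDerivAt_zero ho hΩ.isPreconnected_xProj hG hx hx₀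
    simp only [← hδ₀] at this
    rw [div_eq_iff (mul_ne_zero (main x hx).2.1 (θ.g_ne_zero x (hΩ.xProj_subset hx)))] at this
    exact this
  have hδ₀0 : δ₀ ≠ 0 := by
    obtain ⟨n1, n2, n3, hI', -⟩ := main x₀ hx₀
    rw [hδ₀]
    exact div_ne_zero (mul_ne_zero (θ'.g_ne_zero _ hI') (pow_ne_zero 2 n3))
      (mul_ne_zero n2 (θ.g_ne_zero _ (hΩ.xProj_subset hx₀)))
  refine ⟨δ₀, δ₁, δ₂, φ, ψ, mul_ne_zero hδ₀0 (main x₀ hx₀).1, hφs, fun x hx => (main x hx).2.1,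
    hψs, fun x hx => (main x hx).2.2.1, fun x hx => ?_, hform, fun x hx => ?_,
    (main x₀ hx₀).2.2.2.2.1⟩
  · obtain ⟨n1, n2, n3, hI', hm, hK, hp1, hl, hlin⟩ := main x hx
    have ng := θ.g_ne_zero x (hΩ.xProj_subset hx)
    have ng' := θ'.g_ne_zero _ hI'
    have h1 := (((θ.hasDerivAt_g (hΩ.xProj_subset hx)).fun_mul (hψd' x hx)).fun_div
      ((hψd x hx).fun_pow 2) (pow_ne_zero 2 n3)).deriv
    rw [h1, div_eq_zero_iff]; left
    -- The determining equation linear in u gives ψ_xx in terms of φ and the new g, and `hl` removes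
    -- both. The result is the expanded form of (gψ_x/ψ²)_x = 0.
    have e1 : deriv (deriv ψ) x = deriv ψ x * (2 * (deriv ψ x / ψ x) - deriv θ.g x / θ.g x) := by
      rw [hl]
      have : θ'.g (φ x) / deriv φ x ^ 2 ≠ 0 := div_ne_zero ng' (pow_ne_zero 2 n2)
      refine mul_left_cancel₀ this ?_
      field_simp
      field_simp at hlin
      linear_combination (-ψ x) * hlin
    rw [e1]; field_simp; push_cast; ring
  · obtain ⟨n1, n2, n3, hI', hm, hK, hp1, -⟩ := main x hx
    have ng := θ.g_ne_zero x (hΩ.xProj_subset hx)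
    have nf := θ.f_ne_zero x (hΩ.xProj_subset hx)
    have eg : θ'.g (φ x) = δ₀ * deriv φ x / ψ x ^ 2 * θ.g x := by
      field_simp; linear_combination hG' x hx
    have ef : θ'.f (φ x) = δ₀ * δ₁ / (deriv φ x * ψ x ^ 2) * θ.f x := by
      rw [eg] at hK
      have : θ'.f (φ x) = δ₀ * deriv φ x / ψ x ^ 2 * θ.g x * θ.f x * δ₁ /
          (θ.g x * deriv φ x ^ 2) := by
        rw [eq_div_iff (mul_ne_zero ng (pow_ne_zero 2 n2))]; linear_combination hK
      rw [this]; field_simp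
    refine ⟨hI', ef, eg, ?_⟩
    have np := (Real.rpow_pos_of_pos (abs_pos.2 n3) θ.m).ne'
    rw [ef] at hp1
    have : θ'.h (φ x) = δ₀ * δ₁ / (deriv φ x * ψ x ^ 2) * θ.f x * ψ x * θ.h x / (θ.f x * δ₁) /
        |ψ x| ^ θ.m := by rw [eq_div_iff np, hp1]
    rw [this]; field_simp

/-! ### Listed maps are admissible. -/

theorem injOn_of_deriv_ne_zero {φ : ℝ → ℝ} {I : Set ℝ} (hI : IsPreconnected I)
    (hφ : ContinuousOn φ I) (h : ∀ x ∈ I, deriv φ x ≠ 0) : Set.InjOn φ I := by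
  have key : ∀ a ∈ I, ∀ b ∈ I, a < b → φ a ≠ φ b := by
    intro a ha b hb hab heq
    have hsub := hI.ordConnected.out ha hb
    obtain ⟨c, hc, hc'⟩ := exists_deriv_eq_zero hab (hφ.mono hsub) heq
    exact h c (hsub (Set.Ioo_subset_Icc_self hc)) hc'
  intro a ha b hb hab
  rcases lt_trichotomy a b with hlt | heq | hlt
  · exact (key a ha b hb hlt hab).elim
  · exact heq
  · exact (key b hb a ha hlt hab.symm).elim

theorem eventually_deriv_eq_at {f g : ℝ → ℝ} {f' g' a : ℝ} (h : ∀ᶠ u in 𝓝 a, f u = g u)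
    (hf : HasDerivAt f f' a) (hg : HasDerivAt g g' a) : f' = g' :=
  (hf.congr_of_eventuallyEq (h.mono fun _ h => h.symm)).unique hg

theorem isPointTransformation_of_form (hΩ : IsTransDomain θ Ω) {δ₁ δ₂ : ℝ} {φ ψ : ℝ → ℝ}
    (hδ₁ : δ₁ ≠ 0) (hφ : ContDiffOn ℝ ∞ φ (xProj Ω)) (hφ' : ∀ x ∈ xProj Ω, deriv φ x ≠ 0)
    (hψ : ContDiffOn ℝ ∞ ψ (xProj Ω)) (hψ0 : ∀ x ∈ xProj Ω, ψ x ≠ 0)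
    (hF : ∀ t x u : ℝ, (t, x, u) ∈ Ω → F (t, x, u) = (δ₁ * t + δ₂, φ x, ψ x * u)) :
    IsPointTransformation Ω F where
  smooth := by
    have hm : Set.MapsTo (fun z : ℝ × ℝ × ℝ => z.2.1) Ω (xProj Ω) := fun z hz => ⟨z, hz, rfl⟩
    have h1 : ContDiffOn ℝ ∞ (fun z : ℝ × ℝ × ℝ => z.2.1) Ω := by fun_prop
    have h2 : ContDiffOn ℝ ∞ (fun z : ℝ × ℝ × ℝ => z.2.2) Ω := by fun_prop
    have h3 : ContDiffOn ℝ ∞ (fun z : ℝ × ℝ × ℝ => δ₁ * z.1 + δ₂) Ω := by fun_prop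
    exact (h3.prodMk ((hφ.comp h1 hm).prodMk ((hψ.comp h1 hm).mul h2))).congr fun z hz =>
      hF z.1 z.2.1 z.2.2 hz
  injOn := by
    rintro ⟨t, x, u⟩ hz ⟨t', x', u'⟩ hz' h
    rw [hF _ _ _ hz, hF _ _ _ hz'] at h
    simp only [Prod.mk.injEq] at h
    have hx := injOn_of_deriv_ne_zero hΩ.isPreconnected_xProj hφ.continuousOn hφ'
      (mem_xProj hz) (mem_xProj hz') h.2.1
    subst hx
    have ht := mul_left_cancel₀ hδ₁ (add_right_cancel h.1)
    have hu := mul_left_cancel₀ (hψ0 x (mem_xProj hz)) h.2.2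
    rw [ht, hu]
  jacobian := by
    rintro ⟨t, x, u⟩ hz
    have hx := mem_xProj hz
    have ho := hΩ.isOpen_xProj
    have d1 : HasFDerivAt (fun z : ℝ × ℝ × ℝ => z.2.1)
        ((ContinuousLinearMap.fst ℝ ℝ ℝ).comp (ContinuousLinearMap.snd ℝ ℝ (ℝ × ℝ))) (t, x, u) :=
      hasFDerivAt_fst.comp (t, x, u) hasFDerivAt_snd
    have d2 : HasFDerivAt (fun z : ℝ × ℝ × ℝ => z.2.2)
        ((ContinuousLinearMap.snd ℝ ℝ ℝ).comp (ContinuousLinearMap.snd ℝ ℝ (ℝ × ℝ))) (t, x, u) :=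
      hasFDerivAt_snd.comp (t, x, u) hasFDerivAt_snd
    have d3 : HasFDerivAt (fun z : ℝ × ℝ × ℝ => δ₁ * z.1 + δ₂)
        (δ₁ • ContinuousLinearMap.fst ℝ ℝ (ℝ × ℝ)) (t, x, u) :=
      (hasFDerivAt_fst.const_mul δ₁).add_const δ₂
    have d4 : HasFDerivAt (fun z : ℝ × ℝ × ℝ => φ z.2.1) _ (t, x, u) :=
      HasFDerivAt.comp (t, x, u) (hasDerivAt_of_contDiffOn ho hφ hx).hasFDerivAt d1
    have d5 : HasFDerivAt (fun z : ℝ × ℝ × ℝ => ψ z.2.1) _ (t, x, u) :=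
      HasFDerivAt.comp (t, x, u) (hasDerivAt_of_contDiffOn ho hψ hx).hasFDerivAt d1
    have dF := (d3.prodMk (d4.prodMk (d5.mul d2))).congr_of_eventuallyEq (f₁ := F) (by
      filter_upwards [hΩ.isOpen.mem_nhds hz] with z hz using hF z.1 z.2.1 z.2.2 hz)
    rw [det_ne_zero_iff_injective, dF.fderiv, injective_iff_map_eq_zero]
    rintro ⟨a, b, c⟩ h
    simp only [ContinuousLinearMap.prod_apply, smul_apply, ContinuousLinearMap.coe_fst',
      smul_eq_mul, ContinuousLinearMap.comp_apply, ContinuousLinearMap.coe_snd', add_apply,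
      Prod.mk_eq_zero] at h
    obtain ⟨h1, h2, h3⟩ := h
    have ha : a = 0 := (mul_eq_zero.1 h1).resolve_left hδ₁
    have hb : b = 0 := by
      simpa [hφ' x hx] using h2
    subst hb
    have hc : c = 0 := by simpa [hψ0 x hx] using h3
    rw [ha, hc]; rfl

/-- Differentiating v(δ₁t + δ₂, φ(x)) = ψ(x)u(t, x) expresses the jet of v by that of u. The formula
for the new g makes the u_x terms match, and with it the equation for ψ removes the term linear in
u. -/
theorem isAdmissible_of_hasListedForm (hΩ : IsTransDomain θ Ω) (h : HasListedForm θ θ' Ω F) :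
    IsAdmissible θ θ' Ω F := by
  obtain ⟨δ₀, δ₁, δ₂, φ, ψ, hδ, hφ, hφ', hψ, hψ0, hode, hF, hrel, hm⟩ := h
  have hδ₀ : δ₀ ≠ 0 := left_ne_zero_of_mul hδ
  have hδ₁ : δ₁ ≠ 0 := right_ne_zero_of_mul hδ
  refine ⟨isPointTransformation_of_form hΩ hδ₁ hφ hφ' hψ hψ0 hF, ?_, ?_, ?_⟩
  · rintro ⟨t, x, u⟩ hz
    rw [hF _ _ _ hz]
    exact (hrel x (mem_xProj hz)).1
  · rintro ⟨t, x, u⟩ hz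
    rw [hF _ _ _ hz]
    exact mul_ne_zero (hψ0 x (mem_xProj hz)) (hΩ.u_ne_zero _ hz)
  · rintro u v ⟨t, x⟩ hz hu hv - huv
    simp only at hz
    have hx := mem_xProj hz
    have ho := hΩ.isOpen_xProj
    have hP : baseMap F u (t, x) = (δ₁ * t + δ₂, φ x) := by
      simp only [baseMap, hF _ _ _ hz]
    rw [hP] at hv ⊢
    have hxI := hΩ.xProj_subset hx
    obtain ⟨hI', ef, eg, eh⟩ := hrel x hx
    rw [solvesAt_iff hu hxI, solvesAt_iff hv hI']
    have hgr : ContinuousAt (fun q : ℝ × ℝ => ((q.1, q.2, u q) : ℝ × ℝ × ℝ)) (t, x) :=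
      continuousAt_fst.prodMk (continuousAt_snd.prodMk hu.continuousAt)
    have hrelv : ∀ᶠ q in 𝓝 (t, x), v (δ₁ * q.1 + δ₂, φ q.2) = ψ q.2 * u q := by
      filter_upwards [huv, hgr.eventually (hΩ.isOpen.mem_nhds hz)] with q hq hq'
      simpa only [baseMap, hF _ _ _ hq'] using hq
    have hct : ContinuousAt (fun s : ℝ => (s, x)) t := by fun_prop
    have hcx : ContinuousAt (fun y : ℝ => (t, y)) x := by fun_prop
    have dφ := hasDerivAt_of_contDiffOn ho hφ hx
    have dφ' := hasDerivAt_of_contDiffOn ho (contDiffOn_deriv ho hφ) hx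
    have dψ := hasDerivAt_of_contDiffOn ho hψ hx
    have dψ' := hasDerivAt_of_contDiffOn ho (contDiffOn_deriv ho hψ) hx
    have hu1 := eventually_differentiableAt hu
    have hv1 := eventually_differentiableAt hv
    -- first derivatives
    have hW : fderiv ℝ v (δ₁ * t + δ₂, φ x) (1, 0) * δ₁ = ψ x * fderiv ℝ u (t, x) (1, 0) := by
      have h2 : HasDerivAt (fun s : ℝ => δ₁ * s + δ₂) δ₁ t := by
        simpa using ((hasDerivAt_id t).const_mul δ₁).add_const δ₂
      have h3 := HasDerivAt.comp t (h₂ := fun s => v (s, φ x))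
        (hasDerivAt_fst_slice hv1.self_of_nhds) h2
      refine h3.unique (((hasDerivAt_fst_slice hu1.self_of_nhds).const_mul
        (ψ x)).congr_of_eventuallyEq ?_)
      filter_upwards [hct.eventually hrelv] with s hs using hs
    have hV : ∀ᶠ y in 𝓝 x, fderiv ℝ v (δ₁ * t + δ₂, φ y) (0, 1) * deriv φ y =
        deriv ψ y * u (t, y) + ψ y * fderiv ℝ u (t, y) (0, 1) := by
      have hcφ : ContinuousAt (fun y => (δ₁ * t + δ₂, φ y)) x :=
        continuousAt_const.prodMk dφ.continuousAt
      refine eventually_deriv_eq (f := fun y => v (δ₁ * t + δ₂, φ y))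
        (g := fun y => ψ y * u (t, y)) (hcx.eventually hrelv) ?_ ?_
      · filter_upwards [hcφ.eventually hv1, ho.mem_nhds hx] with y hy hy'
        exact HasDerivAt.comp y (h₂ := fun s => v (δ₁ * t + δ₂, s)) (hasDerivAt_snd_slice hy)
          (hasDerivAt_of_contDiffOn ho hφ hy')
      · filter_upwards [hcx.eventually hu1, ho.mem_nhds hx] with y hy hy'
        exact (hasDerivAt_of_contDiffOn ho hψ hy').fun_mul (hasDerivAt_snd_slice hy)
    have hV0 := hV.self_of_nhds
    have hV2 := (eventually_deriv_eq_at hV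
      ((HasDerivAt.comp x (h₂ := fun s => fderiv ℝ v (δ₁ * t + δ₂, s) (0, 1))
        (hasDerivAt_fderiv_snd_slice hv) dφ).fun_mul dφ')
      ((dψ'.fun_mul (hasDerivAt_snd_slice hu1.self_of_nhds)).fun_add
        (dψ.fun_mul (hasDerivAt_fderiv_snd_slice hu))))
    simp only [Function.comp_apply] at hV2
    -- derivative of the relation for `g`
    have dg := θ.hasDerivAt_g hxI
    have hg' : deriv θ'.g (φ x) * deriv φ x = _ :=
      eventually_deriv_eq_at (f := fun y => θ'.g (φ y))
        (g := fun y => δ₀ * deriv φ y / ψ y ^ 2 * θ.g y)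
        (by filter_upwards [ho.mem_nhds hx] with y hy using (hrel y hy).2.2.1)
        ((θ'.hasDerivAt_g hI').comp x dφ)
        (((dφ'.const_mul δ₀).fun_div (dψ.fun_pow 2) (pow_ne_zero 2 (hψ0 x hx))).fun_mul dg)
    have n1 := hψ0 x hx
    have n2 := hφ' x hx
    have ng := θ.g_ne_zero x hxI
    have hψ2 := hode x hx
    rw [((dg.fun_mul dψ').fun_div (dψ.fun_pow 2) (pow_ne_zero 2 n1)).deriv,
      div_eq_zero_iff, or_iff_left (pow_ne_zero 2 (pow_ne_zero 2 n1))] at hψ2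
    have hvP : v (δ₁ * t + δ₂, φ x) = ψ x * u (t, x) := hrelv.self_of_nhds
    have np := (Real.rpow_pos_of_pos (abs_pos.2 n1) θ.m).ne'
    simp only
    rw [hvP, hm, abs_mul, Real.mul_rpow (abs_nonneg _) (abs_nonneg _), ef, eg, eh]
    set W := fderiv ℝ v (δ₁ * t + δ₂, φ x) (1, 0)
    set V := fderiv ℝ v (δ₁ * t + δ₂, φ x) (0, 1)
    set V2 := fderiv ℝ (fderiv ℝ v) (δ₁ * t + δ₂, φ x) (0, 1) (0, 1)
    set b := fderiv ℝ u (t, x) (1, 0)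
    set c := fderiv ℝ u (t, x) (0, 1)
    set d := fderiv ℝ (fderiv ℝ u) (t, x) (0, 1) (0, 1)
    set φ₁ := deriv φ x
    set φ₂ := deriv (deriv φ) x
    set ψ₁ := deriv ψ x
    set ψ₂ := deriv (deriv ψ) x
    set g₁ := deriv θ.g x
    set G := deriv θ'.g (φ x)
    set p := ψ x
    set a := u (t, x)
    have eW : W = p * b / δ₁ := by field_simp; linear_combination hW
    have eV : V = (ψ₁ * a + p * c) / φ₁ := by field_simp; linear_combination hV0
    have eV2 : V2 = (ψ₂ * a + ψ₁ * c + (ψ₁ * c + p * d) - V * φ₂) / φ₁ ^ 2 := by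
      field_simp; linear_combination hV2
    have eG : G = ((δ₀ * φ₂ * p ^ 2 - δ₀ * φ₁ * (((2 : ℕ) : ℝ) * p ^ (2 - 1) * ψ₁)) / (p ^ 2) ^ 2 *
        θ.g x + δ₀ * φ₁ / p ^ 2 * g₁) / φ₁ := by
      rw [eq_div_iff n2]; exact hg'
    have eψ : ψ₂ = (2 * ψ₁ ^ 2 / p - g₁ * ψ₁ / θ.g x) := by
      field_simp
      push_cast at hψ2
      refine mul_left_cancel₀ n1 ?_
      linear_combination hψ2
    -- The residuals of the two equations are proportional with a nonvanishing factor, which proves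
    -- both implications at once.
    have key : δ₀ * δ₁ / (φ₁ * p ^ 2) * θ.f x * W - (G * V + δ₀ * φ₁ / p ^ 2 * θ.g x * V2 +
        δ₀ / (φ₁ * (p * |p| ^ θ.m)) * θ.h x * (|p| ^ θ.m * |a| ^ θ.m)) =
        δ₀ / (φ₁ * p) * (θ.f x * b - (g₁ * c + θ.g x * d + θ.h x * |a| ^ θ.m)) := by
      rw [eV2, eW, eV, eG, eψ]
      field_simp
      push_cast
      ring
    have hne : δ₀ / (φ₁ * p) ≠ 0 := div_ne_zero hδ₀ (mul_ne_zero n2 n1)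
    rw [← sub_eq_zero, ← sub_eq_zero (a := δ₀ * δ₁ / (φ₁ * p ^ 2) * θ.f x * W), key, mul_eq_zero,
      or_iff_right hne]

/-! ### Closure under inversion and composition. -/

/-- Rolle's theorem makes φ injective on the interval. Near each image point the inverse then
coincides with the local inverse of the inverse function theorem, hence is smooth. -/
theorem exists_smooth_inverse {φ : ℝ → ℝ} {I : Set ℝ} (ho : IsOpen I) (hI : IsPreconnected I)
    (hφ : ContDiffOn ℝ ∞ φ I) (h : ∀ x ∈ I, deriv φ x ≠ 0) :
    ∃ χ : ℝ → ℝ, IsOpen (φ '' I) ∧ ContDiffOn ℝ ∞ χ (φ '' I) ∧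
      ∀ x ∈ I, χ (φ x) = x ∧ deriv χ (φ x) = (deriv φ x)⁻¹ := by
  have hinj := injOn_of_deriv_ne_zero hI hφ.continuousOn h
  have hχ : ∀ x ∈ I, Function.invFunOn φ I (φ x) = x := fun x hx => hinj.leftInvOn_invFunOn hx
  have key : ∀ x ∈ I, φ '' I ∈ 𝓝 (φ x) ∧ ContDiffAt ℝ ∞ (Function.invFunOn φ I) (φ x) := by
    intro x hx
    have hc : ContDiffAt ℝ ∞ φ x := hφ.contDiffAt (ho.mem_nhds hx)
    have hd : HasFDerivAt φ ((ContinuousLinearEquiv.unitsEquivAut ℝ (Units.mk0 _ (h x hx)) :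
        ℝ ≃L[ℝ] ℝ) : ℝ →L[ℝ] ℝ) x := by
      refine (hasDerivAt_of_contDiffOn ho hφ hx).hasFDerivAt.congr_fderiv ?_
      ext; simp
    have hs := hc.hasStrictFDerivAt' hd (by simp)
    have hcl := hs.localInverse_continuousAt
    have hr := hs.eventually_right_inverse
    have hmem : ∀ᶠ y in 𝓝 (φ x), hs.localInverse φ _ x y ∈ I := by
      refine hcl.eventually ?_
      rw [hs.localInverse_apply_image]
      exact ho.mem_nhds hx
    refine ⟨?_, ?_⟩
    · filter_upwards [hr, hmem] with y h1 h2 using ⟨_, h2, h1⟩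
    · refine (hc.to_localInverse hd (by simp)).congr_of_eventuallyEq ?_
      filter_upwards [hr, hmem] with y h1 h2
      have h3 := hχ _ h2
      rw [h1] at h3
      exact h3
  refine ⟨Function.invFunOn φ I, isOpen_iff_mem_nhds.2 ?_, ?_, fun x hx => ⟨hχ x hx, ?_⟩⟩
  · rintro _ ⟨x, hx, rfl⟩; exact (key x hx).1
  · rintro _ ⟨x, hx, rfl⟩; exact (key x hx).2.contDiffWithinAt
  · have h1 := ((key x hx).2.differentiableAt (by simp)).hasDerivAt.comp x
      (hasDerivAt_of_contDiffOn ho hφ hx)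
    have h2 := h1.unique ((hasDerivAt_id x).congr_of_eventuallyEq (by
      filter_upwards [ho.mem_nhds hx] with y hy using hχ y hy))
    exact eq_inv_of_mul_eq_one_left h2

theorem deriv_eq_zero_of_eqOn {w : ℝ → ℝ} {I : Set ℝ} (ho : IsOpen I) {C : ℝ}
    (h : ∀ x ∈ I, w x = C) {x : ℝ} (hx : x ∈ I) : deriv w x = 0 :=
  ((hasDerivAt_const x C).congr_of_eventuallyEq (by
    filter_upwards [ho.mem_nhds hx] with y hy using h y hy)).deriv

/-- The first integral of the equation `(g ψ_x / ψ²)_x = 0`. -/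
theorem exists_first_integral {θ : ArbElem} {I : Set ℝ} (ho : IsOpen I) (hI : IsPreconnected I)
    (hsub : I ⊆ θ.I) {ψ : ℝ → ℝ} (hψ : ContDiffOn ℝ ∞ ψ I) (hψ0 : ∀ x ∈ I, ψ x ≠ 0)
    (hode : ∀ x ∈ I, deriv (fun y => θ.g y * deriv ψ y / ψ y ^ 2) x = 0) :
    ∃ C, ∀ x ∈ I, θ.g x * deriv ψ x / ψ x ^ 2 = C := by
  rcases I.eq_empty_or_nonempty with rfl | ⟨x₀, hx₀⟩
  · exact ⟨0, by simp⟩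
  refine ⟨_, fun x hx => eq_of_hasDerivAt_zero ho hI
    (f := fun y => θ.g y * deriv ψ y / ψ y ^ 2) (fun y hy => ?_) hx hx₀⟩
  have h1 := ((θ.hasDerivAt_g (hsub hy)).fun_mul
    (hasDerivAt_of_contDiffOn ho (contDiffOn_deriv ho hψ) hy)).fun_div
    ((hasDerivAt_of_contDiffOn ho hψ hy).fun_pow 2) (pow_ne_zero 2 (hψ0 y hy))
  rw [← hode y hy]
  exact h1.differentiableAt.hasDerivAt

/-- The map has a continuous inverse defined over φ(xProj Ω), which gives openness. Injectivity of φ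
makes each nonempty slice of the image an affine image of a single slice of `Ω`. -/
theorem isTransDomain_image (hΩ : IsTransDomain θ Ω) (h : HasListedForm θ θ' Ω F) :
    IsTransDomain θ' (F '' Ω) := by
  have hA := isAdmissible_of_hasListedForm hΩ h
  obtain ⟨δ₀, δ₁, δ₂, φ, ψ, hδ, hφ, hφ', hψ, hψ0, hode, hF, hrel, hm⟩ := h
  have hδ₁ : δ₁ ≠ 0 := right_ne_zero_of_mul hδ
  obtain ⟨χ, hop, hχ, hχφ⟩ := exists_smooth_inverse hΩ.isOpen_xProj hΩ.isPreconnected_xProj hφ hφ'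
  refine ⟨?_, hΩ.isConnected.image F hA.point.smooth.continuousOn, fun X => ?_, ?_, ?_⟩
  · set V : Set (ℝ × ℝ × ℝ) := {z | z.2.1 ∈ φ '' xProj Ω}
    have hV : IsOpen V := hop.preimage (by fun_prop : Continuous fun z : ℝ × ℝ × ℝ => z.2.1)
    have h1 : ContinuousOn (fun z : ℝ × ℝ × ℝ => χ z.2.1) V :=
      hχ.continuousOn.comp (by fun_prop) fun z hz => hz
    have hmaps : Set.MapsTo (fun z : ℝ × ℝ × ℝ => χ z.2.1) V (xProj Ω) := by
      rintro ⟨t, X, u⟩ ⟨x, hx, hxX⟩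
      simp only at hxX ⊢
      rw [← hxX, (hχφ x hx).1]; exact hx
    have h2 : ContinuousOn (fun z : ℝ × ℝ × ℝ =>
        ((z.1 - δ₂) / δ₁, χ z.2.1, z.2.2 / ψ (χ z.2.1))) V := by
      refine ContinuousOn.prodMk (by fun_prop) (h1.prodMk (ContinuousOn.div (by fun_prop)
        (hψ.continuousOn.comp h1 hmaps) fun z hz => hψ0 _ (hmaps hz)))
    have h3 := h2.isOpen_inter_preimage hV hΩ.isOpen
    convert h3 using 1
    ext ⟨T, X, U⟩
    constructor
    · rintro ⟨⟨t, x, u⟩, hz, he⟩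
      have hx := mem_xProj hz
      rw [hF _ _ _ hz] at he
      simp only [Prod.mk.injEq] at he
      obtain ⟨rfl, rfl, rfl⟩ := he
      refine ⟨⟨x, hx, rfl⟩, ?_⟩
      simp only [Set.mem_preimage, (hχφ x hx).1]
      rw [mul_div_cancel_left₀ _ (hψ0 x hx), add_sub_cancel_right, mul_div_cancel_left₀ _ hδ₁]
      exact hz
    · rintro ⟨⟨x, hx, hxX⟩, hz⟩
      simp only at hxX
      subst hxX
      simp only [Set.mem_preimage, (hχφ x hx).1] at hz
      refine ⟨_, hz, ?_⟩
      rw [hF _ _ _ hz, mul_div_cancel₀ _ hδ₁, mul_div_cancel₀ _ (hψ0 x hx), sub_add_cancel]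
  · by_cases hX : X ∈ φ '' xProj Ω
    · obtain ⟨x, hx, rfl⟩ := hX
      have h1 := (hΩ.slice x).image (fun p : ℝ × ℝ => (δ₁ * p.1 + δ₂, ψ x * p.2)) (by fun_prop)
      convert h1 using 1
      ext ⟨T, U⟩
      constructor
      · rintro ⟨⟨t, y, u⟩, hz, he⟩
        rw [hF _ _ _ hz] at he
        simp only [Prod.mk.injEq] at he
        have hxy := injOn_of_deriv_ne_zero hΩ.isPreconnected_xProj hφ.continuousOn hφ'
          (mem_xProj hz) hx he.2.1
        subst hxy
        exact ⟨(t, u), hz, Prod.ext he.1 he.2.2⟩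
      · rintro ⟨⟨t, u⟩, hz, he⟩
        refine ⟨(t, x, u), hz, ?_⟩
        simp only [Prod.mk.injEq] at he
        rw [hF _ _ _ hz, he.1, he.2]
    · convert isPreconnected_empty using 1
      rw [Set.eq_empty_iff_forall_notMem]
      rintro ⟨T, U⟩ ⟨⟨t, x, u⟩, hz, he⟩
      rw [hF _ _ _ hz] at he
      simp only [Prod.mk.injEq] at he
      exact hX ⟨x, mem_xProj hz, he.2.1⟩
  · rintro _ ⟨z, hz, rfl⟩; exact hA.mem_I z hz
  · rintro _ ⟨z, hz, rfl⟩; exact hA.u_ne_zero z hz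

theorem hasListedForm_inverse (hΩ : IsTransDomain θ Ω) (h : HasListedForm θ θ' Ω F) :
    HasListedForm θ' θ (F '' Ω) (Function.invFunOn F Ω) := by
  have hinj := (isAdmissible_of_hasListedForm hΩ h).point.injOn
  obtain ⟨δ₀, δ₁, δ₂, φ, ψ, hδ, hφ, hφ', hψ, hψ0, hode, hF, hrel, hm⟩ := h
  have hδ₀ : δ₀ ≠ 0 := left_ne_zero_of_mul hδ
  have hδ₁ : δ₁ ≠ 0 := right_ne_zero_of_mul hδ
  have ho := hΩ.isOpen_xProj
  obtain ⟨χ, hop, hχ, hχφ⟩ := exists_smooth_inverse ho hΩ.isPreconnected_xProj hφ hφ'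
  obtain ⟨C, hC⟩ := exists_first_integral ho hΩ.isPreconnected_xProj hΩ.xProj_subset hψ hψ0 hode
  have hproj : xProj (F '' Ω) = φ '' xProj Ω := by
    ext X
    constructor
    · rintro ⟨_, ⟨⟨t, x, u⟩, hz, rfl⟩, rfl⟩
      rw [hF _ _ _ hz]
      exact ⟨x, mem_xProj hz, rfl⟩
    · rintro ⟨_, ⟨⟨t, x, u⟩, hz, rfl⟩, rfl⟩
      exact ⟨_, ⟨_, hz, rfl⟩, by rw [hF _ _ _ hz]⟩
  have hmaps : Set.MapsTo χ (φ '' xProj Ω) (xProj Ω) := by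
    rintro _ ⟨x, hx, rfl⟩
    rw [(hχφ x hx).1]; exact hx
  have hψχ : ContDiffOn ℝ ∞ (fun X => (ψ (χ X))⁻¹) (φ '' xProj Ω) :=
    (hψ.comp hχ hmaps).inv fun X hX => hψ0 _ (hmaps hX)
  have hdψ : ∀ x ∈ xProj Ω,
      deriv (fun X => (ψ (χ X))⁻¹) (φ x) = -(deriv ψ x * (deriv φ x)⁻¹) / ψ x ^ 2 := by
    intro x hx
    have h1 := hasDerivAt_of_contDiffOn hop hχ ⟨x, hx, rfl⟩
    have h2 := hasDerivAt_of_contDiffOn ho hψ hx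
    rw [(hχφ x hx).2] at h1
    rw [← (hχφ x hx).1] at h2
    have h3 := ((h2.comp (φ x) h1).fun_inv (by
      simp only [Function.comp_apply, (hχφ x hx).1]; exact hψ0 x hx)).deriv
    simp only [Function.comp_apply, (hχφ x hx).1] at h3
    exact h3
  refine ⟨δ₀⁻¹, δ₁⁻¹, -(δ₂ / δ₁), χ, fun X => (ψ (χ X))⁻¹,
    mul_ne_zero (inv_ne_zero hδ₀) (inv_ne_zero hδ₁), ?_⟩
  rw [hproj]
  -- If C is the first integral of ψ, then the reciprocal of ψ, taken in the new variable, has the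
  -- first integral -δ₀C with respect to the new g.
  refine ⟨hχ, ?_, hψχ, fun X hX => inv_ne_zero (hψ0 _ (hmaps hX)),
    fun X hX => deriv_eq_zero_of_eqOn hop (C := -(δ₀ * C)) ?_ hX, ?_, ?_, hm.symm⟩
  · rintro _ ⟨x, hx, rfl⟩
    rw [(hχφ x hx).2]; exact inv_ne_zero (hφ' x hx)
  · rintro _ ⟨x, hx, rfl⟩
    rw [hdψ x hx]
    beta_reduce
    rw [(hχφ x hx).1, (hrel x hx).2.2.1, ← hC x hx]
    have n1 := hφ' x hx
    have n2 := hψ0 x hx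
    field_simp
  · rintro _ _ _ ⟨⟨t, x, u⟩, hz, he⟩
    rw [← he, hinj.leftInvOn_invFunOn hz]
    rw [hF _ _ _ hz] at he
    simp only [Prod.mk.injEq] at he
    obtain ⟨rfl, rfl, rfl⟩ := he
    have n2 := hψ0 x (mem_xProj hz)
    beta_reduce
    rw [(hχφ x (mem_xProj hz)).1]
    refine Prod.ext ?_ (Prod.ext rfl ?_)
    · simp only; field_simp; ring
    · simp only; field_simp
  · rintro _ ⟨x, hx, rfl⟩
    obtain ⟨-, ef, eg, eh⟩ := hrel x hx
    have n1 := hφ' x hx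
    have n2 := hψ0 x hx
    have np := (Real.rpow_pos_of_pos (abs_pos.2 n2) θ.m).ne'
    beta_reduce
    rw [(hχφ x hx).1, (hχφ x hx).2, ef, eg, eh, hm, abs_inv, Real.inv_rpow (abs_nonneg _)]
    refine ⟨hΩ.xProj_subset hx, ?_, ?_, ?_⟩ <;> field_simp

theorem HasListedForm.comp {θ'' : ArbElem} {Ω' : Set (ℝ × ℝ × ℝ)} {F' : ℝ × ℝ × ℝ → ℝ × ℝ × ℝ}
    (hΩ : IsTransDomain θ Ω) (h : HasListedForm θ θ' Ω F) (hΩ' : IsTransDomain θ' Ω')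
    (h' : HasListedForm θ' θ'' Ω' F') (hmap : Set.MapsTo F Ω Ω') :
    HasListedForm θ θ'' Ω (F' ∘ F) := by
  obtain ⟨δ₀, δ₁, δ₂, φ, ψ, hδ, hφ, hφ', hψ, hψ0, hode, hF, hrel, hm⟩ := h
  obtain ⟨ε₀, ε₁, ε₂, χ, η, hε, hχ, hχ', hη, hη0, hode', hF', hrel', hm'⟩ := h'
  have ho := hΩ.isOpen_xProj
  have ho' := hΩ'.isOpen_xProj
  have hmaps : Set.MapsTo φ (xProj Ω) (xProj Ω') := by
    rintro _ ⟨⟨t, x, u⟩, hz, rfl⟩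
    have := hmap hz
    rw [hF _ _ _ hz] at this
    exact mem_xProj this
  obtain ⟨C, hC⟩ := exists_first_integral ho hΩ.isPreconnected_xProj hΩ.xProj_subset hψ hψ0 hode
  obtain ⟨C', hC'⟩ := exists_first_integral ho' hΩ'.isPreconnected_xProj hΩ'.xProj_subset hη hη0
    hode'
  have hd : ∀ x ∈ xProj Ω, deriv (fun x => χ (φ x)) x = deriv χ (φ x) * deriv φ x := fun x hx =>
    ((hasDerivAt_of_contDiffOn ho' hχ (hmaps hx)).comp x (hasDerivAt_of_contDiffOn ho hφ hx)).deriv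
  have hdη : ∀ x ∈ xProj Ω, HasDerivAt (fun x => η (φ x)) (deriv η (φ x) * deriv φ x) x :=
    fun x hx => (hasDerivAt_of_contDiffOn ho' hη (hmaps hx)).comp x
      (hasDerivAt_of_contDiffOn ho hφ hx)
  refine ⟨δ₀ * ε₀, ε₁ * δ₁, ε₁ * δ₂ + ε₂, fun x => χ (φ x), fun x => η (φ x) * ψ x,
    ?_, hχ.comp hφ hmaps, fun x hx => ?_, (hη.comp hφ hmaps).mul hψ,
    fun x hx => mul_ne_zero (hη0 _ (hmaps hx)) (hψ0 x hx), fun x hx => ?_, fun t x u hz => ?_,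
    fun x hx => ?_, hm'.trans hm⟩
  · rw [show δ₀ * ε₀ * (ε₁ * δ₁) = δ₀ * δ₁ * (ε₀ * ε₁) by ring]; exact mul_ne_zero hδ hε
  · rw [hd x hx]; exact mul_ne_zero (hχ' _ (hmaps hx)) (hφ' x hx)
  -- Inserting both first integrals and the formula for the intermediate g leaves this combination
  -- of ψ and 1/η. The derivatives of its two terms cancel by the same relations.
  · have hev : ∀ᶠ y in 𝓝 x, θ.g y * deriv (fun x => η (φ x) * ψ x) y / (η (φ y) * ψ y) ^ 2 =
        C' / δ₀ * ψ y + C * (η (φ y))⁻¹ := by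
      filter_upwards [ho.mem_nhds hx] with y hy
      rw [((hdη y hy).fun_mul (hasDerivAt_of_contDiffOn ho hψ hy)).deriv, ← hC y hy,
        ← hC' _ (hmaps hy), (hrel y hy).2.2.1]
      have n1 := hφ' y hy
      have n2 := hψ0 y hy
      have n3 := hη0 _ (hmaps hy)
      have n4 := left_ne_zero_of_mul hδ
      field_simp
    have h1 := ((hasDerivAt_of_contDiffOn ho hψ hx).const_mul (C' / δ₀)).fun_add
      (((hdη x hx).fun_inv (hη0 _ (hmaps hx))).const_mul C)
    rw [(h1.congr_of_eventuallyEq hev).deriv, ← hC x hx, ← hC' _ (hmaps hx), (hrel x hx).2.2.1]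
    have n1 := hφ' x hx
    have n2 := hψ0 x hx
    have n3 := hη0 _ (hmaps hx)
    have n4 := left_ne_zero_of_mul hδ
    field_simp
    ring
  · have h1 := hmap hz
    rw [Function.comp_apply]
    rw [hF _ _ _ hz] at h1 ⊢
    rw [hF' _ _ _ h1]
    refine Prod.ext ?_ (Prod.ext rfl ?_) <;> simp only <;> ring
  · obtain ⟨-, ef, eg, eh⟩ := hrel x hx
    obtain ⟨hI, ef', eg', eh'⟩ := hrel' _ (hmaps hx)
    have n1 := hφ' x hx
    have n2 := hψ0 x hx
    have n3 := hη0 _ (hmaps hx)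
    have n4 := hχ' _ (hmaps hx)
    rw [hd x hx, ef', eg', eh', ef, eg, eh, hm, abs_mul,
      Real.mul_rpow (abs_nonneg _) (abs_nonneg _)]
    have np := (Real.rpow_pos_of_pos (abs_pos.2 n2) θ.m).ne'
    have np' := (Real.rpow_pos_of_pos (abs_pos.2 n3) θ.m).ne'
    refine ⟨hI, ?_, ?_, ?_⟩ <;> field_simp

/-! ### Realization of every listed map by a continuous family. -/

theorem mul_pos_of_isPreconnected {w : ℝ → ℝ} {I : Set ℝ} (hI : IsPreconnected I)
    (hw : ContinuousOn w I) (h : ∀ x ∈ I, w x ≠ 0) {x y : ℝ} (hx : x ∈ I) (hy : y ∈ I) :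
    0 < w x * w y := by
  have key : ∀ a ∈ I, ∀ b ∈ I, ¬ (w a < 0 ∧ 0 < w b) := by
    rintro a ha b hb ⟨h1, h2⟩
    obtain ⟨c, hc, hc'⟩ := hI.intermediate_value ha hb hw ⟨h1.le, h2.le⟩
    exact h c hc hc'
  rcases (h x hx).lt_or_gt with h1 | h1 <;> rcases (h y hy).lt_or_gt with h2 | h2
  · exact mul_pos_of_neg_of_neg h1 h2
  · exact (key x hx y hy ⟨h1, h2⟩).elim
  · exact (key y hy x hx ⟨h2, h1⟩).elim
  · exact mul_pos h1 h2

/-- A transformation domain stays one when it is restricted to an interval of values of `x`. -/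
theorem IsTransDomain.restrict {θ : ArbElem} {Ω : Set (ℝ × ℝ × ℝ)} (hΩ : IsTransDomain θ Ω)
    {J : Set ℝ} (hJo : IsOpen (xProj Ω ∩ J)) (hJ : IsPreconnected (xProj Ω ∩ J))
    (hne : (xProj Ω ∩ J).Nonempty) : IsTransDomain θ {z ∈ Ω | z.2.1 ∈ J} := by
  have hD : {z ∈ Ω | z.2.1 ∈ J} = Ω ∩ (fun z : ℝ × ℝ × ℝ => z.2.1) ⁻¹' (xProj Ω ∩ J) := by
    ext z
    exact ⟨fun h => ⟨h.1, ⟨z, h.1, rfl⟩, h.2⟩, fun h => ⟨h.1, h.2.2⟩⟩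
  have hop : IsOpen {z ∈ Ω | z.2.1 ∈ J} := by
    rw [hD]
    exact hΩ.isOpen.inter (hJo.preimage (by fun_prop))
  have hmap : IsOpenMap (fun z : ℝ × ℝ × ℝ => z.2.1) := isOpenMap_fst.comp isOpenMap_snd
  refine ⟨hop, ⟨?_, ?_⟩, fun x => ?_, fun z hz => hΩ.mem_I z hz.1, fun z hz => hΩ.u_ne_zero z hz.1⟩
  · obtain ⟨_, ⟨z, hz, rfl⟩, hzJ⟩ := hne
    exact ⟨z, hz, hzJ⟩
  -- The projection to the x-axis is open with connected fibres. The projections of the two open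
  -- pieces cover a connected set, so they share some x, and the connected slice over that x meets
  -- both pieces.
  · rintro U V hU hV hUV ⟨a, ha, haU⟩ ⟨b, hb, hbV⟩
    obtain ⟨x, hx, ⟨c, ⟨hc, hcU⟩, hcx⟩, ⟨e, ⟨he, heV⟩, hex⟩⟩ := hJ _ _
      (hmap _ (hop.inter hU)) (hmap _ (hop.inter hV))
      (by
        rintro _ ⟨⟨z, hz, rfl⟩, hzJ⟩
        rcases hUV ⟨hz, hzJ⟩ with h | h
        · exact Or.inl ⟨z, ⟨⟨hz, hzJ⟩, h⟩, rfl⟩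
        · exact Or.inr ⟨z, ⟨⟨hz, hzJ⟩, h⟩, rfl⟩)
      ⟨a.2.1, ⟨⟨a, ha.1, rfl⟩, ha.2⟩, a, ⟨ha, haU⟩, rfl⟩
      ⟨b.2.1, ⟨⟨b, hb.1, rfl⟩, hb.2⟩, b, ⟨hb, hbV⟩, rfl⟩
    obtain ⟨c₁, c₂, c₃⟩ := c
    obtain ⟨e₁, e₂, e₃⟩ := e
    simp only at hcx hex
    subst hcx hex
    have hcont : Continuous (fun p : ℝ × ℝ => ((p.1, e₂, p.2) : ℝ × ℝ × ℝ)) := by fun_prop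
    obtain ⟨p, hp, hpU, hpV⟩ := hΩ.slice e₂ _ _ (hU.preimage hcont) (hV.preimage hcont)
      (fun p hp => hUV ⟨hp, hc.2⟩) ⟨(c₁, c₃), hc.1, hcU⟩ ⟨(e₁, e₃), he.1, heV⟩
    exact ⟨_, ⟨hp, hc.2⟩, hpU, hpV⟩
  · by_cases hx : x ∈ J
    · simpa [hx] using hΩ.slice x
    · simpa [hx] using isPreconnected_empty

/-- Every transformation of the listed form can be completed by new arbitrary elements. -/
theorem exists_target {θ : ArbElem} {Ω : Set (ℝ × ℝ × ℝ)} {F : ℝ × ℝ × ℝ → ℝ × ℝ × ℝ}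
    (hΩ : IsTransDomain θ Ω) {δ₁ δ₂ : ℝ} {φ ψ : ℝ → ℝ} (hδ₁ : δ₁ ≠ 0)
    (hφ : ContDiffOn ℝ ∞ φ (xProj Ω)) (hφ' : ∀ x ∈ xProj Ω, deriv φ x ≠ 0)
    (hψ : ContDiffOn ℝ ∞ ψ (xProj Ω)) (hψ0 : ∀ x ∈ xProj Ω, ψ x ≠ 0)
    (hode : ∀ x ∈ xProj Ω, deriv (fun y => θ.g y * deriv ψ y / ψ y ^ 2) x = 0)
    (hF : ∀ t x u : ℝ, (t, x, u) ∈ Ω → F (t, x, u) = (δ₁ * t + δ₂, φ x, ψ x * u)) :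
    ∃ θ', HasListedForm θ θ' Ω F := by
  have ho := hΩ.isOpen_xProj
  have hsub := hΩ.xProj_subset
  obtain ⟨χ, hop, hχ, hχφ⟩ := exists_smooth_inverse ho hΩ.isPreconnected_xProj hφ hφ'
  have hmaps : Set.MapsTo χ (φ '' xProj Ω) (xProj Ω) := by
    rintro _ ⟨x, hx, rfl⟩
    rw [(hχφ x hx).1]; exact hx
  have hdφ := contDiffOn_deriv ho hφ
  have hpow : ContDiffOn ℝ ∞ (fun x => |ψ x| ^ θ.m) (xProj Ω) := fun x hx =>
    ((((hψ.contDiffAt (ho.mem_nhds hx)).abs (hψ0 x hx)).rpow_const_of_ne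
      (abs_pos.2 (hψ0 x hx)).ne')).contDiffWithinAt
  have hpow0 : ∀ x ∈ xProj Ω, |ψ x| ^ θ.m ≠ 0 := fun x hx =>
    (Real.rpow_pos_of_pos (abs_pos.2 (hψ0 x hx)) θ.m).ne'
  have hf : ContDiffOn ℝ ∞ (fun x => 1 * δ₁ / (deriv φ x * ψ x ^ 2) * θ.f x) (xProj Ω) :=
    (contDiffOn_const.div (hdφ.mul (hψ.pow 2)) fun x hx =>
      mul_ne_zero (hφ' x hx) (pow_ne_zero 2 (hψ0 x hx))).mul (θ.smooth_f.mono hsub)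
  have hg : ContDiffOn ℝ ∞ (fun x => 1 * deriv φ x / ψ x ^ 2 * θ.g x) (xProj Ω) :=
    ((contDiffOn_const.mul hdφ).div (hψ.pow 2) fun x hx => pow_ne_zero 2 (hψ0 x hx)).mul
      (θ.smooth_g.mono hsub)
  have hh : ContDiffOn ℝ ∞ (fun x => 1 / (deriv φ x * (ψ x * |ψ x| ^ θ.m)) * θ.h x) (xProj Ω) :=
    (contDiffOn_const.div (hdφ.mul (hψ.mul hpow)) fun x hx =>
      mul_ne_zero (hφ' x hx) (mul_ne_zero (hψ0 x hx) (hpow0 x hx))).mul (θ.smooth_h.mono hsub)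
  -- The listed formulas with δ₀ = 1, transported by the inverse χ of φ.
  let θ' : ArbElem :=
    { I := φ '' xProj Ω
      f := fun X => 1 * δ₁ / (deriv φ (χ X) * ψ (χ X) ^ 2) * θ.f (χ X)
      g := fun X => 1 * deriv φ (χ X) / ψ (χ X) ^ 2 * θ.g (χ X)
      h := fun X => 1 / (deriv φ (χ X) * (ψ (χ X) * |ψ (χ X)| ^ θ.m)) * θ.h (χ X)
      m := θ.m
      isOpen_I := hop
      nonempty_I := (hΩ.isConnected.nonempty.image _).image _
      ordConnected_I := (hΩ.isPreconnected_xProj.image φ hφ.continuousOn).ordConnected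
      smooth_f := hf.comp hχ hmaps
      smooth_g := hg.comp hχ hmaps
      smooth_h := hh.comp hχ hmaps
      f_ne_zero := fun X hX => mul_ne_zero (div_ne_zero (mul_ne_zero one_ne_zero hδ₁)
        (mul_ne_zero (hφ' _ (hmaps hX)) (pow_ne_zero 2 (hψ0 _ (hmaps hX)))))
        (θ.f_ne_zero _ (hsub (hmaps hX)))
      g_ne_zero := fun X hX => mul_ne_zero (div_ne_zero (mul_ne_zero one_ne_zero
        (hφ' _ (hmaps hX))) (pow_ne_zero 2 (hψ0 _ (hmaps hX)))) (θ.g_ne_zero _ (hsub (hmaps hX)))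
      h_ne_zero := fun X hX => mul_ne_zero (div_ne_zero one_ne_zero
        (mul_ne_zero (hφ' _ (hmaps hX)) (mul_ne_zero (hψ0 _ (hmaps hX)) (hpow0 _ (hmaps hX)))))
        (θ.h_ne_zero _ (hsub (hmaps hX)))
      m_ne_zero := θ.m_ne_zero
      m_ne_one := θ.m_ne_one }
  refine ⟨θ', 1, δ₁, δ₂, φ, ψ, by simpa using hδ₁, hφ, hφ', hψ, hψ0, hode, hF, fun x hx => ?_, rfl⟩
  simp only [θ', (hχφ x hx).1]
  exact ⟨⟨x, hx, rfl⟩, trivial, trivial, trivial⟩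

theorem HasListedForm.congr {θ θ' : ArbElem} {Ω : Set (ℝ × ℝ × ℝ)} {F G : ℝ × ℝ × ℝ → ℝ × ℝ × ℝ}
    (h : HasListedForm θ θ' Ω F) (hFG : Set.EqOn G F Ω) : HasListedForm θ θ' Ω G := by
  obtain ⟨δ₀, δ₁, δ₂, φ, ψ, hδ, hφ, hφ', hψ, hψ0, hode, hF, hrel, hm⟩ := h
  exact ⟨δ₀, δ₁, δ₂, φ, ψ, hδ, hφ, hφ', hψ, hψ0, hode,
    fun t x u hz => (hFG hz).trans (hF t x u hz), hrel, hm⟩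

/-- An integral depending on a parameter is jointly continuous in the parameter and the limit. -/
theorem continuousOn_integral_param {I : Set ℝ} (ho : IsOpen I) (hI : I.OrdConnected)
    {w : ℝ × ℝ → ℝ} (hw : ContinuousOn w (Set.univ ×ˢ I)) {c : ℝ} (hc : c ∈ I) :
    ContinuousOn (fun p : ℝ × ℝ => ∫ y in c..p.2, w (p.1, y)) (Set.univ ×ˢ I) := by
  rintro ⟨s₀, x₀⟩ ⟨-, hx₀ : x₀ ∈ I⟩
  have hmin : min c x₀ ∈ I := by rcases min_choice c x₀ with h | h <;> rw [h] <;> assumption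
  have hmax : max c x₀ ∈ I := by rcases max_choice c x₀ with h | h <;> rw [h] <;> assumption
  obtain ⟨a, haI, ha⟩ : ∃ a ∈ I, a < min c x₀ := by
    have h1 : ∀ᶠ v in 𝓝[<] (min c x₀), v ∈ I := nhdsWithin_le_nhds (ho.mem_nhds hmin)
    obtain ⟨v, hv, hv'⟩ := (h1.and self_mem_nhdsWithin).exists
    exact ⟨v, hv, hv'⟩
  obtain ⟨b, hbI, hb⟩ : ∃ b ∈ I, max c x₀ < b := by
    have h1 : ∀ᶠ v in 𝓝[>] (max c x₀), v ∈ I := nhdsWithin_le_nhds (ho.mem_nhds hmax)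
    obtain ⟨v, hv, hv'⟩ := (h1.and self_mem_nhdsWithin).exists
    exact ⟨v, hv, hv'⟩
  obtain ⟨hac, hax⟩ := lt_min_iff.1 ha
  obtain ⟨hcb, hxb⟩ := max_lt_iff.1 hb
  have hab : a ≤ b := (hac.trans hcb).le
  have hsub : Set.Icc a b ⊆ I := hI.out haI hbI
  -- Clamping y to the compact interval [a, b], which contains c and a neighbourhood of x₀, gives a
  -- globally continuous integrand that agrees with `w` where it is needed.
  have hW : Continuous (Function.uncurry fun (p : ℝ × ℝ) (y : ℝ) =>
      w (p.1, (Set.projIcc a b hab y : ℝ))) := by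
    refine hw.comp_continuous (f := fun q : (ℝ × ℝ) × ℝ =>
      ((q.1.1, (Set.projIcc a b hab q.2 : ℝ)) : ℝ × ℝ)) ?_ fun q => ⟨trivial, hsub (Subtype.coe_prop _)⟩
    exact (continuous_fst.comp continuous_fst).prodMk
      (continuous_subtype_val.comp (continuous_projIcc.comp continuous_snd))
  have hcont := intervalIntegral.continuous_parametric_intervalIntegral_of_continuous
    (a₀ := c) (μ := MeasureTheory.volume) hW continuous_snd
  refine (hcont.continuousAt.congr ?_).continuousWithinAt
  filter_upwards [continuousAt_snd.eventually (Ioo_mem_nhds hax hxb)] with p hp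
  refine intervalIntegral.integral_congr fun y hy => ?_
  have hy' : y ∈ Set.Icc a b :=
    Set.uIcc_subset_Icc ⟨hac.le, hcb.le⟩ (Set.Ioo_subset_Icc_self hp) hy
  simp only [Set.projIcc_of_mem hab hy']

/-- The reciprocals of the solutions `ψ` of the equation `(g ψ_x / ψ²)_x = 0` with the first
integral `C`. -/
noncomputable def recipSol (d C x₀ : ℝ) (θ : ArbElem) (x : ℝ) : ℝ :=
  d - C * ∫ y in x₀..x, (θ.g y)⁻¹

section recipSol

variable {d C x₀ : ℝ} {θ : ArbElem}

theorem hasDerivAt_recipSol (hx₀ : x₀ ∈ θ.I) {x : ℝ} (hx : x ∈ θ.I) :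
    HasDerivAt (recipSol d C x₀ θ) (-(C / θ.g x)) x := by
  have h1 := hasDerivAt_integral θ.isOpen_I θ.ordConnected_I
    (θ.smooth_g.continuousOn.inv₀ θ.g_ne_zero) hx₀ hx
  exact ((h1.const_mul C).const_sub d).congr_deriv (by rw [div_eq_mul_inv, Pi.inv_apply])

theorem continuousOn_recipSol (hx₀ : x₀ ∈ θ.I) : ContinuousOn (recipSol d C x₀ θ) θ.I :=
  fun _ hx => (hasDerivAt_recipSol hx₀ hx).continuousAt.continuousWithinAt

theorem contDiffOn_recipSol (hx₀ : x₀ ∈ θ.I) : ContDiffOn ℝ ∞ (recipSol d C x₀ θ) θ.I := by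
  refine (contDiffOn_infty_iff_deriv_of_isOpen θ.isOpen_I).2
    ⟨fun x hx => (hasDerivAt_recipSol hx₀ hx).differentiableAt.differentiableWithinAt, ?_⟩
  have h1 : ContDiffOn ℝ ∞ (fun x => -(C / θ.g x)) θ.I :=
    (contDiffOn_const.div θ.smooth_g θ.g_ne_zero).neg
  exact h1.congr fun x hx => (hasDerivAt_recipSol hx₀ hx).deriv

/-- The derivative -C/g never changes strict sign on the interval, so the function is monotone. A
gap in the positivity set would give mean-value slopes of opposite signs, although their product is
a square divided by g(ξ)g(η) > 0. -/
theorem ordConnected_recipSol_pos (hx₀ : x₀ ∈ θ.I) :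
    {x ∈ θ.I | 0 < d * recipSol d C x₀ θ x}.OrdConnected := by
  refine ⟨fun a ha b hb x hx => ?_⟩
  have hab : Set.Icc a b ⊆ θ.I := θ.ordConnected_I.out ha.1 hb.1
  refine ⟨hab hx, ?_⟩
  by_contra hneg
  have hax : a < x := hx.1.lt_of_ne fun h => hneg (h ▸ ha.2)
  have hxb : x < b := hx.2.lt_of_ne fun h => hneg (h ▸ hb.2)
  have hd : ∀ y ∈ θ.I, HasDerivAt (fun x => d * recipSol d C x₀ θ x) (d * -(C / θ.g y)) y :=
    fun y hy => (hasDerivAt_recipSol hx₀ hy).const_mul d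
  have hc : ContinuousOn (fun x => d * recipSol d C x₀ θ x) θ.I := fun y hy =>
    (hd y hy).continuousAt.continuousWithinAt
  have hsub1 : Set.Icc a x ⊆ θ.I := (Set.Icc_subset_Icc_right hx.2).trans hab
  have hsub2 : Set.Icc x b ⊆ θ.I := (Set.Icc_subset_Icc_left hx.1).trans hab
  obtain ⟨ξ, hξ, h1⟩ := exists_hasDerivAt_eq_slope _ _ hax (hc.mono hsub1) fun y hy =>
    hd y (hsub1 (Set.Ioo_subset_Icc_self hy))
  obtain ⟨η, hη, h2⟩ := exists_hasDerivAt_eq_slope _ _ hxb (hc.mono hsub2) fun y hy =>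
    hd y (hsub2 (Set.Ioo_subset_Icc_self hy))
  have hξI := hsub1 (Set.Ioo_subset_Icc_self hξ)
  have hηI := hsub2 (Set.Ioo_subset_Icc_self hη)
  have hpos := mul_pos_of_isPreconnected θ.ordConnected_I.isPreconnected
    θ.smooth_g.continuousOn θ.g_ne_zero hξI hηI
  have n1 : d * -(C / θ.g ξ) < 0 := by
    rw [h1]; exact div_neg_of_neg_of_pos (by linarith [ha.2]) (by linarith)
  have n2 : 0 < d * -(C / θ.g η) := by
    rw [h2]; exact div_pos (by linarith [hb.2]) (by linarith)
  have n3 := mul_neg_of_neg_of_pos n1 n2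
  have n4 : d * -(C / θ.g ξ) * (d * -(C / θ.g η)) = (d * C) ^ 2 / (θ.g ξ * θ.g η) := by
    have := θ.g_ne_zero _ hξI
    have := θ.g_ne_zero _ hηI
    field_simp
  rw [n4] at n3
  exact absurd n3 (not_lt.2 (by positivity))

theorem recipSol_self : recipSol d C x₀ θ x₀ = d := by simp [recipSol]

/-- Every solution of the equation `(g ψ_x / ψ²)_x = 0` is of this form. -/
theorem recipSol_eq_inv {J : Set ℝ} (ho : IsOpen J) (hJ : IsPreconnected J) (hsub : J ⊆ θ.I)
    {ψ : ℝ → ℝ} (hψ : ContDiffOn ℝ ∞ ψ J) (hψ0 : ∀ x ∈ J, ψ x ≠ 0)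
    (hC : ∀ x ∈ J, θ.g x * deriv ψ x / ψ x ^ 2 = C) (hx₀ : x₀ ∈ J) {x : ℝ} (hx : x ∈ J) :
    recipSol (ψ x₀)⁻¹ C x₀ θ x = (ψ x)⁻¹ := by
  have h1 := eq_of_hasDerivAt_zero ho hJ
    (f := fun x => recipSol (ψ x₀)⁻¹ C x₀ θ x - (ψ x)⁻¹) (fun y hy => ?_) hx hx₀
  · simp only [recipSol_self, sub_self] at h1
    exact sub_eq_zero.1 h1
  · refine ((hasDerivAt_recipSol (hsub hx₀) (hsub hy)).fun_sub
      ((hasDerivAt_of_contDiffOn ho hψ hy).fun_inv (hψ0 y hy))).congr_deriv ?_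
    rw [← hC y hy]
    have n1 := hψ0 y hy
    have n2 := θ.g_ne_zero y (hsub hy)
    field_simp
    ring

end recipSol

theorem isTransDomain_halfSpace (θ : ArbElem) :
    IsTransDomain θ {z : ℝ × ℝ × ℝ | z.2.1 ∈ θ.I ∧ 0 < z.2.2} := by
  have hI : Convex ℝ θ.I := θ.ordConnected_I.convex
  have e1 : {z : ℝ × ℝ × ℝ | z.2.1 ∈ θ.I ∧ 0 < z.2.2} = Set.univ ×ˢ θ.I ×ˢ Set.Ioi 0 := by
    ext z; simp
  refine ⟨?_, ?_, fun x => ?_, fun z hz => hz.1, fun z hz => hz.2.ne'⟩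
  · rw [e1]; exact isOpen_univ.prod (θ.isOpen_I.prod isOpen_Ioi)
  · rw [e1]
    exact isConnected_univ.prod
      ((show IsConnected θ.I from ⟨θ.nonempty_I, hI.isPreconnected⟩).prod isConnected_Ioi)
  · by_cases hx : x ∈ θ.I
    · have e2 : {p : ℝ × ℝ | (p.1, x, p.2) ∈ {z : ℝ × ℝ × ℝ | z.2.1 ∈ θ.I ∧ 0 < z.2.2}} =
          Set.univ ×ˢ Set.Ioi 0 := by
        ext p; simp [hx]
      rw [e2]; exact isPreconnected_univ.prod isPreconnected_Ioi
    · simpa [hx] using isPreconnected_empty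

theorem hasListedForm_id {θ : ArbElem} {Ω : Set (ℝ × ℝ × ℝ)} (hΩ : IsTransDomain θ Ω) :
    ∃ θ', HasListedForm θ θ' Ω id := by
  refine exists_target hΩ (δ₁ := 1) (δ₂ := 0) (φ := fun x => x) (ψ := fun _ => 1) one_ne_zero
    contDiffOn_id (by simp) contDiffOn_const (by simp) (by simp) (by simp)

/-- The transformations with fixed parameters `δ₁`, `δ₂`, `φ`, for which the parameter `ψ` is the
solution of its equation with fixed values of the first integral and at the point `x₀`. -/
theorem exists_listedForm_recipSol {θ : ArbElem} {Ω : Set (ℝ × ℝ × ℝ)} (hΩ : IsTransDomain θ Ω)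
    {δ₁ δ₂ d C x₀ : ℝ} {φ : ℝ → ℝ} (hδ₁ : δ₁ ≠ 0) (hd : d ≠ 0)
    (hφ : ContDiffOn ℝ ∞ φ (xProj Ω)) (hφ' : ∀ x ∈ xProj Ω, deriv φ x ≠ 0) (hx₀ : x₀ ∈ xProj Ω) :
    IsTransDomain θ {z ∈ Ω | 0 < d * recipSol d C x₀ θ z.2.1} ∧
    ∃ θ', HasListedForm θ θ' {z ∈ Ω | 0 < d * recipSol d C x₀ θ z.2.1}
      (fun z => (δ₁ * z.1 + δ₂, φ z.2.1, z.2.2 / recipSol d C x₀ θ z.2.1)) := by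
  have hx₀' := hΩ.xProj_subset hx₀
  -- The domain is cut down to the interval around x₀ where `recipSol` keeps the sign of its value d
  -- at x₀, so that its reciprocal is smooth and nonvanishing there.
  have hop : IsOpen {x ∈ θ.I | 0 < d * recipSol d C x₀ θ x} :=
    (continuousOn_const.mul (continuousOn_recipSol hx₀')).isOpen_inter_preimage θ.isOpen_I
      isOpen_Ioi
  have hdom : {z ∈ Ω | 0 < d * recipSol d C x₀ θ z.2.1} =
      {z ∈ Ω | z.2.1 ∈ {x ∈ θ.I | 0 < d * recipSol d C x₀ θ x}} := by
    ext z
    exact ⟨fun h => ⟨h.1, hΩ.mem_I z h.1, h.2⟩, fun h => ⟨h.1, h.2.2⟩⟩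
  have hD : IsTransDomain θ {z ∈ Ω | 0 < d * recipSol d C x₀ θ z.2.1} := by
    rw [hdom]
    refine hΩ.restrict (hΩ.isOpen_xProj.inter hop)
      ((hΩ.isPreconnected_xProj.ordConnected.inter
        (ordConnected_recipSol_pos hx₀')).isPreconnected) ⟨x₀, hx₀, hx₀', ?_⟩
    rw [recipSol_self]; exact mul_self_pos.2 hd
  have hsubΩ : xProj {z ∈ Ω | 0 < d * recipSol d C x₀ θ z.2.1} ⊆ xProj Ω :=
    Set.image_mono fun z hz => hz.1
  have hne : ∀ x ∈ xProj {z ∈ Ω | 0 < d * recipSol d C x₀ θ z.2.1},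
      recipSol d C x₀ θ x ≠ 0 := by
    rintro _ ⟨z, hz, rfl⟩
    exact right_ne_zero_of_mul hz.2.ne'
  refine ⟨hD, exists_target hD (δ₁ := δ₁) (δ₂ := δ₂) (φ := φ)
    (ψ := fun x => (recipSol d C x₀ θ x)⁻¹) hδ₁ (hφ.mono hsubΩ) (fun x hx => hφ' x (hsubΩ hx))
    (((contDiffOn_recipSol hx₀').mono hD.xProj_subset).inv hne) (fun x hx => inv_ne_zero (hne x hx))
    (fun x hx => deriv_eq_zero_of_eqOn hD.isOpen_xProj (C := C) (fun y hy => ?_) hx)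
    fun t x u hz => ?_⟩
  · rw [((hasDerivAt_recipSol hx₀' (hD.xProj_subset hy)).fun_inv (hne y hy)).deriv]
    have n1 := hne y hy
    have n2 := θ.g_ne_zero y (hD.xProj_subset hy)
    field_simp
  · simp only [div_eq_inv_mul]

/-- The equation for ψ depends on g, so the given ψ cannot be kept for other θ. Keeping instead its
first integral C and its value at x₀ yields a ψ for every θ on the same interval, depending on θ
only through ∫ 1/g and therefore continuously. The new arbitrary elements may be chosen separately
for each θ, because continuity is required of the maps only. -/
theorem exists_mem_group_of_hasListedForm {θ₀ θ' : ArbElem} {Ω : Set (ℝ × ℝ × ℝ)}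
    {F : ℝ × ℝ × ℝ → ℝ × ℝ × ℝ} (hΩ : IsTransDomain θ₀ Ω) (h : HasListedForm θ₀ θ' Ω F) :
    ∃ Φ ∈ generalizedExtendedEquivalenceGroup,
      Φ.arb θ₀ = θ' ∧ Φ.dom θ₀ = Ω ∧ Set.EqOn (Φ.toFun θ₀) F Ω := by
  classical
  obtain ⟨δ₀, δ₁, δ₂, φ, ψ, hδ, hφ, hφ', hψ, hψ0, hode, hF, -⟩ := id h
  have hδ₁ : δ₁ ≠ 0 := right_ne_zero_of_mul hδ
  have ho := hΩ.isOpen_xProj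
  have hpc := hΩ.isPreconnected_xProj
  obtain ⟨C, hC⟩ := exists_first_integral ho hpc hΩ.xProj_subset hψ hψ0 hode
  obtain ⟨x₀, hx₀⟩ : (xProj Ω).Nonempty := hΩ.isConnected.nonempty.image _
  obtain ⟨d, hd⟩ : ∃ d, d = (ψ x₀)⁻¹ := ⟨_, rfl⟩
  have hd0 : d ≠ 0 := hd ▸ inv_ne_zero (hψ0 x₀ hx₀)
  have hrec : ∀ x ∈ xProj Ω, recipSol d C x₀ θ₀ x = (ψ x)⁻¹ := fun x hx => by
    rw [hd]; exact recipSol_eq_inv ho hpc hΩ.xProj_subset hψ hψ0 hC hx₀ hx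
  let dom : ArbElem → Set (ℝ × ℝ × ℝ) := fun θ =>
    if θ.I = θ₀.I then {z ∈ Ω | 0 < d * recipSol d C x₀ θ z.2.1}
    else {z | z.2.1 ∈ θ.I ∧ 0 < z.2.2}
  let fn : ArbElem → ℝ × ℝ × ℝ → ℝ × ℝ × ℝ := fun θ =>
    if θ.I = θ₀.I then fun z => (δ₁ * z.1 + δ₂, φ z.2.1, z.2.2 / recipSol d C x₀ θ z.2.1)
    else id
  have dom_pos : ∀ θ : ArbElem, θ.I = θ₀.I →
      dom θ = {z ∈ Ω | 0 < d * recipSol d C x₀ θ z.2.1} := fun θ hθ => if_pos hθ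
  have fn_pos : ∀ θ : ArbElem, θ.I = θ₀.I → fn θ =
      fun z => (δ₁ * z.1 + δ₂, φ z.2.1, z.2.2 / recipSol d C x₀ θ z.2.1) := fun θ hθ => if_pos hθ
  have dom_neg : ∀ θ : ArbElem, θ.I ≠ θ₀.I → dom θ = {z | z.2.1 ∈ θ.I ∧ 0 < z.2.2} :=
    fun θ hθ => if_neg hθ
  have fn_neg : ∀ θ : ArbElem, θ.I ≠ θ₀.I → fn θ = id := fun θ hθ => if_neg hθ
  -- For θ₀ nothing is cut away, since ψ has constant sign on the connected projection of `Ω`.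
  have dom₀ : dom θ₀ = Ω := by
    rw [dom_pos θ₀ rfl]
    refine Set.Subset.antisymm (fun z hz => hz.1) fun z hz => ⟨hz, ?_⟩
    have hzx : z.2.1 ∈ xProj Ω := ⟨z, hz, rfl⟩
    rw [hrec _ hzx, hd, ← mul_inv]
    exact inv_pos.2 (mul_pos_of_isPreconnected hpc hψ.continuousOn hψ0 hx₀ hzx)
  have fn₀ : Set.EqOn (fn θ₀) F Ω := by
    rintro ⟨t, x, u⟩ hz
    rw [fn_pos θ₀ rfl, hF t x u hz]
    simp only [hrec x (mem_xProj hz), div_inv_eq_mul, mul_comm u]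
  have key : ∀ θ : ArbElem, IsTransDomain θ (dom θ) ∧
      ∃ θ'', HasListedForm θ θ'' (dom θ) (fn θ) ∧ (θ = θ₀ → θ'' = θ') := by
    intro θ
    by_cases hθ₀ : θ = θ₀
    · subst hθ₀
      rw [dom₀]
      exact ⟨hΩ, θ', h.congr fn₀, fun _ => rfl⟩
    have key' : IsTransDomain θ (dom θ) ∧ ∃ θ'', HasListedForm θ θ'' (dom θ) (fn θ) := by
      by_cases hθ : θ.I = θ₀.I
      · rw [dom_pos θ hθ, fn_pos θ hθ]
        have hΩ' : IsTransDomain θ Ω := { hΩ with mem_I := fun z hz => hθ ▸ hΩ.mem_I z hz }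
        exact exists_listedForm_recipSol hΩ' hδ₁ hd0 hφ hφ' hx₀
      · rw [dom_neg θ hθ, fn_neg θ hθ]
        exact ⟨isTransDomain_halfSpace θ, hasListedForm_id (isTransDomain_halfSpace θ)⟩
    obtain ⟨h1, θ'', h2⟩ := key'
    exact ⟨h1, θ'', h2, fun h => (hθ₀ h).elim⟩
  choose hdom arb harb harb₀ using key
  refine ⟨⟨arb, dom, fn, hdom⟩, ⟨?_, fun θ => isAdmissible_of_hasListedForm (hdom θ) (harb θ)⟩,
    harb₀ θ₀ rfl, dom₀, fn₀⟩
  -- A smooth curve of arbitrary elements keeps its interval fixed, so it stays within one of the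
  -- two branches of the definition.
  intro I θ hθ
  by_cases hI : I = θ₀.I
  · have hI' : ∀ s, (θ s).I = θ₀.I := fun s => (hθ.I_eq s).trans hI
    have hIo : IsOpen I := hI ▸ θ₀.isOpen_I
    have hx₀I : x₀ ∈ I := hI ▸ hΩ.xProj_subset hx₀
    have hcont : ContinuousOn (fun p : ℝ × ℝ => recipSol d C x₀ (θ p.1) p.2) (Set.univ ×ˢ I) := by
      have h1 : ContinuousOn (fun p : ℝ × ℝ => ((θ p.1).g p.2)⁻¹) (Set.univ ×ˢ I) :=
        hθ.smooth_g.continuousOn.inv₀ fun p hp =>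
          (θ p.1).g_ne_zero _ ((hθ.I_eq p.1).symm ▸ hp.2)
      exact continuousOn_const.sub (continuousOn_const.mul
        (continuousOn_integral_param hIo (hI ▸ θ₀.ordConnected_I) h1 hx₀I))
    have hcont' : ContinuousOn (fun p : ℝ × ℝ × ℝ × ℝ => recipSol d C x₀ (θ p.1) p.2.2.1)
        {p | p.2 ∈ Ω} :=
      hcont.comp (f := fun p : ℝ × ℝ × ℝ × ℝ => (p.1, p.2.2.1)) (by fun_prop) fun p hp =>
        ⟨trivial, hI ▸ hΩ.mem_I _ hp⟩
    have hset : {p : ℝ × ℝ × ℝ × ℝ | p.2 ∈ dom (θ p.1)} =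
        {p | p.2 ∈ Ω} ∩ (fun p => d * recipSol d C x₀ (θ p.1) p.2.2.1) ⁻¹' Set.Ioi 0 := by
      ext p
      simp only [Set.mem_ofPred_eq, dom_pos _ (hI' p.1)]
      rfl
    refine ⟨?_, ?_⟩
    · change IsOpen {p : ℝ × ℝ × ℝ × ℝ | p.2 ∈ dom (θ p.1)}
      rw [hset]
      exact (continuousOn_const.mul hcont').isOpen_inter_preimage
        (hΩ.isOpen.preimage continuous_snd) isOpen_Ioi
    · change ContinuousOn (fun p : ℝ × ℝ × ℝ × ℝ => fn (θ p.1) p.2)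
        {p : ℝ × ℝ × ℝ × ℝ | p.2 ∈ dom (θ p.1)}
      rw [hset]
      simp only [fn_pos _ (hI' _)]
      have h1 : ContinuousOn (fun p : ℝ × ℝ × ℝ × ℝ => φ p.2.2.1) {p | p.2 ∈ Ω} :=
        hφ.continuousOn.comp (by fun_prop) fun p hp => ⟨p.2, hp, rfl⟩
      refine ContinuousOn.prodMk (by fun_prop) ((h1.mono Set.inter_subset_left).prodMk
        (ContinuousOn.div (by fun_prop) (hcont'.mono Set.inter_subset_left) fun p hp =>
          right_ne_zero_of_mul (ne_of_gt hp.2)))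
  · have hI' : ∀ s, (θ s).I ≠ θ₀.I := fun s hs => hI ((hθ.I_eq s).symm.trans hs)
    refine ⟨?_, ?_⟩
    · have hset : {p : ℝ × ℝ × ℝ × ℝ | p.2 ∈ dom (θ p.1)} =
          Prod.snd ⁻¹' {z : ℝ × ℝ × ℝ | z.2.1 ∈ (θ 0).I ∧ 0 < z.2.2} := by
        ext p
        simp only [Set.mem_ofPred_eq, dom_neg _ (hI' p.1), hθ.I_eq, Set.mem_preimage]
      change IsOpen {p : ℝ × ℝ × ℝ × ℝ | p.2 ∈ dom (θ p.1)}
      rw [hset]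
      exact (isTransDomain_halfSpace (θ 0)).isOpen.preimage continuous_snd
    · change ContinuousOn (fun p : ℝ × ℝ × ℝ × ℝ => fn (θ p.1) p.2) _
      simp only [fn_neg _ (hI' _), id]
      exact continuousOn_snd

end RDPower

theorem mainTheorem8 :
    -- the group consists exactly of the transformations of the listed form
    (∀ Φ : RDPower.TransFamily,
      Φ ∈ RDPower.generalizedExtendedEquivalenceGroup ↔
        Φ.DependsContinuously ∧
          ∀ θ, RDPower.HasListedForm θ (Φ.arb θ) (Φ.dom θ) (Φ.toFun θ)) ∧
    -- for every equation, all values of the parameters `δ₀, δ₁, δ₂, φ, ψ` are realized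
    (∀ (θ θ' : RDPower.ArbElem) (Ω : Set (ℝ × ℝ × ℝ)) (F : ℝ × ℝ × ℝ → ℝ × ℝ × ℝ),
      RDPower.IsTransDomain θ Ω → RDPower.HasListedForm θ θ' Ω F →
        ∃ Φ ∈ RDPower.generalizedExtendedEquivalenceGroup,
          Φ.arb θ = θ' ∧ Φ.dom θ = Ω ∧ Set.EqOn (Φ.toFun θ) F Ω) ∧
    -- the listed transformations are closed under inversion and composition
    (∀ (θ θ' : RDPower.ArbElem) (Ω : Set (ℝ × ℝ × ℝ)) (F : ℝ × ℝ × ℝ → ℝ × ℝ × ℝ),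
      RDPower.IsTransDomain θ Ω → RDPower.HasListedForm θ θ' Ω F →
        RDPower.IsTransDomain θ' (F '' Ω) ∧
        RDPower.HasListedForm θ' θ (F '' Ω) (Function.invFunOn F Ω)) ∧
    (∀ (θ θ' θ'' : RDPower.ArbElem) (Ω Ω' : Set (ℝ × ℝ × ℝ)) (F F' : ℝ × ℝ × ℝ → ℝ × ℝ × ℝ),
      RDPower.IsTransDomain θ Ω → RDPower.HasListedForm θ θ' Ω F →
      RDPower.IsTransDomain θ' Ω' → RDPower.HasListedForm θ' θ'' Ω' F' →
      Set.MapsTo F Ω Ω' →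
        RDPower.HasListedForm θ θ'' Ω (F' ∘ F)) := by
  refine ⟨fun Φ => ⟨fun hΦ => ⟨hΦ.1, fun θ => ?_⟩, fun h => ⟨h.1, fun θ => ?_⟩⟩, ?_, ?_, ?_⟩
  · exact RDPower.hasListedForm_of_hasForm (Φ.isTransDomain θ) (hΦ.2 θ)
      (RDPower.hasForm_of_mem_group hΦ θ)
  · exact RDPower.isAdmissible_of_hasListedForm (Φ.isTransDomain θ) (h.2 θ)
  · exact fun θ θ' Ω F hΩ h => RDPower.exists_mem_group_of_hasListedForm hΩ h
  · exact fun θ θ' Ω F hΩ h =>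
      ⟨RDPower.isTransDomain_image hΩ h, RDPower.hasListedForm_inverse hΩ h⟩
  · exact fun θ θ' θ'' Ω Ω' F F' hΩ h hΩ' h' hmap => h.comp hΩ hΩ' h' hmap
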